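/- Logarithms are to base 2. For $N\ge 0$ and a finite-dimensional space $\mathcal K$, an $N$-partite state is a density operator (positive semidefinite, trace one) on $\mathcal K^{\otimes N}$, and $\mathrm{SEP}$ is the set of fully separable states, i.e. of finite convex mixtures of states $\sigma^1\otimes\cdots\otimes\sigma^N$ with $\sigma^1,\dots,\sigma^N$ density operators on $\mathcal K$. For an $N$-partite state $\rho$ define - the relative entropy of entanglement (REE) $E_{\mathrm R}(\rho)=\min_{\sigma\in\mathrm{SEP}}S(\rho\|\sigma)$, where $S(\rho\|\sigma)=\mathrm{tr}\,\rho(\log\rho-\log\sigma)$ if $\mathrm{supp}\,\rho\subseteq\mathrm{supp}\,\sigma$ and $S(\rho\|\sigma)=+\infty$ otherwise; - the geometric measure (GM) $G(\rho)=-2\log\Lambda(\rho)$, where $\Lambda(\rho)\ge 0$ and $\Lambda^2(\rho)=\max_{\sigma\in\mathrm{SEP}}\mathrm{tr}(\rho\sigma)$; - the logarithmic global robustness (LGR) $R_{\mathrm L}(\rho)=\log(1+R_{\mathrm g}(\rho))$, where $R_{\mathrm g}(\rho)=\min\{t\ge 0:\ (\rho+t\Delta)/(1+t)\in\mathrm{SEP}\text{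 for some state }\Delta\}$. The $n$-copy state $\rho^{\otimes n}$ is regarded as an $N$-partite state over $\mathcal K^{\otimes n}$ whose $j$-th party holds the $j$-th particles of all $n$ copies. For $E\in\{G,E_{\mathrm R},R_{\mathrm L}\}$ put $E^\infty(\rho)=\lim_{n\to\infty}\frac1n E(\rho^{\otimes n})$; $E$ of $\rho$ is additive if $E^\infty(\rho)=E(\rho)$ and non-additive if the limit $E^\infty(\rho)$ exists and $E^\infty(\rho)\neq E(\rho)$. **Proposition.** Let $N\le d$. For orthonormal $|a_1\rangle,\dots,|a_N\rangle\in\mathbb C^d$, the Slater determinant state is $$|a_1\rangle\wedge\cdots\wedge|a_N\rangle=\frac1{\sqrt{N!}}\sum_{\pi\in S_N}\mathrm{sgn}(\pi)\,|a_{\pi(1)}\rangle\otimes\cdots\otimes|a_{\pi(N)}\rangle .$$ Let $\rho_N=\sum_i p_i|\psi_i\rangle\langle\psi_i|$ be any finite convex mixture of such states $|\psi_i\rangle$ ($p_i\ge0$, $\sum_ip_i=1$). Then $$E_{\mathrm R}(\rho_N)=R_{\mathrm L}(\rho_N)=\log N!,$$ $$\log\frac{d^N\,N!\,(d-N)!}{d!}\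 \le\ E_{\mathrm R}(\rho_N^{\otimes2})\ \le\ R_{\mathrm L}(\rho_N^{\otimes2})\ \le\ N\log N$$ (with $0\log 0=0$). If moreover $N\ge3$, then GM, REE and LGR of $\rho_N$ are all non-additive, and already $E(\rho_N^{\otimes2})<2E(\rho_N)$ for each $E\in\{G,E_{\mathrm R},R_{\mathrm L}\}$. -/

import Mathlib

open Filter Topology
open scoped Nat ComplexOrder

/-! `N`-partite states whose parties all have single-particle Hilbert space `ℂ^α` are represented
by matrices indexed by the computational basis `Fin N → α` of `(ℂ^α)^{⊗N}`. -/

namespace MultipartiteEntanglement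

/-- A density matrix: positive semidefinite with unit trace. -/
def IsDensityMatrix {n : Type*} [Fintype n] (ρ : Matrix n n ℂ) : Prop :=
  ρ.PosSemidef ∧ ρ.trace = 1

/-- The rank-one operator `|ψ⟩⟨ψ|`. -/
def ketBra {n : Type*} (ψ : n → ℂ) : Matrix n n ℂ :=
  Matrix.vecMulVec ψ (star ψ)

/-- The tensor product `τ₁ ⊗ ⋯ ⊗ τ_N` of single-particle operators. -/
def productOperator {N : ℕ} {α : Type*} (τ : Fin N → Matrix α α ℂ) :
    Matrix (Fin N → α) (Fin N → α) ℂ :=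
  Matrix.of fun x y => ∏ j, τ j (x j) (y j)

/-- The set of fully separable `N`-partite states: convex mixtures of tensor products of
single-particle states. -/
def separableStates (N : ℕ) (α : Type*) [Fintype α] : Set (Matrix (Fin N → α) (Fin N → α) ℂ) :=
  convexHull ℝ {σ | ∃ τ : Fin N → Matrix α α ℂ,
    (∀ j, IsDensityMatrix (τ j)) ∧ σ = productOperator τ}

open Classical in
/-- Quantum relative entropy `S(ρ‖σ) = tr ρ (log ρ - log σ)` with base-2 logarithm, equal to `+∞`
unless the support of `ρ` is contained in that of `σ` (i.e. `ker σ ⊆ ker ρ`). The convention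
`Real.logb 2 0 = 0` implements `0 log 0 = 0`. -/
noncomputable def relativeEntropy {n : Type*} [Fintype n] [DecidableEq n] (ρ σ : Matrix n n ℂ) :
    EReal :=
  if ∀ v : n → ℂ, σ.mulVec v = 0 → ρ.mulVec v = 0 then
    (((ρ * (cfc (Real.logb 2) ρ - cfc (Real.logb 2) σ)).trace.re : ℝ) : EReal)
  else ⊤

/-- Relative entropy of entanglement (REE). -/
noncomputable def relEntropyEntanglement {N : ℕ} {α : Type*} [Fintype α] [DecidableEq α]
    (ρ : Matrix (Fin N → α) (Fin N → α) ℂ) : EReal :=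
  ⨅ σ ∈ separableStates N α, relativeEntropy ρ σ

/-- The maximal overlap `Λ²(ρ) = max_{σ ∈ SEP} tr(ρσ)`. -/
noncomputable def maxOverlapSq {N : ℕ} {α : Type*} [Fintype α]
    (ρ : Matrix (Fin N → α) (Fin N → α) ℂ) : ℝ :=
  sSup ((fun σ => (ρ * σ).trace.re) '' separableStates N α)

/-- Geometric measure of entanglement (GM), `G(ρ) = -2 log Λ(ρ)`. -/
noncomputable def geometricMeasure {N : ℕ} {α : Type*} [Fintype α]
    (ρ : Matrix (Fin N → α) (Fin N → α) ℂ) : ℝ :=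
  -2 * Real.logb 2 (Real.sqrt (maxOverlapSq ρ))

/-- Global robustness of entanglement. -/
noncomputable def globalRobustness {N : ℕ} {α : Type*} [Fintype α]
    (ρ : Matrix (Fin N → α) (Fin N → α) ℂ) : ℝ :=
  sInf {t : ℝ | 0 ≤ t ∧ ∃ Δ : Matrix (Fin N → α) (Fin N → α) ℂ,
    IsDensityMatrix Δ ∧ (1 + t)⁻¹ • (ρ + t • Δ) ∈ separableStates N α}

/-- Logarithmic global robustness of entanglement (LGR). -/
noncomputable def logGlobalRobustness {N : ℕ} {α : Type*} [Fintype α]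
    (ρ : Matrix (Fin N → α) (Fin N → α) ℂ) : ℝ :=
  Real.logb 2 (1 + globalRobustness ρ)

/-- The `n`-copy state `ρ^{⊗n}`, regarded as an `N`-partite state whose `j`-th party holds the
`j`-th particle of every copy. -/
def tensorPower {N : ℕ} {α : Type*} (ρ : Matrix (Fin N → α) (Fin N → α) ℂ) (n : ℕ) :
    Matrix (Fin N → (Fin n → α)) (Fin N → (Fin n → α)) ℂ :=
  Matrix.of fun x y => ∏ k, ρ (fun j => x j k) (fun j => y j k)

/-- The entanglement measure `E` of the state `ρ` is non-additive: the regularized measure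
`E^∞(ρ) = lim E(ρ^{⊗n}) / n` exists as a (finite) real number and differs from `E(ρ)`. -/
def IsNonadditive {N : ℕ}
    (E : ∀ (α : Type) [Fintype α] [DecidableEq α], Matrix (Fin N → α) (Fin N → α) ℂ → EReal)
    {α : Type} [Fintype α] [DecidableEq α] (ρ : Matrix (Fin N → α) (Fin N → α) ℂ) : Prop :=
  ∃ l : ℝ, Tendsto (fun n : ℕ => E (Fin n → α) (tensorPower ρ n) / (n : EReal)) atTop
    (𝓝 (l : EReal)) ∧ (l : EReal) ≠ E α ρ

/-- The wedge product
`|a₁⟩ ∧ ⋯ ∧ |a_N⟩ = (N!)^{-1/2} ∑_π sgn(π) |a_{π(1)}, …, a_{π(N)}⟩`; it is a Slater determinant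
state when `a₁, …, a_N` are orthonormal. -/
noncomputable def slaterKet {N : ℕ} {α : Type*} (a : Fin N → EuclideanSpace ℂ α) :
    (Fin N → α) → ℂ :=
  fun x => ((Real.sqrt (N ! : ℝ) : ℝ) : ℂ)⁻¹ *
    ∑ π : Equiv.Perm (Fin N), ((Equiv.Perm.sign π : ℤ) : ℂ) * ∏ j, a (π j) (x j)

end MultipartiteEntanglement

open MultipartiteEntanglement

/-! One copy. A mixture of Slater states is supported on the totally antisymmetric space. Its
projection `P` sends a unit product vector to a Slater vector divided by `√N!`, of norm at most
`1/√N!` by Hadamard's inequality (`slaterKet_eq_smul`). Testing with `P` therefore gives `S(ρ‖σ) ≥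
-log tr Pσ ≥ log N!` for separable `σ`. Conversely, a Slater vector is an average over permutations
of product vectors with coefficients of modulus `√N!`, and Cauchy–Schwarz dominates its projector by
`N!` times a separable state (`exists_separable_of_average`). Relative entropy is at most
max-relative entropy, so REE ≤ LGR and the bounds meet.

Two copies, upper bound. Each party holds two particles, so local vectors may be entangled across
the copies. A pair of Slater vectors is an average over permutations `τ` and signs of powers
`φ^{⊗N}`, where `φ = N^{-1/2} ∑ ± a_{τ m} ⊗ b_m`, with coefficients of modulus `N^{N/2}`
(`joinKet_slaterKet_eq_average`). This yields `N log N`.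

Two copies, lower bound. A local vector is now a `d × d` matrix of norm one, and `P ⊗ P`
antisymmetrizes the row and the column indices separately. The norm of the result is bounded one
factor at a time by `card_mul_biNormSq_biWedge_le`, an induction resting on normal ordering of the
wedge and contraction operators of a matrix.

Non-additivity. For `N ≥ 3` one has `N^N < (N!)²`, which settles REE and LGR. For GM, `ρ` sees a
product vector only through a Slater vector; if its expectation in `ρ` is `m`, the overlap is at
most `m / N!`, whereas the paired product vector over the same basis has two-copy overlap `m² /
N^N`. Subadditivity and Fekete's lemma turn the strict drop at two copies into a strict drop of the
limit. -/

namespace MultipartiteEntanglement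

/-- The sign of a permutation as a complex number. -/
def sgn {k : ℕ} (π : Equiv.Perm (Fin k)) : ℂ := ((Equiv.Perm.sign π : ℤ) : ℂ)

@[simp] lemma sgn_one {k : ℕ} : sgn (1 : Equiv.Perm (Fin k)) = 1 := by simp [sgn]

lemma sgn_mul {k : ℕ} (π τ : Equiv.Perm (Fin k)) : sgn (π * τ) = sgn π * sgn τ := by
  simp [sgn]

@[simp] lemma sgn_refl {k : ℕ} : sgn (Equiv.refl (Fin k)) = 1 := sgn_one

@[simp] lemma sgn_inv {k : ℕ} (π : Equiv.Perm (Fin k)) : sgn π⁻¹ = sgn π := by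
  simp [sgn]

@[simp] lemma star_sgn {k : ℕ} (π : Equiv.Perm (Fin k)) : star (sgn π) = sgn π := by
  simp [sgn]

@[simp] lemma sgn_mul_self {k : ℕ} (π : Equiv.Perm (Fin k)) : sgn π * sgn π = 1 := by
  rw [← sgn_mul]
  rcases Int.units_eq_one_or (Equiv.Perm.sign π) with h | h <;> simp [sgn, h]

@[simp] lemma norm_sgn {k : ℕ} (π : Equiv.Perm (Fin k)) : ‖sgn π‖ = 1 := by
  rcases Int.units_eq_one_or (Equiv.Perm.sign π) with h | h <;> simp [sgn, h]

lemma sgn_swap_succ {k : ℕ} (n : Fin k) :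
    sgn (Equiv.swap (0 : Fin (k + 1)) n.succ) = -1 := by
  simp [sgn, Equiv.Perm.sign_swap (Fin.succ_ne_zero n).symm]

lemma sgn_decomposeFin_symm {k : ℕ} (p : Fin (k + 1)) (e : Equiv.Perm (Fin k)) :
    sgn (Equiv.Perm.decomposeFin.symm (p, e)) = sgn (Equiv.swap 0 p) * sgn e := by
  refine Fin.cases ?_ (fun n => ?_) p
  · simp [sgn, Equiv.Perm.decomposeFin.symm_sign]
  · rw [sgn_swap_succ]
    simp [sgn, Equiv.Perm.decomposeFin.symm_sign]

/-- A function of `k` indices that is antisymmetric under permutations of its arguments. -/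
def Antisymmetric {k : ℕ} {α : Type*} (X : (Fin k → α) → ℂ) : Prop :=
  ∀ (π : Equiv.Perm (Fin k)) (x : Fin k → α), X (x ∘ π) = sgn π * X x

/-! ### Antisymmetric functions, creation and annihilation -/

section Antisymmetric

variable {α : Type*} {k : ℕ}

/-- Antisymmetrization over the coset representatives `swap 0 p` of the stabilizer of `0`. -/
noncomputable def cosetAlt (h : (Fin (k + 1) → α) → ℂ) (x : Fin (k + 1) → α) : ℂ :=
  ∑ p, sgn (Equiv.swap 0 p) * h (x ∘ Equiv.swap 0 p)

lemma comp_decomposeFin_symm (x : Fin (k + 1) → α) (p : Fin (k + 1)) (e : Equiv.Perm (Fin k)) :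
    x ∘ Equiv.Perm.decomposeFin.symm (p, e) =
      Fin.cons (x p) (Fin.tail (x ∘ Equiv.swap 0 p) ∘ e) := by
  funext i
  refine Fin.cases ?_ (fun n => ?_) i
  · simp
  · simp [Fin.tail]

lemma sum_perm_eq_cosetAlt (h : (Fin (k + 1) → α) → ℂ) (x : Fin (k + 1) → α) :
    ∑ π : Equiv.Perm (Fin (k + 1)), sgn π * h (x ∘ π) =
      cosetAlt (fun y => ∑ e : Equiv.Perm (Fin k),
        sgn e * h (Fin.cons (y 0) (Fin.tail y ∘ e))) x := by
  rw [← Equiv.Perm.decomposeFin.symm.sum_comp, Fintype.sum_prod_type, cosetAlt]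
  refine Finset.sum_congr rfl fun p _ => ?_
  rw [Finset.mul_sum]
  refine Finset.sum_congr rfl fun e _ => ?_
  rw [sgn_decomposeFin_symm, comp_decomposeFin_symm, mul_assoc]
  simp

/-- Within a coset of the stabilizer of `0` the antisymmetry of `h` cancels the sign, so the coset
contributes `k!` equal terms. -/
lemma cosetAlt_eq_sum_perm {h : (Fin (k + 1) → α) → ℂ}
    (hh : ∀ a, Antisymmetric fun y => h (Fin.cons a y)) (x : Fin (k + 1) → α) :
    (k ! : ℂ) * cosetAlt h x = ∑ π : Equiv.Perm (Fin (k + 1)), sgn π * h (x ∘ π) := by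
  rw [sum_perm_eq_cosetAlt, cosetAlt, cosetAlt, Finset.mul_sum]
  refine Finset.sum_congr rfl fun p _ => ?_
  have : ∀ e : Equiv.Perm (Fin k), sgn e * h (Fin.cons ((x ∘ Equiv.swap 0 p) 0)
      (Fin.tail (x ∘ Equiv.swap 0 p) ∘ e)) = h (x ∘ Equiv.swap 0 p) := fun e => by
    rw [show h (Fin.cons ((x ∘ Equiv.swap 0 p) 0) (Fin.tail (x ∘ Equiv.swap 0 p) ∘ e)) = _ from
      hh _ e _, ← mul_assoc, sgn_mul_self, one_mul]
    exact congrArg h (Fin.cons_self_tail _)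
  simp only [this, Finset.sum_const, Finset.card_univ, Fintype.card_perm, Fintype.card_fin,
    nsmul_eq_mul]
  ring

lemma antisymmetric_sum_perm (h : (Fin k → α) → ℂ) :
    Antisymmetric fun x => ∑ π : Equiv.Perm (Fin k), sgn π * h (x ∘ π) := by
  intro σ x
  simp only [Finset.mul_sum]
  rw [← Equiv.sum_comp (Equiv.mulLeft σ) fun π => sgn σ * (sgn π * h (x ∘ π))]
  refine Finset.sum_congr rfl fun π _ => ?_
  rw [Equiv.coe_mulLeft, sgn_mul, ← mul_assoc, ← mul_assoc, sgn_mul_self, one_mul]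
  rfl

lemma antisymmetric_cosetAlt {h : (Fin (k + 1) → α) → ℂ}
    (hh : ∀ a, Antisymmetric fun y => h (Fin.cons a y)) : Antisymmetric (cosetAlt h) := by
  intro π x
  have hk : (k ! : ℂ) ≠ 0 := by exact_mod_cast k.factorial_ne_zero
  apply mul_left_cancel₀ hk
  rw [mul_left_comm, cosetAlt_eq_sum_perm hh, cosetAlt_eq_sum_perm hh]
  exact antisymmetric_sum_perm h π x

/-- The anticommutation relations in coordinates: a leading `i` either stays in place or is
exchanged with an entry of `x`, at the price of a sign. -/
lemma cosetAlt_cons (h : (Fin (k + 1) → α) → ℂ) (i : α) (x : Fin k → α) :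
    cosetAlt h (Fin.cons i x) =
      h (Fin.cons i x) - ∑ n, h (Fin.cons (x n) (Function.update x n i)) := by
  rw [cosetAlt, Fin.sum_univ_succ, sub_eq_add_neg, ← Finset.sum_neg_distrib]
  congr 1
  · simp
  · refine Finset.sum_congr rfl fun n _ => ?_
    rw [sgn_swap_succ, neg_one_mul]
    congr 2
    funext m
    refine Fin.cases ?_ (fun m => ?_) m
    · simp
    · by_cases hm : m = n
      · subst hm; simp
      · simp [hm, Equiv.swap_apply_of_ne_of_ne (Fin.succ_ne_zero m)
          (fun h => hm (Fin.succ_injective _ h))]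

/-- Moving the replaced entry to the front costs the sign of a transposition, which the antisymmetry
of `X` supplies. The exchange terms of `cosetAlt_cons` thus become wedges again. -/
lemma sum_mul_update {X : (Fin (k + 1) → α) → ℂ} (hX : Antisymmetric X) (B : α → ℂ) (i : α)
    (x : Fin (k + 1) → α) :
    ∑ n, B (x n) * X (Function.update x n i) =
      cosetAlt (fun y => B (y 0) * X (Fin.cons i (Fin.tail y))) x := by
  refine Finset.sum_congr rfl fun p _ => ?_
  have : Fin.cons i (Fin.tail (x ∘ Equiv.swap 0 p)) = Function.update x p i ∘ Equiv.swap 0 p := by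
    funext m
    refine Fin.cases ?_ (fun m => ?_) m
    · simp
    · have : Equiv.swap 0 p m.succ ≠ p := by
        rw [Ne, Equiv.swap_apply_eq_iff]
        simp
      simp [Fin.tail, this]
  simp only [Function.comp_apply, Equiv.swap_apply_left, this]
  rw [hX, mul_left_comm, ← mul_assoc (sgn _), sgn_mul_self, one_mul]

lemma Antisymmetric.cons {X : (Fin (k + 1) → α) → ℂ} (hX : Antisymmetric X) (a : α) :
    Antisymmetric fun y => X (Fin.cons a y) := by
  intro e x
  have : (Fin.cons a (x ∘ e) : Fin (k + 1) → α) =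
      Fin.cons a x ∘ Equiv.Perm.decomposeFin.symm (0, e) := by
    rw [comp_decomposeFin_symm]
    simp
  simp only [this]
  rw [hX, sgn_decomposeFin_symm]
  simp

lemma Antisymmetric.sum {ι : Type*} {s : Finset ι} {X : ι → (Fin k → α) → ℂ}
    (hX : ∀ i ∈ s, Antisymmetric (X i)) : Antisymmetric fun x => ∑ i ∈ s, X i x := by
  intro π x
  simp only [Finset.mul_sum]
  exact Finset.sum_congr rfl fun i hi => hX i hi π x

lemma Antisymmetric.const_mul {X : (Fin k → α) → ℂ} (hX : Antisymmetric X) (c : ℂ) :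
    Antisymmetric fun x => c * X x := by
  intro π x
  simp only [hX π x]
  ring

variable [Fintype α]

lemma sum_fin_cons {M : Type*} [AddCommMonoid M] (f : (Fin (k + 1) → α) → M) :
    ∑ x, f x = ∑ a, ∑ y : Fin k → α, f (Fin.cons a y) := by
  rw [← (Fin.consEquiv fun _ => α).sum_comp, Fintype.sum_prod_type]
  rfl

/-- Each of the `k + 1` transpositions can be moved onto `Z`, where its sign cancels. Hence
contraction of the first slot is adjoint to `cosetAlt` up to this factor. -/
lemma sum_star_cosetAlt_mul {Z : (Fin (k + 1) → α) → ℂ} (hZ : Antisymmetric Z)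
    (h : (Fin (k + 1) → α) → ℂ) :
    ∑ x, star (cosetAlt h x) * Z x =
      (k + 1) * ∑ a, ∑ y, star (h (Fin.cons a y)) * Z (Fin.cons a y) := by
  rw [← sum_fin_cons fun x => star (h x) * Z x]
  simp only [cosetAlt, star_sum, Finset.sum_mul]
  rw [Finset.sum_comm]
  have : ∀ p : Fin (k + 1), ∑ x, star (sgn (Equiv.swap 0 p) * h (x ∘ Equiv.swap 0 p)) * Z x =
      ∑ x, star (h x) * Z x := by
    intro p
    rw [← ((Equiv.swap 0 p).arrowCongr (Equiv.refl α)).sum_comp]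
    refine Finset.sum_congr rfl fun x _ => ?_
    have e : (((Equiv.swap 0 p).arrowCongr (Equiv.refl α)) x) = x ∘ Equiv.swap 0 p := by
      ext; simp
    rw [e, hZ, star_mul', star_sgn, Function.comp_assoc]
    have : (⇑(Equiv.swap 0 p) ∘ ⇑(Equiv.swap 0 p) : Fin (k + 1) → Fin (k + 1)) = id := by
      ext; simp
    rw [this, Function.comp_id, mul_mul_mul_comm, mul_comm (sgn _), mul_assoc, mul_left_comm,
      ← mul_assoc (sgn _), sgn_mul_self, one_mul]
  rw [Finset.sum_congr rfl fun p _ => this p]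
  simp

lemma star_mul_self_eq (z : ℂ) : star z * z = ((‖z‖ ^ 2 : ℝ) : ℂ) := by
  rw [Complex.star_def, Complex.conj_mul']
  push_cast; rfl

/-- Creation operators satisfy `∑ i, a_i a_i† = d - k` on `k`-particle antisymmetric functions. -/
lemma sum_norm_cosetAlt_sq [DecidableEq α] {V : (Fin k → α) → ℂ} (hV : Antisymmetric V) :
    ∑ i, ∑ x, ‖cosetAlt (fun y => (if y 0 = i then 1 else 0) * V (Fin.tail y)) x‖ ^ 2 =
      (k + 1) * ((Fintype.card α : ℝ) - k) * ∑ x, ‖V x‖ ^ 2 := by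
  apply Complex.ofReal_injective
  push_cast
  have hanti : ∀ i : α,
      Antisymmetric (cosetAlt fun y => (if y 0 = i then (1 : ℂ) else 0) * V (Fin.tail y)) :=
    fun i => antisymmetric_cosetAlt fun a => by
      simpa only [Fin.cons_zero, Fin.tail_cons] using hV.const_mul _
  have e : ∀ z : ℂ, ((‖z‖ : ℂ)) ^ 2 = star z * z := fun z => by
    rw [star_mul_self_eq]; push_cast; rfl
  simp only [e]
  have h1 : ∀ i : α, ∑ x, star (cosetAlt (fun y => (if y 0 = i then (1 : ℂ) else 0) *
        V (Fin.tail y)) x) *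
      cosetAlt (fun y => (if y 0 = i then (1 : ℂ) else 0) * V (Fin.tail y)) x =
      (k + 1) * ∑ y, star (V y) *
        (V y - ∑ n, if y n = i then V (Function.update y n i) else 0) := by
    intro i
    rw [sum_star_cosetAlt_mul (hanti i)]
    congr 1
    rw [Finset.sum_eq_single i]
    · simp [cosetAlt_cons]
    · intro b _ hb
      simp [hb]
    · simp
  simp only [h1]
  rw [← Finset.mul_sum, Finset.sum_comm, mul_assoc]
  congr 1
  rw [Finset.mul_sum]
  refine Finset.sum_congr rfl fun y _ => ?_
  -- The unexchanged term is counted `d` times. The exchange with slot `n` survives only for `i = y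
  -- n`, where the update is trivial, so `k` copies are subtracted.
  rw [← Finset.mul_sum, Finset.sum_sub_distrib, Finset.sum_comm]
  simp
  ring

/-- The annihilation operators form a row of operators of norm at most `√(d - k)`. -/
lemma mul_sum_norm_sum_cons_sq_le (hk : k ≤ Fintype.card α) {W : α → (Fin (k + 1) → α) → ℂ}
    (hW : ∀ i, Antisymmetric (W i)) :
    ((k : ℝ) + 1) * ∑ y, ‖∑ i, W i (Fin.cons i y)‖ ^ 2 ≤
      ((Fintype.card α : ℝ) - k) * ∑ i, ∑ x, ‖W i x‖ ^ 2 := by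
  classical
  set V : (Fin k → α) → ℂ := fun y => ∑ i, W i (Fin.cons i y) with hVdef
  have hV : Antisymmetric V := Antisymmetric.sum fun i _ => (hW i).cons i
  -- `C` is the creation side of the duality: its pairing with `W` returns `(k + 1)‖V‖²` and its
  -- norm is known, so Cauchy–Schwarz bounds `V`.
  set C : α → (Fin (k + 1) → α) → ℂ := fun i =>
    cosetAlt fun y => (if y 0 = i then (1 : ℂ) else 0) * V (Fin.tail y) with hC
  have h1 : ((∑ y, ‖V y‖ ^ 2 : ℝ) : ℂ) * (k + 1) = ∑ i, ∑ x, star (C i x) * W i x := by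
    have : ∀ i, ∑ x, star (C i x) * W i x = (k + 1) * ∑ y, star (V y) * W i (Fin.cons i y) := by
      intro i
      rw [hC, sum_star_cosetAlt_mul (hW i)]
      congr 1
      rw [Finset.sum_eq_single i]
      · simp
      · intro b _ hb
        simp [hb]
      · simp
    simp only [this]
    rw [← Finset.mul_sum, Finset.sum_comm, mul_comm]
    simp only [← Finset.mul_sum]
    push_cast
    congr 1
    refine Finset.sum_congr rfl fun y _ => ?_
    change _ = star (V y) * V y
    rw [star_mul_self_eq]; push_cast; rfl
  have h2 : ∑ i, ∑ x, ‖C i x‖ ^ 2 = (k + 1) * ((Fintype.card α : ℝ) - k) * ∑ x, ‖V x‖ ^ 2 :=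
    sum_norm_cosetAlt_sq hV
  have h3 : (∑ y, ‖V y‖ ^ 2) * ((k : ℝ) + 1) ≤ ∑ i, ∑ x, ‖C i x‖ * ‖W i x‖ := by
    have : ‖((∑ y, ‖V y‖ ^ 2 : ℝ) : ℂ) * (k + 1)‖ = (∑ y, ‖V y‖ ^ 2) * ((k : ℝ) + 1) := by
      rw [norm_mul, Complex.norm_real, Real.norm_of_nonneg (by positivity)]
      congr 1
      exact_mod_cast Complex.norm_natCast (k + 1)
    rw [← this, h1]
    refine (norm_sum_le _ _).trans (Finset.sum_le_sum fun i _ => (norm_sum_le _ _).trans_eq ?_)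
    simp
  set v := ∑ y, ‖V y‖ ^ 2 with hv
  set w := ∑ i, ∑ x, ‖W i x‖ ^ 2 with hw
  have h4 : (v * ((k : ℝ) + 1)) ^ 2 ≤ ((k + 1) * ((Fintype.card α : ℝ) - k) * v) * w := by
    rw [← h2]
    have cs := Finset.sum_mul_sq_le_sq_mul_sq (Finset.univ : Finset (α × (Fin (k + 1) → α)))
      (fun q => ‖C q.1 q.2‖) (fun q => ‖W q.1 q.2‖)
    simp only [Fintype.sum_prod_type] at cs
    refine le_trans ?_ cs
    gcongr
  have hv0 : 0 ≤ v := by positivity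
  rcases hv0.eq_or_lt with h0 | hpos
  · rw [← h0, mul_zero]
    have : (0 : ℝ) ≤ (Fintype.card α : ℝ) - k := sub_nonneg.mpr (by exact_mod_cast hk)
    positivity
  · have hk' : (0 : ℝ) < k + 1 := by positivity
    have : v * (k + 1) * (((k : ℝ) + 1) * v) ≤ v * (k + 1) * (((Fintype.card α : ℝ) - k) * w) := by
      nlinarith [h4]
    exact le_of_mul_le_mul_left this (by positivity)

end Antisymmetric

/-! ### Wedge and contraction by a two-index tensor -/

section BiWedge

variable {α : Type*} {k : ℕ}

/-- Antisymmetry separately in two groups of `k` indices. -/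
def BiAntisymmetric (X : (Fin k → α) → (Fin k → α) → ℂ) : Prop :=
  (∀ x', Antisymmetric fun x => X x x') ∧ ∀ x, Antisymmetric (X x)

/-- The wedge product of a two-index tensor with a `2k`-index tensor, antisymmetrized separately
in the first and in the second indices. -/
noncomputable def biWedge (A : α → α → ℂ) (X : (Fin k → α) → (Fin k → α) → ℂ)
    (x x' : Fin (k + 1) → α) : ℂ :=
  cosetAlt (fun y => cosetAlt
    (fun y' => A (y 0) (y' 0) * X (Fin.tail y) (Fin.tail y')) x') x

/-- Contraction of the conjugate of a two-index tensor with a `2(k+1)`-index tensor. -/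
noncomputable def biContract [Fintype α] (A : α → α → ℂ)
    (X : (Fin (k + 1) → α) → (Fin (k + 1) → α) → ℂ) (x x' : Fin k → α) : ℂ :=
  ∑ i, ∑ j, star (A i j) * X (Fin.cons i x) (Fin.cons j x')

lemma cosetAlt_comm (h : (Fin (k + 1) → α) → (Fin (k + 1) → α) → ℂ) (x x' : Fin (k + 1) → α) :
    cosetAlt (fun y => cosetAlt (h y) x') x = cosetAlt (fun y' => cosetAlt (h · y') x) x' := by
  simp only [cosetAlt, Finset.mul_sum]
  rw [Finset.sum_comm]
  refine Finset.sum_congr rfl fun _ _ => Finset.sum_congr rfl fun _ _ => by ring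

lemma biAntisymmetric_biWedge (A : α → α → ℂ) {X : (Fin k → α) → (Fin k → α) → ℂ}
    (hX : BiAntisymmetric X) : BiAntisymmetric (biWedge A X) := by
  constructor
  · intro x'
    refine antisymmetric_cosetAlt fun a => ?_
    intro π x
    simp only [cosetAlt, Fin.cons_zero, Fin.tail_cons, Finset.mul_sum, hX.1 _ π x]
    exact Finset.sum_congr rfl fun _ _ => by ring
  · intro x
    have : biWedge A X x = fun x' => cosetAlt (fun y' => cosetAlt
        (fun y => A (y 0) (y' 0) * X (Fin.tail y) (Fin.tail y')) x) x' := by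
      funext x'
      exact cosetAlt_comm _ _ _
    rw [this]
    refine antisymmetric_cosetAlt fun a => ?_
    intro π x
    simp only [cosetAlt, Fin.cons_zero, Fin.tail_cons, Finset.mul_sum, hX.2 _ π x]
    exact Finset.sum_congr rfl fun _ _ => by ring

variable [Fintype α]

lemma biAntisymmetric_biContract (A : α → α → ℂ)
    {X : (Fin (k + 1) → α) → (Fin (k + 1) → α) → ℂ}
    (hX : BiAntisymmetric X) : BiAntisymmetric (biContract A X) :=
  ⟨fun _ => Antisymmetric.sum fun i _ => Antisymmetric.sum fun _ _ =>
    ((hX.1 _).cons i).const_mul _,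
   fun _ => Antisymmetric.sum fun _ _ => Antisymmetric.sum fun j _ =>
    ((hX.2 _).cons j).const_mul _⟩

/-- The adjointness of `sum_star_cosetAlt_mul`, used in each group, contributes one factor `k + 1`
per group. -/
lemma sum_star_biWedge_mul (A : α → α → ℂ) (X : (Fin k → α) → (Fin k → α) → ℂ)
    {Z : (Fin (k + 1) → α) → (Fin (k + 1) → α) → ℂ} (hZ : BiAntisymmetric Z) :
    ∑ x, ∑ x', star (biWedge A X x x') * Z x x' =
      (k + 1) ^ 2 * ∑ x, ∑ x', star (X x x') * biContract A Z x x' := by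
  have h1 : ∀ x', ∑ x, star (biWedge A X x x') * Z x x' = (k + 1) * ∑ a, ∑ y,
      star (cosetAlt (fun y' => A a (y' 0) * X y (Fin.tail y')) x') * Z (Fin.cons a y) x' := by
    intro x'
    simp only [biWedge]
    rw [sum_star_cosetAlt_mul (hZ.1 x')]
    simp
  rw [Finset.sum_comm]
  simp only [h1]
  rw [← Finset.mul_sum, Finset.sum_comm, sq, mul_assoc]
  congr 1
  have h2 : ∀ a y, ∑ x', star (cosetAlt (fun y' => A a (y' 0) * X y (Fin.tail y')) x') *
      Z (Fin.cons a y) x' = (k + 1) * ∑ b, ∑ y', star (A a b * X y y') *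
        Z (Fin.cons a y) (Fin.cons b y') := by
    intro a y
    rw [sum_star_cosetAlt_mul (hZ.2 _)]
    simp
  have h3 : ∀ a, ∑ x', ∑ y, star (cosetAlt (fun y' => A a (y' 0) * X y (Fin.tail y')) x') *
      Z (Fin.cons a y) x' = (k + 1) * ∑ y, ∑ b, ∑ y', star (A a b * X y y') *
        Z (Fin.cons a y) (Fin.cons b y') := by
    intro a
    rw [Finset.sum_comm, Finset.mul_sum]
    exact Finset.sum_congr rfl fun y _ => h2 a y
  simp only [h3]
  rw [← Finset.mul_sum]
  congr 1
  rw [Finset.sum_comm]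
  refine Finset.sum_congr rfl fun y _ => ?_
  simp only [biContract, Finset.mul_sum]
  rw [Finset.sum_comm' (t' := Finset.univ) (s' := fun _ => Finset.univ) (by simp)]
  rw [Finset.sum_comm (s := (Finset.univ : Finset (Fin k → α)))]
  rw [Finset.sum_comm]
  refine Finset.sum_congr rfl fun a _ => ?_
  rw [Finset.sum_comm (s := (Finset.univ : Finset (Fin k → α)))]
  refine Finset.sum_congr rfl fun b _ => Finset.sum_congr rfl fun y' _ => ?_
  rw [star_mul']
  ring

/-- The part of the number operator acting on the second group of indices. -/
noncomputable def numSnd (A : α → α → ℂ) (X : (Fin k → α) → (Fin k → α) → ℂ)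
    (x x' : Fin k → α) : ℂ :=
  ∑ i, ∑ j, star (A i j) * ∑ n, A i (x' n) * X x (Function.update x' n j)

/-- The part of the number operator acting on the first group of indices. -/
noncomputable def numFst (A : α → α → ℂ) (X : (Fin k → α) → (Fin k → α) → ℂ)
    (x x' : Fin k → α) : ℂ :=
  ∑ i, ∑ j, star (A i j) * ∑ n, A (x n) j * X (Function.update x n i) x'

/-- Applying `cosetAlt_cons` in both groups leaves four terms: no exchange, an exchange in one group
only (the two number operators), and an exchange in both. -/
lemma biContract_biWedge (A : α → α → ℂ) (X : (Fin k → α) → (Fin k → α) → ℂ)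
    (x x' : Fin k → α) :
    biContract A (biWedge A X) x x' =
      ((∑ i, ∑ j, ‖A i j‖ ^ 2 : ℝ) : ℂ) * X x x' - numSnd A X x x' - numFst A X x x' +
      ∑ i, ∑ j, star (A i j) * ∑ n, ∑ n', A (x n) (x' n') *
        X (Function.update x n i) (Function.update x' n' j) := by
  have key : ∀ i j, biWedge A X (Fin.cons i x) (Fin.cons j x') =
      A i j * X x x' - (∑ n, A i (x' n) * X x (Function.update x' n j)) -
      (∑ n, A (x n) j * X (Function.update x n i) x') +
      ∑ n, ∑ n', A (x n) (x' n') * X (Function.update x n i) (Function.update x' n' j) := by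
    intro i j
    rw [biWedge, cosetAlt_cons]
    simp only [cosetAlt_cons, Fin.cons_zero, Fin.tail_cons, Finset.sum_sub_distrib]
    ring
  simp only [biContract, key, numSnd, numFst]
  push_cast
  simp only [Finset.sum_mul, ← Finset.sum_sub_distrib, ← Finset.sum_add_distrib]
  refine Finset.sum_congr rfl fun i _ => Finset.sum_congr rfl fun j _ => ?_
  have : ((‖A i j‖ : ℂ)) ^ 2 = star (A i j) * A i j := by
    rw [star_mul_self_eq]; push_cast; rfl
  rw [this]
  ring

/-- The doubly exchanged term is the normally ordered one: it contracts first and wedges afterwards.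
By adjointness its expectation is then a multiple of the squared norm of `biContract A X`. -/
lemma sum_update_update_eq_biWedge (A : α → α → ℂ)
    {X : (Fin (k + 1) → α) → (Fin (k + 1) → α) → ℂ} (hX : BiAntisymmetric X)
    (x x' : Fin (k + 1) → α) :
    ∑ i, ∑ j, star (A i j) * ∑ n, ∑ n', A (x n) (x' n') *
        X (Function.update x n i) (Function.update x' n' j) =
      biWedge A (biContract A X) x x' := by
  have h1 : ∀ i j, ∑ n, ∑ n', A (x n) (x' n') *
        X (Function.update x n i) (Function.update x' n' j) =
      cosetAlt (fun y => cosetAlt (fun y' => A (y 0) (y' 0) *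
        X (Fin.cons i (Fin.tail y)) (Fin.cons j (Fin.tail y'))) x') x := by
    intro i j
    rw [cosetAlt_comm]
    have e1 : ∀ y' : Fin (k + 1) → α, cosetAlt (fun y => A (y 0) (y' 0) *
        X (Fin.cons i (Fin.tail y)) (Fin.cons j (Fin.tail y'))) x =
        ∑ n, A (x n) (y' 0) * X (Function.update x n i) (Fin.cons j (Fin.tail y')) := fun y' =>
      (sum_mul_update (hX.1 _) (fun a => A a (y' 0)) i x).symm
    simp only [e1]
    have e2 : ∀ n, ∑ n', A (x n) (x' n') * X (Function.update x n i) (Function.update x' n' j) =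
        cosetAlt (fun y' => A (x n) (y' 0) *
          X (Function.update x n i) (Fin.cons j (Fin.tail y'))) x' := fun n =>
      sum_mul_update (hX.2 _) (A (x n)) j x'
    simp only [e2]
    simp only [cosetAlt, Finset.mul_sum]
    rw [Finset.sum_comm]
  simp only [h1, biWedge, biContract, cosetAlt, Finset.mul_sum]
  have h2 : ∀ f : α → α → Fin (k + 1) → Fin (k + 1) → ℂ,
      ∑ i, ∑ j, ∑ p, ∑ p', f i j p p' = ∑ p, ∑ p', ∑ i, ∑ j, f i j p p' := by
    intro f
    simp only [← Fintype.sum_prod_type (fun q : α × α => ∑ p, ∑ p', f q.1 q.2 p p')]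
    rw [Finset.sum_comm]
    refine Finset.sum_congr rfl fun p _ => ?_
    rw [Finset.sum_comm]
    simp only [Fintype.sum_prod_type]
  rw [h2]
  refine Finset.sum_congr rfl fun p _ => Finset.sum_congr rfl fun p' _ =>
    Finset.sum_congr rfl fun i _ => Finset.sum_congr rfl fun j _ => by ring

/-- A one-sided exchange is an annihilation followed by a creation, so its expectation is a sum of
squares of partial contractions. As it enters with a minus sign, it lowers the norm of the wedge. -/
lemma sum_star_mul_numSnd (A : α → α → ℂ)
    {X : (Fin (k + 1) → α) → (Fin (k + 1) → α) → ℂ} (hX : BiAntisymmetric X) :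
    ∑ x, ∑ x', star (X x x') * numSnd A X x x' =
      (((k + 1) * ∑ x, ∑ i, ∑ y', ‖∑ j, star (A i j) * X x (Fin.cons j y')‖ ^ 2 : ℝ) : ℂ) := by
  push_cast
  rw [Finset.mul_sum]
  refine Finset.sum_congr rfl fun x _ => ?_
  have h1 : ∀ i j, ∑ x', star (X x x') * ∑ n, A i (x' n) * X x (Function.update x' n j) =
      (k + 1) * ∑ b, ∑ y', star (X x (Fin.cons b y')) * (A i b * X x (Fin.cons j y')) := by
    intro i j
    simp only [sum_mul_update (hX.2 _)]
    have := sum_star_cosetAlt_mul (hX.2 x) fun y => A i (y 0) * X x (Fin.cons j (Fin.tail y))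
    have := congrArg star this
    simpa [mul_comm, mul_assoc, mul_left_comm] using this
  have h2 : ∑ x', star (X x x') * numSnd A X x x' = ∑ i, ∑ j, star (A i j) *
      ∑ x', star (X x x') * ∑ n, A i (x' n) * X x (Function.update x' n j) := by
    simp only [numSnd]
    simp only [Finset.mul_sum (s := (Finset.univ : Finset α))]
    rw [Finset.sum_comm]
    refine Finset.sum_congr rfl fun i _ => ?_
    rw [Finset.sum_comm]
    refine Finset.sum_congr rfl fun j _ => ?_
    rw [Finset.mul_sum]
    exact Finset.sum_congr rfl fun _ _ => by ring
  rw [h2, Finset.mul_sum]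
  refine Finset.sum_congr rfl fun i _ => ?_
  simp only [h1]
  have h3 : ∀ y' : Fin k → α, ((‖∑ j, star (A i j) * X x (Fin.cons j y')‖ : ℝ) : ℂ) ^ 2 =
      ∑ j, ∑ b, star (A i j) * (star (X x (Fin.cons b y')) * (A i b * X x (Fin.cons j y'))) := by
    intro y'
    have e : ∀ z : ℂ, ((‖z‖ : ℂ)) ^ 2 = star z * z := fun z => by
      rw [star_mul_self_eq]; push_cast; rfl
    rw [e, star_sum, Finset.sum_mul_sum, Finset.sum_comm]
    refine Finset.sum_congr rfl fun j _ => Finset.sum_congr rfl fun b _ => ?_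
    rw [star_mul', star_star]
    ring
  simp only [h3]
  rw [Finset.sum_comm (s := (Finset.univ : Finset (Fin k → α))), Finset.mul_sum]
  refine Finset.sum_congr rfl fun j _ => ?_
  rw [Finset.sum_comm (s := (Finset.univ : Finset (Fin k → α))), mul_left_comm, Finset.mul_sum]
  congr 1
  refine Finset.sum_congr rfl fun b _ => ?_
  rw [Finset.mul_sum]

lemma sum_star_mul_numFst (A : α → α → ℂ)
    {X : (Fin (k + 1) → α) → (Fin (k + 1) → α) → ℂ} (hX : BiAntisymmetric X) :
    ∑ x, ∑ x', star (X x x') * numFst A X x x' =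
      (((k + 1) * ∑ x', ∑ j, ∑ y, ‖∑ i, star (A i j) * X (Fin.cons i y) x'‖ ^ 2 : ℝ) : ℂ) := by
  have hX' : BiAntisymmetric fun x' x => X x x' := ⟨hX.2, hX.1⟩
  rw [← sum_star_mul_numSnd (fun i j => A j i) hX', Finset.sum_comm]
  refine Finset.sum_congr rfl fun x' _ => Finset.sum_congr rfl fun x _ => ?_
  rw [numFst, numSnd, Finset.sum_comm]

end BiWedge

/-! ### Norm bounds for wedges of two-index tensors -/

section BiWedgeNorm

variable {α : Type*} {k : ℕ} [Fintype α]

/-- The squared norm of a function of two groups of indices. -/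
noncomputable def biNormSq {β γ : Type*} [Fintype β] [Fintype γ] (X : β → γ → ℂ) : ℝ :=
  ∑ x, ∑ x', ‖X x x'‖ ^ 2

lemma biNormSq_nonneg {β γ : Type*} [Fintype β] [Fintype γ] (X : β → γ → ℂ) : 0 ≤ biNormSq X := by
  unfold biNormSq; positivity

lemma sum_star_mul_self {β γ : Type*} [Fintype β] [Fintype γ] (X : β → γ → ℂ) :
    ∑ x, ∑ x', star (X x x') * X x x' = (biNormSq X : ℂ) := by
  simp only [star_mul_self_eq, biNormSq]
  push_cast
  rfl

lemma norm_sum_star_mul_sq_le {β γ : Type*} [Fintype β] [Fintype γ] (X Y : β → γ → ℂ) :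
    ‖∑ x, ∑ x', star (X x x') * Y x x'‖ ^ 2 ≤ biNormSq X * biNormSq Y := by
  have cs := Finset.sum_mul_sq_le_sq_mul_sq (Finset.univ : Finset (β × γ))
    (fun q => ‖X q.1 q.2‖) (fun q => ‖Y q.1 q.2‖)
  simp only [Fintype.sum_prod_type] at cs
  refine le_trans ?_ cs
  gcongr
  refine (norm_sum_le _ _).trans (Finset.sum_le_sum fun i _ => (norm_sum_le _ _).trans_eq ?_)
  simp

lemma biNormSq_biWedge (A : α → α → ℂ) {X : (Fin k → α) → (Fin k → α) → ℂ}
    (hX : BiAntisymmetric X) :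
    (biNormSq (biWedge A X) : ℂ) = (k + 1) ^ 2 * ((biNormSq A : ℂ) * biNormSq X -
      ∑ x, ∑ x', star (X x x') * numSnd A X x x' - ∑ x, ∑ x', star (X x x') * numFst A X x x' +
      ∑ x, ∑ x', star (X x x') * ∑ i, ∑ j, star (A i j) * ∑ n, ∑ n', A (x n) (x' n') *
        X (Function.update x n i) (Function.update x' n' j)) := by
  rw [← sum_star_mul_self, sum_star_biWedge_mul A X (biAntisymmetric_biWedge A hX)]
  congr 1
  simp only [biContract_biWedge]
  rw [← sum_star_mul_self X, Finset.mul_sum, ← Finset.sum_sub_distrib, ← Finset.sum_sub_distrib,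
    ← Finset.sum_add_distrib]
  refine Finset.sum_congr rfl fun x _ => ?_
  rw [Finset.mul_sum, ← Finset.sum_sub_distrib, ← Finset.sum_sub_distrib,
    ← Finset.sum_add_distrib]
  refine Finset.sum_congr rfl fun x' _ => ?_
  rw [biNormSq]
  ring

lemma sum_star_biContract_mul_self (A : α → α → ℂ)
    {X : (Fin (k + 1) → α) → (Fin (k + 1) → α) → ℂ} (hX : BiAntisymmetric X) :
    ∑ x, ∑ x', star (biWedge A (biContract A X) x x') * X x x' =
      (((k + 1) ^ 2 * biNormSq (biContract A X) : ℝ) : ℂ) := by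
  rw [sum_star_biWedge_mul A _ hX, sum_star_mul_self]
  push_cast; rfl

/-- For fixed `y'` the full contraction annihilates `i` in the `i`-th partial contraction and sums
over `i`, so the row bound `mul_sum_norm_sum_cons_sq_le` applies. -/
lemma biNormSq_biContract_le_numSnd (hk : k ≤ Fintype.card α) (A : α → α → ℂ)
    {X : (Fin (k + 1) → α) → (Fin (k + 1) → α) → ℂ} (hX : BiAntisymmetric X) :
    ((k : ℝ) + 1) * biNormSq (biContract A X) ≤ ((Fintype.card α : ℝ) - k) *
      ∑ x, ∑ i, ∑ y', ‖∑ j, star (A i j) * X x (Fin.cons j y')‖ ^ 2 := by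
  have key : ∀ y', ((k : ℝ) + 1) * ∑ y, ‖biContract A X y y'‖ ^ 2 ≤
      ((Fintype.card α : ℝ) - k) *
        ∑ i, ∑ x, ‖∑ j, star (A i j) * X x (Fin.cons j y')‖ ^ 2 := fun y' =>
    mul_sum_norm_sum_cons_sq_le hk (W := fun i x => ∑ j, star (A i j) * X x (Fin.cons j y'))
      fun i => Antisymmetric.sum fun j _ => (hX.1 _).const_mul _
  have := Finset.sum_le_sum fun y' (_ : y' ∈ Finset.univ) => key y'
  rw [← Finset.mul_sum, ← Finset.mul_sum, Finset.sum_comm] at this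
  refine this.trans_eq ?_
  congr 1
  rw [Finset.sum_comm, Finset.sum_comm (t := (Finset.univ : Finset α))]
  refine Finset.sum_congr rfl fun i _ => Finset.sum_comm

lemma biNormSq_biContract_le_numFst (hk : k ≤ Fintype.card α) (A : α → α → ℂ)
    {X : (Fin (k + 1) → α) → (Fin (k + 1) → α) → ℂ} (hX : BiAntisymmetric X) :
    ((k : ℝ) + 1) * biNormSq (biContract A X) ≤ ((Fintype.card α : ℝ) - k) *
      ∑ x', ∑ j, ∑ y, ‖∑ i, star (A i j) * X (Fin.cons i y) x'‖ ^ 2 := by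
  refine le_of_eq_of_le ?_ (biNormSq_biContract_le_numSnd hk (fun i j => A j i)
    (X := fun x' x => X x x') ⟨hX.2, hX.1⟩)
  rw [biNormSq, biNormSq, Finset.sum_comm]
  simp only [biContract]
  congr 1
  refine Finset.sum_congr rfl fun _ _ => Finset.sum_congr rfl fun _ _ => ?_
  rw [Finset.sum_comm]

/-- Normal ordering writes the norm of the wedge, up to a factor, as `‖A‖²‖X‖²` minus two one-sided
terms plus a multiple of `‖Y‖²`, where `Y` is the contraction of `X` with `A`. The row bound
estimates the one-sided terms below by `‖Y‖²`; the induction hypothesis, through adjointness,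
estimates `‖Y‖²` above. -/
theorem card_mul_biNormSq_biWedge_le (hk : k < Fintype.card α) (A : α → α → ℂ)
    {X : (Fin k → α) → (Fin k → α) → ℂ} (hX : BiAntisymmetric X) :
    (Fintype.card α : ℝ) * biNormSq (biWedge A X) ≤
      ((k : ℝ) + 1) ^ 3 * ((Fintype.card α : ℝ) - k) * (biNormSq A * biNormSq X) := by
  induction k with
  | zero =>
    have h := biNormSq_biWedge A hX
    simp only [numSnd, numFst, Finset.univ_eq_empty, Finset.sum_empty, mul_zero,
      Finset.sum_const_zero, sub_zero, add_zero] at h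
    norm_num at h
    have h' : biNormSq (biWedge A X) = biNormSq A * biNormSq X := by exact_mod_cast h
    rw [h']
    simp
  | succ k ih =>
    set Y := biContract A X with hY
    set d : ℝ := (Fintype.card α : ℝ) with hd
    -- This keeps the coefficient `d - k - 2` of `‖Y‖²` nonnegative below.
    have hkd : (k : ℝ) + 2 ≤ d := by
      rw [hd]; exact_mod_cast hk
    have hYa := biAntisymmetric_biContract A hX
    set S := ∑ x, ∑ i, ∑ y', ‖∑ j, star (A i j) * X x (Fin.cons j y')‖ ^ 2 with hS
    set F := ∑ x', ∑ j, ∑ y, ‖∑ i, star (A i j) * X (Fin.cons i y) x'‖ ^ 2 with hF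
    have hSb : ((k : ℝ) + 1) * biNormSq Y ≤ (d - k) * S :=
      biNormSq_biContract_le_numSnd (by omega) A hX
    have hFb : ((k : ℝ) + 1) * biNormSq Y ≤ (d - k) * F :=
      biNormSq_biContract_le_numFst (by omega) A hX
    have hW : biNormSq (biWedge A X) = ((k : ℝ) + 2) ^ 2 * (biNormSq A * biNormSq X -
        (k + 1) * S - (k + 1) * F + (k + 1) ^ 2 * biNormSq Y) := by
      have h := biNormSq_biWedge A hX
      simp only [sum_update_update_eq_biWedge A hX] at h
      rw [sum_star_mul_numSnd A hX, sum_star_mul_numFst A hX, ← hS, ← hF] at h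
      have e : ∑ x, ∑ x', star (X x x') * biWedge A (biContract A X) x x' =
          (((k + 1) ^ 2 * biNormSq Y : ℝ) : ℂ) := by
        have := congrArg star (sum_star_biContract_mul_self A hX)
        simpa [mul_comm] using this
      rw [e] at h
      apply Complex.ofReal_injective
      rw [h]
      push_cast
      ring
    -- Adjointness gives `(k + 1)²‖Y‖² = ⟨A ∧ Y, X⟩`. Cauchy–Schwarz and the induction hypothesis
    -- for `Y` bound its square, and one factor `‖Y‖²` cancels.
    have hYb : ((k : ℝ) + 1) * d * biNormSq Y ≤ (d - k) * (biNormSq A * biNormSq X) := by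
      have cs := norm_sum_star_mul_sq_le (biWedge A Y) X
      rw [sum_star_biContract_mul_self A hX, Complex.norm_real, Real.norm_of_nonneg
        (mul_nonneg (by positivity) (biNormSq_nonneg _))] at cs
      have hi := ih (by omega) hYa
      have h0 := biNormSq_nonneg Y
      rcases h0.eq_or_lt with h0 | hpos
      · rw [← h0, mul_zero]
        exact mul_nonneg (by linarith) (mul_nonneg (biNormSq_nonneg _) (biNormSq_nonneg _))
      · have h1 : (k + 1 : ℝ) ^ 3 * biNormSq Y * (((k : ℝ) + 1) * d * biNormSq Y) ≤
            (k + 1 : ℝ) ^ 3 * biNormSq Y * ((d - k) * (biNormSq A * biNormSq X)) := by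
          have h2 := mul_le_mul_of_nonneg_left cs (show 0 ≤ d by linarith)
          have h3 := mul_le_mul_of_nonneg_right hi (biNormSq_nonneg X)
          nlinarith [h2, h3]
        exact le_of_mul_le_mul_left h1 (by positivity)
    rw [hW]
    set a := biNormSq A * biNormSq X
    set y := biNormSq Y
    have hdk : 0 < d - k := by linarith
    -- `S` and `F` are both replaced by their lower bound `(k + 1) y / (d - k)`.
    have h5 : (d - k) * (a - (k + 1) * S - (k + 1) * F + (k + 1) ^ 2 * y) ≤
        (d - k) * a + (k + 1) * (d - k - 2) * ((k + 1) * y) := by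
      nlinarith [mul_le_mul_of_nonneg_left hSb (show (0 : ℝ) ≤ k + 1 by positivity),
        mul_le_mul_of_nonneg_left hFb (show (0 : ℝ) ≤ k + 1 by positivity)]
    -- The constants close up because `d + (k + 1)(d - k - 2) = (k + 2)(d - k - 1)`.
    have h6 : (d - k) * (d * (a - (k + 1) * S - (k + 1) * F + (k + 1) ^ 2 * y)) ≤
        (d - k) * ((k + 2) * (d - (k + 1)) * a) := by
      have h7 := mul_le_mul_of_nonneg_left h5 (show (0 : ℝ) ≤ d by linarith)
      have h8 := mul_le_mul_of_nonneg_left hYb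
        (show (0 : ℝ) ≤ (k + 1) * (d - k - 2) from mul_nonneg (by positivity) (by linarith))
      nlinarith [h7, h8]
    have h9 := le_of_mul_le_mul_left h6 hdk
    have h10 := mul_le_mul_of_nonneg_left h9 (show (0 : ℝ) ≤ (k + 2) ^ 2 by positivity)
    push_cast
    nlinarith [h10]

lemma biAntisymmetric_one {α : Type*} : BiAntisymmetric fun (_ _ : Fin 0 → α) => (1 : ℂ) :=
  ⟨fun _ π _ => by simp [Subsingleton.elim π 1], fun _ π _ => by simp [Subsingleton.elim π 1]⟩

/-- The separate antisymmetrization, without normalization, of `A₁ ⊗ ⋯ ⊗ A_k` in the first and in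
the second indices. -/
noncomputable def biAlt {k : ℕ} {α : Type*} (A : Fin k → α → α → ℂ) (x x' : Fin k → α) : ℂ :=
  ∑ π : Equiv.Perm (Fin k), ∑ π' : Equiv.Perm (Fin k),
    sgn π * sgn π' * ∏ j, A j (x (π j)) (x' (π' j))

/-- Grouping both permutations by the image of `0` peels off the first factor, as in a Laplace
expansion. -/
lemma biAlt_succ {k : ℕ} {α : Type*} (A : Fin (k + 1) → α → α → ℂ) :
    biAlt A = biWedge (A 0) (biAlt (Fin.tail A)) := by
  funext x x'
  have h1 : biAlt A x x' = ∑ π : Equiv.Perm (Fin (k + 1)), sgn π *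
      (fun y => ∑ π' : Equiv.Perm (Fin (k + 1)), sgn π' *
        (fun y' => ∏ j, A j (y j) (y' j)) (x' ∘ π')) (x ∘ π) := by
    simp only [biAlt, Finset.mul_sum, Function.comp_apply, mul_assoc]
  rw [h1]
  refine (sum_perm_eq_cosetAlt (fun y => ∑ π' : Equiv.Perm (Fin (k + 1)), sgn π' *
    (fun y' => ∏ j, A j (y j) (y' j)) (x' ∘ π')) x).trans ?_
  rw [biWedge]
  congr 1
  funext y
  have h2 : ∀ e : Equiv.Perm (Fin k), ∑ π' : Equiv.Perm (Fin (k + 1)), sgn π' *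
      (fun y' : Fin (k + 1) → α => ∏ j, A j ((Fin.cons (y 0) (Fin.tail y ∘ e) :
        Fin (k + 1) → α) j) (y' j)) (x' ∘ π') = _ := fun e =>
    sum_perm_eq_cosetAlt (fun y' : Fin (k + 1) → α => ∏ j, A j ((Fin.cons (y 0)
      (Fin.tail y ∘ e) : Fin (k + 1) → α) j) (y' j)) x'
  simp only [] at h2
  simp only [h2, cosetAlt, Finset.mul_sum]
  rw [Finset.sum_comm]
  refine Finset.sum_congr rfl fun p _ => ?_
  simp only [biAlt, Finset.mul_sum]
  refine Finset.sum_congr rfl fun π _ => Finset.sum_congr rfl fun π' _ => ?_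
  rw [Fin.prod_univ_succ]
  simp [Fin.tail]
  ring

lemma biAntisymmetric_biAlt {k : ℕ} {α : Type*} (A : Fin k → α → α → ℂ) :
    BiAntisymmetric (biAlt A) := by
  induction k with
  | zero =>
    convert biAntisymmetric_one (α := α) using 1
    funext x x'
    simp [biAlt]
  | succ k ih =>
    rw [biAlt_succ]
    exact biAntisymmetric_biWedge _ (ih _)

/-- Iterating the one-factor bound multiplies `(j + 1)³ (d - j) / d` over `j < k`. -/
theorem card_pow_mul_biNormSq_biAlt_le {k : ℕ} (hk : k ≤ Fintype.card α)
    (A : Fin k → α → α → ℂ) (hA : ∀ j, biNormSq (A j) = 1) :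
    (Fintype.card α : ℝ) ^ k * biNormSq (biAlt A) ≤
      (k ! : ℝ) ^ 3 * (Fintype.card α).descFactorial k := by
  induction k with
  | zero => simp [biAlt, biNormSq]
  | succ k ih =>
    have h1 := card_mul_biNormSq_biWedge_le (by omega) (A 0) (biAntisymmetric_biAlt (Fin.tail A))
    have h2 := ih (by omega) (Fin.tail A) fun j => hA j.succ
    rw [← biAlt_succ, hA 0, one_mul] at h1
    have hd : (0 : ℝ) ≤ (Fintype.card α : ℝ) - k :=
      sub_nonneg.mpr (by exact_mod_cast (by omega : k ≤ Fintype.card α))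
    rw [Nat.descFactorial_succ, Nat.factorial_succ]
    push_cast [Nat.cast_sub (by omega : k ≤ Fintype.card α)]
    calc (Fintype.card α : ℝ) ^ (k + 1) * biNormSq (biAlt A)
        = (Fintype.card α : ℝ) ^ k * (Fintype.card α * biNormSq (biAlt A)) := by ring
      _ ≤ (Fintype.card α : ℝ) ^ k * (((k : ℝ) + 1) ^ 3 * ((Fintype.card α : ℝ) - k) *
          biNormSq (biAlt (Fin.tail A))) := by gcongr
      _ = ((k : ℝ) + 1) ^ 3 * ((Fintype.card α : ℝ) - k) *
          ((Fintype.card α : ℝ) ^ k * biNormSq (biAlt (Fin.tail A))) := by ring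
      _ ≤ ((k : ℝ) + 1) ^ 3 * ((Fintype.card α : ℝ) - k) *
          ((k ! : ℝ) ^ 3 * (Fintype.card α).descFactorial k) := by gcongr
      _ = _ := by ring

end BiWedgeNorm

/-! ### Vectors, rank-one operators and spectral decompositions -/

section Kets

variable {n : Type*}

lemma ketBra_apply (ψ : n → ℂ) (x y : n) : ketBra ψ x y = ψ x * star (ψ y) := rfl

lemma posSemidef_ketBra [Fintype n] (ψ : n → ℂ) : (ketBra ψ).PosSemidef :=
  Matrix.posSemidef_vecMulVec_self_star ψ

/-- Normalized vectors. -/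
def IsUnitKet [Fintype n] (ψ : n → ℂ) : Prop := ∑ x, ‖ψ x‖ ^ 2 = 1

lemma star_dotProduct_self [Fintype n] (ψ : n → ℂ) :
    star ψ ⬝ᵥ ψ = ((∑ x, ‖ψ x‖ ^ 2 : ℝ) : ℂ) := by
  simp only [dotProduct, Pi.star_apply, star_mul_self_eq]
  push_cast; rfl

lemma isUnitKet_iff [Fintype n] (ψ : n → ℂ) : IsUnitKet ψ ↔ star ψ ⬝ᵥ ψ = 1 := by
  rw [star_dotProduct_self, IsUnitKet]
  norm_cast

lemma trace_ketBra [Fintype n] (ψ : n → ℂ) : (ketBra ψ).trace = star ψ ⬝ᵥ ψ := by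
  rw [ketBra, Matrix.trace_vecMulVec, dotProduct_comm]

lemma trace_mul_ketBra [Fintype n] (Q : Matrix n n ℂ) (ψ : n → ℂ) :
    (Q * ketBra ψ).trace = star ψ ⬝ᵥ Q.mulVec ψ := by
  rw [ketBra, Matrix.mul_vecMulVec, Matrix.trace_vecMulVec, dotProduct_comm]

lemma isDensityMatrix_ketBra [Fintype n] {ψ : n → ℂ} (h : IsUnitKet ψ) :
    IsDensityMatrix (ketBra ψ) :=
  ⟨posSemidef_ketBra ψ, by rw [trace_ketBra, (isUnitKet_iff ψ).1 h]⟩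

lemma ketBra_mulVec [Fintype n] (ψ χ : n → ℂ) :
    (ketBra ψ).mulVec χ = (star ψ ⬝ᵥ χ) • ψ := by
  funext x
  simp only [Matrix.mulVec, dotProduct, ketBra_apply, Pi.smul_apply, smul_eq_mul, Pi.star_apply,
    Finset.sum_mul]
  exact Finset.sum_congr rfl fun _ _ => by ring

lemma convex_isDensityMatrix [Fintype n] : Convex ℝ {σ : Matrix n n ℂ | IsDensityMatrix σ} := by
  rintro σ ⟨h1, h1'⟩ τ ⟨h2, h2'⟩ a b ha hb hab
  refine ⟨(h1.smul ha).add (h2.smul hb), ?_⟩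
  rw [Matrix.trace_add, Matrix.trace_smul, Matrix.trace_smul, h1', h2', ← add_smul, hab, one_smul]

/-- Orthonormal bases of `ℂⁿ`, as families of functions. -/
structure IsKetBasis {I : Type*} [Fintype I] [DecidableEq I] [Fintype n] [DecidableEq n]
    (e : I → n → ℂ) : Prop where
  orth : ∀ i j, star (e i) ⬝ᵥ e j = if i = j then 1 else 0
  complete : ∑ i, ketBra (e i) = 1

lemma exists_eigenbasis [Fintype n] [DecidableEq n] {ρ : Matrix n n ℂ} (hρ : ρ.IsHermitian) :
    ∃ (e : n → n → ℂ) (r : n → ℝ), IsKetBasis e ∧ ρ = ∑ i, r i • ketBra (e i) ∧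
      (ρ.PosSemidef → ∀ i, 0 ≤ r i) := by
  set U : Matrix n n ℂ := (hρ.eigenvectorUnitary : Matrix n n ℂ) with hU
  have h1 : star U * U = 1 := Unitary.coe_star_mul_self _
  have h2 : U * star U = 1 := Unitary.coe_mul_star_self _
  refine ⟨fun i x => U x i, hρ.eigenvalues, ⟨fun i j => ?_, ?_⟩, ?_,
    fun h => h.eigenvalues_nonneg⟩
  · have := congrFun (congrFun h1 i) j
    rw [Matrix.mul_apply, Matrix.one_apply] at this
    exact this
  · rw [← h2]
    ext x y
    rw [Matrix.sum_apply, Matrix.mul_apply]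
    rfl
  · conv_lhs => rw [hρ.spectral_theorem]
    rw [Unitary.conjStarAlgAut_apply]
    ext x y
    rw [Matrix.sum_apply, Matrix.mul_apply]
    refine Finset.sum_congr rfl fun i _ => ?_
    rw [Matrix.mul_diagonal]
    simp only [Matrix.smul_apply, ketBra_apply, Complex.real_smul]
    rw [Matrix.star_apply, ← hU, Function.comp_apply, RCLike.ofReal_eq_complex_ofReal]
    ring

lemma IsKetBasis.isUnitKet {I : Type*} [Fintype I] [DecidableEq I] [Fintype n] [DecidableEq n]
    {e : I → n → ℂ} (he : IsKetBasis e) (i : I) : IsUnitKet (e i) := by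
  rw [isUnitKet_iff, he.orth, if_pos rfl]

lemma IsDensityMatrix.exists_eigenbasis [Fintype n] [DecidableEq n] {ρ : Matrix n n ℂ}
    (hρ : IsDensityMatrix ρ) : ∃ (e : n → n → ℂ) (r : n → ℝ), IsKetBasis e ∧
      ρ = ∑ i, r i • ketBra (e i) ∧ (∀ i, 0 ≤ r i) ∧ ∑ i, r i = 1 := by
  obtain ⟨e, r, he, h, h0⟩ := MultipartiteEntanglement.exists_eigenbasis hρ.1.isHermitian
  refine ⟨e, r, he, h, h0 hρ.1, ?_⟩
  have := hρ.2
  rw [h, Matrix.trace_sum] at this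
  simp only [Matrix.trace_smul, trace_ketBra, he.orth, if_true] at this
  apply Complex.ofReal_injective
  simpa using this

lemma IsDensityMatrix.one_sub_posSemidef [Fintype n] [DecidableEq n] {ρ : Matrix n n ℂ}
    (hρ : IsDensityMatrix ρ) : (1 - ρ).PosSemidef := by
  obtain ⟨e, r, he, h, h0, h1⟩ := hρ.exists_eigenbasis
  have : 1 - ρ = ∑ i, (1 - r i) • ketBra (e i) := by
    rw [h, ← he.complete, ← Finset.sum_sub_distrib]
    simp [sub_smul]
  rw [this]
  refine Matrix.posSemidef_sum _ fun i _ => (posSemidef_ketBra _).smul ?_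
  rw [sub_nonneg, ← h1]
  exact Finset.single_le_sum (fun j _ => h0 j) (Finset.mem_univ i)

lemma trace_mul_ketBra_re_nonneg [Fintype n] {Q : Matrix n n ℂ}
    (hQ : Q.PosSemidef) (ψ : n → ℂ) : 0 ≤ (Q * ketBra ψ).trace.re := by
  rw [trace_mul_ketBra]
  exact (Complex.le_def.1 (hQ.dotProduct_mulVec_nonneg ψ)).1

lemma trace_mul_re_nonneg [Fintype n] [DecidableEq n] {Q σ : Matrix n n ℂ}
    (hQ : Q.PosSemidef) (hσ : σ.PosSemidef) : 0 ≤ (Q * σ).trace.re := by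
  obtain ⟨e, r, -, h, h0⟩ := exists_eigenbasis hσ.isHermitian
  rw [h, Matrix.mul_sum, Matrix.trace_sum, Complex.re_sum]
  refine Finset.sum_nonneg fun i _ => ?_
  rw [Matrix.mul_smul, Matrix.trace_smul, Complex.smul_re]
  exact mul_nonneg (h0 hσ i) (trace_mul_ketBra_re_nonneg hQ _)

end Kets

/-! ### Separable states and tensor products of multipartite operators -/

section Separable

variable {N : ℕ} {α β γ : Type*}

/-- The product vector `v₁ ⊗ ⋯ ⊗ v_N`. -/
def prodKet (v : Fin N → α → ℂ) (x : Fin N → α) : ℂ := ∏ j, v j (x j)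

lemma ketBra_prodKet (v : Fin N → α → ℂ) :
    ketBra (prodKet v) = productOperator fun j => ketBra (v j) := by
  ext x y
  simp [ketBra_apply, prodKet, productOperator, Finset.prod_mul_distrib]

variable [Fintype α] [Fintype β] [Fintype γ]

lemma IsUnitKet.prodKet {v : Fin N → α → ℂ} (hv : ∀ j, IsUnitKet (v j)) :
    IsUnitKet (prodKet v) := by
  classical
  have h := Finset.prod_univ_sum (fun _ : Fin N => (Finset.univ : Finset α))
    fun j x => ‖v j x‖ ^ 2
  rw [Fintype.piFinset_univ] at h
  rw [IsUnitKet]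
  simp only [MultipartiteEntanglement.prodKet, norm_prod, ← Finset.prod_pow]
  rw [← h]
  exact Finset.prod_eq_one fun j _ => hv j

lemma ketBra_prodKet_mem {v : Fin N → α → ℂ} (hv : ∀ j, IsUnitKet (v j)) :
    ketBra (prodKet v) ∈ separableStates N α :=
  subset_convexHull ℝ _ ⟨fun j => ketBra (v j), fun j => isDensityMatrix_ketBra (hv j),
    ketBra_prodKet v⟩

lemma convex_separableStates : Convex ℝ (separableStates N α) := convex_convexHull ℝ _

/-- Separable states are mixtures of pure product states. -/
lemma separableStates_subset {S : Set (Matrix (Fin N → α) (Fin N → α) ℂ)} (hS : Convex ℝ S)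
    (h : ∀ v : Fin N → α → ℂ, (∀ j, IsUnitKet (v j)) → ketBra (prodKet v) ∈ S) :
    separableStates N α ⊆ S := by
  classical
  refine convexHull_min ?_ hS
  rintro _ ⟨τ, hτ, rfl⟩
  choose e r he hτe h0 h1 using fun j => (hτ j).exists_eigenbasis
  -- Multiplying out the spectral decompositions of the factors gives a mixture of pure product
  -- states with product weights.
  have key : productOperator τ = ∑ m : Fin N → α, (∏ j, r j (m j)) •
      ketBra (prodKet fun j => e j (m j)) := by
    ext x y
    rw [Matrix.sum_apply]
    simp only [productOperator, Matrix.of_apply]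
    have h := Finset.prod_univ_sum (fun _ : Fin N => (Finset.univ : Finset α))
      fun j i => (r j i • ketBra (e j i)) (x j) (y j)
    rw [Fintype.piFinset_univ] at h
    have h2 : ∀ j, τ j (x j) (y j) = ∑ i, (r j i • ketBra (e j i)) (x j) (y j) := fun j => by
      conv_lhs => rw [hτe j]
      rw [Matrix.sum_apply]
    simp only [h2]
    rw [h]
    refine Finset.sum_congr rfl fun m _ => ?_
    simp only [Matrix.smul_apply, ketBra_apply, Complex.real_smul, prodKet, Finset.prod_mul_distrib,
      Complex.ofReal_prod, star_prod]
  rw [key]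
  refine hS.sum_mem (fun m _ => Finset.prod_nonneg fun j _ => h0 j _) ?_
    fun m _ => h _ fun j => (he j).isUnitKet _
  have h := Finset.prod_univ_sum (fun _ : Fin N => (Finset.univ : Finset α)) fun j i => r j i
  rw [Fintype.piFinset_univ] at h
  rw [← h]
  exact Finset.prod_eq_one fun j _ => h1 j

lemma isDensityMatrix_of_mem_separableStates {σ : Matrix (Fin N → α) (Fin N → α) ℂ}
    (hσ : σ ∈ separableStates N α) : IsDensityMatrix σ :=
  separableStates_subset convex_isDensityMatrix
    (fun _ hv => isDensityMatrix_ketBra (IsUnitKet.prodKet hv)) hσ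

lemma trace_mul_re_le_of_mem_separableStates {Q σ : Matrix (Fin N → α) (Fin N → α) ℂ} {c : ℝ}
    (hQ : ∀ v : Fin N → α → ℂ, (∀ j, IsUnitKet (v j)) →
      (star (prodKet v) ⬝ᵥ Q.mulVec (prodKet v)).re ≤ c)
    (hσ : σ ∈ separableStates N α) : (Q * σ).trace.re ≤ c := by
  refine separableStates_subset (S := {σ | (Q * σ).trace.re ≤ c}) ?_ (fun v hv => ?_) hσ
  · intro σ hσ τ hτ a b ha hb hab
    simp only [Set.mem_ofPred_eq, mul_add, Matrix.mul_smul, Matrix.trace_add, Matrix.trace_smul,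
      Complex.add_re, Complex.smul_re, smul_eq_mul] at *
    calc _ ≤ a * c + b * c := by gcongr
      _ = c := by rw [← add_mul, hab, one_mul]
  · rw [Set.mem_ofPred_eq, trace_mul_ketBra]
    exact hQ v hv

/-- A separation of local indices `γ ≃ α × β` separates `N`-tuples of indices. -/
def splitEquiv (N : ℕ) {α β γ : Type*} (e : γ ≃ α × β) :
    (Fin N → γ) ≃ (Fin N → α) × (Fin N → β) :=
  (Equiv.arrowCongr (Equiv.refl _) e).trans (Equiv.arrowProdEquivProdArrow _ _ _)

/-- The tensor product of two `N`-partite operators as an `N`-partite operator. -/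
noncomputable def joinOp {N : ℕ} {α β γ : Type*} (e : γ ≃ α × β)
    (ρ : Matrix (Fin N → α) (Fin N → α) ℂ) (σ : Matrix (Fin N → β) (Fin N → β) ℂ) :
    Matrix (Fin N → γ) (Fin N → γ) ℂ :=
  (Matrix.kroneckerMap (· * ·) ρ σ).submatrix (splitEquiv N e) (splitEquiv N e)

/-- The tensor product of two `N`-partite vectors as an `N`-partite vector. -/
def joinKet {N : ℕ} {α β γ : Type*} (e : γ ≃ α × β) (ψ : (Fin N → α) → ℂ)
    (χ : (Fin N → β) → ℂ) (x : Fin N → γ) : ℂ :=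
  ψ (splitEquiv N e x).1 * χ (splitEquiv N e x).2

variable (e : γ ≃ α × β)

lemma joinOp_apply {N : ℕ} {α β γ : Type*} (e : γ ≃ α × β) (ρ : Matrix (Fin N → α) (Fin N → α) ℂ)
    (σ : Matrix (Fin N → β) (Fin N → β) ℂ) (x y : Fin N → γ) :
    joinOp e ρ σ x y = ρ (splitEquiv N e x).1 (splitEquiv N e y).1 *
      σ (splitEquiv N e x).2 (splitEquiv N e y).2 := rfl

lemma sum_splitEquiv {M : Type*} [AddCommMonoid M]
    (f : (Fin N → α) → (Fin N → β) → M) :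
    ∑ x : Fin N → γ, f (splitEquiv N e x).1 (splitEquiv N e x).2 = ∑ x, ∑ y, f x y := by
  rw [(splitEquiv N e).sum_comp fun q => f q.1 q.2, Fintype.sum_prod_type]

lemma ketBra_joinKet {N : ℕ} {α β γ : Type*} (e : γ ≃ α × β) (ψ : (Fin N → α) → ℂ)
    (χ : (Fin N → β) → ℂ) :
    ketBra (joinKet e ψ χ) = joinOp e (ketBra ψ) (ketBra χ) := by
  ext x y
  simp only [ketBra_apply, joinKet, joinOp_apply, star_mul']
  ring

lemma prodKet_mul {N : ℕ} {α β γ : Type*} (e : γ ≃ α × β) (v : Fin N → α → ℂ) (w : Fin N → β → ℂ) :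
    prodKet (fun j c => v j (e c).1 * w j (e c).2) = joinKet e (prodKet v) (prodKet w) := by
  funext x
  simp only [prodKet, joinKet, Finset.prod_mul_distrib]
  rfl

lemma joinOp_mul_joinOp (A C : Matrix (Fin N → α) (Fin N → α) ℂ)
    (B D : Matrix (Fin N → β) (Fin N → β) ℂ) :
    joinOp e A B * joinOp e C D = joinOp e (A * C) (B * D) := by
  rw [joinOp, joinOp, Matrix.submatrix_mul_equiv, ← Matrix.mul_kronecker_mul]
  rfl

lemma trace_joinOp
    (A : Matrix (Fin N → α) (Fin N → α) ℂ)
    (B : Matrix (Fin N → β) (Fin N → β) ℂ) :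
    (joinOp e A B).trace = A.trace * B.trace := by
  simp only [Matrix.trace, Matrix.diag, joinOp_apply]
  rw [sum_splitEquiv e fun x y => A x x * B y y, Finset.sum_mul_sum]

lemma joinOp_mulVec_joinKet
    (A : Matrix (Fin N → α) (Fin N → α) ℂ)
    (B : Matrix (Fin N → β) (Fin N → β) ℂ) (ψ : (Fin N → α) → ℂ) (χ : (Fin N → β) → ℂ) :
    (joinOp e A B).mulVec (joinKet e ψ χ) = joinKet e (A.mulVec ψ) (B.mulVec χ) := by
  funext x
  simp only [Matrix.mulVec, dotProduct, joinOp_apply, joinKet]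
  rw [sum_splitEquiv e fun y y' => A (splitEquiv N e x).1 y * B (splitEquiv N e x).2 y' *
    (ψ y * χ y'), Finset.sum_mul_sum]
  refine Finset.sum_congr rfl fun _ _ => Finset.sum_congr rfl fun _ _ => by ring

lemma star_joinKet_dotProduct
    (ψ ψ' : (Fin N → α) → ℂ) (χ χ' : (Fin N → β) → ℂ) :
    star (joinKet e ψ χ) ⬝ᵥ joinKet e ψ' χ' = (star ψ ⬝ᵥ ψ') * (star χ ⬝ᵥ χ') := by
  simp only [dotProduct, Pi.star_apply, joinKet]
  rw [sum_splitEquiv e fun y y' => star (ψ y * χ y') * (ψ' y * χ' y'), Finset.sum_mul_sum]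
  refine Finset.sum_congr rfl fun _ _ => Finset.sum_congr rfl fun _ _ => ?_
  rw [star_mul']
  ring

lemma IsUnitKet.mul {v : α → ℂ} {w : β → ℂ}
    (hv : IsUnitKet v) (hw : IsUnitKet w) :
    IsUnitKet fun c => v (e c).1 * w (e c).2 := by
  simp only [IsUnitKet, norm_mul, mul_pow] at *
  rw [e.sum_comp fun q => ‖v q.1‖ ^ 2 * ‖w q.2‖ ^ 2, Fintype.sum_prod_type]
  simp only [← Finset.mul_sum, hw, mul_one, hv]

lemma joinOp_posSemidef {γ : Type*} (e : γ ≃ α × β) {A : Matrix (Fin N → α) (Fin N → α) ℂ}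
    {B : Matrix (Fin N → β) (Fin N → β) ℂ} (hA : A.PosSemidef) (hB : B.PosSemidef) :
    (joinOp e A B).PosSemidef :=
  (hA.kronecker hB).submatrix _

lemma IsDensityMatrix.joinOp
    {A : Matrix (Fin N → α) (Fin N → α) ℂ}
    {B : Matrix (Fin N → β) (Fin N → β) ℂ} (hA : IsDensityMatrix A) (hB : IsDensityMatrix B) :
    IsDensityMatrix (joinOp e A B) :=
  ⟨joinOp_posSemidef e hA.1 hB.1, by rw [trace_joinOp, hA.2, hB.2, one_mul]⟩

lemma joinOp_add_left {N : ℕ} {α β γ : Type*} (e : γ ≃ α × β)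
    (A A' : Matrix (Fin N → α) (Fin N → α) ℂ)
    (B : Matrix (Fin N → β) (Fin N → β) ℂ) :
    joinOp e (A + A') B = joinOp e A B + joinOp e A' B := by
  ext x y; simp [joinOp_apply, add_mul]

lemma joinOp_add_right {N : ℕ} {α β γ : Type*} (e : γ ≃ α × β)
    (A : Matrix (Fin N → α) (Fin N → α) ℂ)
    (B B' : Matrix (Fin N → β) (Fin N → β) ℂ) :
    joinOp e A (B + B') = joinOp e A B + joinOp e A B' := by
  ext x y; simp [joinOp_apply, mul_add]

lemma joinOp_smul_left {N : ℕ} {α β γ : Type*} (e : γ ≃ α × β) (c : ℝ)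
    (A : Matrix (Fin N → α) (Fin N → α) ℂ) (B : Matrix (Fin N → β) (Fin N → β) ℂ) :
    joinOp e (c • A) B = c • joinOp e A B := by
  ext x y; simp [joinOp_apply, mul_assoc]

lemma joinOp_smul_right {N : ℕ} {α β γ : Type*} (e : γ ≃ α × β) (c : ℝ)
    (A : Matrix (Fin N → α) (Fin N → α) ℂ) (B : Matrix (Fin N → β) (Fin N → β) ℂ) :
    joinOp e A (c • B) = c • joinOp e A B := by
  ext x y; simp [joinOp_apply, mul_left_comm]

/-- Bilinearity reduces to pure product states, whose tensor product is again a product once the two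
factors of each party are grouped together. -/
lemma joinOp_mem_separableStates
    {σ : Matrix (Fin N → α) (Fin N → α) ℂ}
    {τ : Matrix (Fin N → β) (Fin N → β) ℂ} (hσ : σ ∈ separableStates N α)
    (hτ : τ ∈ separableStates N β) : joinOp e σ τ ∈ separableStates N γ := by
  refine separableStates_subset (S := {σ | joinOp e σ τ ∈ separableStates N γ}) ?_
    (fun v hv => ?_) hσ
  · intro σ hσ σ' hσ' a b ha hb hab
    rw [Set.mem_ofPred_eq, joinOp_add_left, joinOp_smul_left, joinOp_smul_left]
    exact convex_separableStates hσ hσ' ha hb hab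
  refine separableStates_subset
    (S := {τ | joinOp e (ketBra (prodKet v)) τ ∈ separableStates N γ}) ?_ (fun w hw => ?_) hτ
  · intro σ hσ σ' hσ' a b ha hb hab
    rw [Set.mem_ofPred_eq, joinOp_add_right, joinOp_smul_right, joinOp_smul_right]
    exact convex_separableStates hσ hσ' ha hb hab
  rw [Set.mem_ofPred_eq, ← ketBra_joinKet, ← prodKet_mul]
  exact ketBra_prodKet_mem fun j => (hv j).mul e (hw j)

end Separable

/-! ### Tensor powers -/

section TensorPower

variable {N : ℕ} {α : Type*}

lemma tensorPower_add (ρ : Matrix (Fin N → α) (Fin N → α) ℂ) (m n : ℕ) :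
    tensorPower ρ (m + n) =
      joinOp (Fin.appendEquiv m n).symm (tensorPower ρ m) (tensorPower ρ n) := by
  ext x y
  simp only [tensorPower, Matrix.of_apply, joinOp_apply, Fin.prod_univ_add]
  rfl

lemma tensorPower_succ (ρ : Matrix (Fin N → α) (Fin N → α) ℂ) (n : ℕ) :
    tensorPower ρ (n + 1) =
      joinOp (Fin.consEquiv fun _ => α).symm ρ (tensorPower ρ n) := by
  ext x y
  simp only [tensorPower, Matrix.of_apply, joinOp_apply, Fin.prod_univ_succ]
  rfl

lemma tensorPower_two (ρ : Matrix (Fin N → α) (Fin N → α) ℂ) :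
    tensorPower ρ 2 = joinOp (finTwoArrowEquiv α) ρ ρ := by
  ext x y
  simp only [tensorPower, Matrix.of_apply, joinOp_apply, Fin.prod_univ_two]
  rfl

lemma IsDensityMatrix.tensorPower [Fintype α] [DecidableEq α]
    {ρ : Matrix (Fin N → α) (Fin N → α) ℂ} (hρ : IsDensityMatrix ρ) (n : ℕ) :
    IsDensityMatrix (tensorPower ρ n) := by
  induction n with
  | zero =>
    -- With no copies there is a single basis state, and the matrix is the `1 × 1` identity.
    have : MultipartiteEntanglement.tensorPower ρ 0 = 1 := by
      ext x y
      rw [Subsingleton.elim x y]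
      simp [MultipartiteEntanglement.tensorPower]
    rw [this]
    exact ⟨Matrix.PosSemidef.one, by simp⟩
  | succ n ih =>
    rw [tensorPower_succ]
    exact hρ.joinOp _ ih

end TensorPower

/-! ### Functional calculus and relative entropy in eigenbases -/

section Spectral

variable {n I J : Type*} [Fintype n] [DecidableEq n] [Fintype I] [DecidableEq I]
  [Fintype J] [DecidableEq J] {e : I → n → ℂ} {f : J → n → ℂ}

lemma IsKetBasis.ketBra_mul_ketBra (he : IsKetBasis e) (i j : I) :
    ketBra (e i) * ketBra (e j) = if i = j then ketBra (e i) else 0 := by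
  rw [ketBra, ketBra, Matrix.vecMulVec_mul_vecMulVec, he.orth]
  split_ifs with h
  · rw [h, one_smul]
  · rw [zero_smul, Matrix.vecMulVec_zero]

lemma IsKetBasis.sum_smul_mul_sum_smul (he : IsKetBasis e) (r s : I → ℝ) :
    (∑ i, r i • ketBra (e i)) * ∑ i, s i • ketBra (e i) = ∑ i, (r i * s i) • ketBra (e i) := by
  rw [Finset.sum_mul_sum]
  refine Finset.sum_congr rfl fun i _ => ?_
  rw [Finset.sum_eq_single i]
  · rw [smul_mul_smul_comm, he.ketBra_mul_ketBra, if_pos rfl]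
  · intro j _ hj
    rw [smul_mul_smul_comm, he.ketBra_mul_ketBra, if_neg hj.symm, smul_zero]
  · simp

lemma isHermitian_sum_smul_ketBra {n I : Type*} [Fintype n] [Fintype I] (e : I → n → ℂ)
    (r : I → ℝ) : (∑ i, r i • ketBra (e i)).IsHermitian := by
  rw [Matrix.IsHermitian, Matrix.conjTranspose_sum]
  refine Finset.sum_congr rfl fun i _ => ?_
  rw [Matrix.conjTranspose_smul, (posSemidef_ketBra (e i)).isHermitian.eq, star_trivial]

lemma IsKetBasis.aeval_sum_smul (he : IsKetBasis e) (r : I → ℝ) (q : Polynomial ℝ) :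
    Polynomial.aeval (∑ i, r i • ketBra (e i)) q = ∑ i, q.eval (r i) • ketBra (e i) := by
  induction q using Polynomial.induction_on with
  | C a =>
    simp only [Polynomial.aeval_C, Polynomial.eval_C]
    rw [← Finset.smul_sum, he.complete, Algebra.algebraMap_eq_smul_one]
  | add p q hp hq =>
    simp only [map_add, hp, hq, Polynomial.eval_add, add_smul, Finset.sum_add_distrib]
  | monomial k a h =>
    rw [pow_succ, ← mul_assoc, map_mul, h, Polynomial.aeval_X, he.sum_smul_mul_sum_smul]
    simp [mul_assoc]

/-- Interpolating `g` on a finite set reduces to polynomials. The nodes include both the spectrum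
and all `r i`, so the two need not be compared. -/
lemma IsKetBasis.cfc_sum_smul (he : IsKetBasis e) (r : I → ℝ) (g : ℝ → ℝ) :
    cfc g (∑ i, r i • ketBra (e i)) = ∑ i, g (r i) • ketBra (e i) := by
  classical
  set ρ := ∑ i, r i • ketBra (e i) with hρ
  have hh : IsSelfAdjoint ρ := isHermitian_sum_smul_ketBra e r
  have hfin : (spectrum ℝ ρ).Finite := Matrix.finite_real_spectrum
  set T : Finset ℝ := Finset.univ.image r ∪ hfin.toFinset with hT
  set q : Polynomial ℝ := Lagrange.interpolate T id g with hq
  have hqe : ∀ t ∈ T, q.eval t = g t := fun t ht =>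
    Lagrange.eval_interpolate_at_node g (fun _ _ _ _ h => h) ht
  have h1 : cfc g ρ = cfc q.eval ρ := cfc_congr fun t ht => (hqe t (by simp [hT, ht])).symm
  rw [h1, cfc_polynomial q ρ hh, hρ, he.aeval_sum_smul]
  exact Finset.sum_congr rfl fun i _ => by rw [hqe (r i) (by simp [hT])]

lemma sum_smul_ketBra_mulVec {n I : Type*} [Fintype n] [Fintype I] (e : I → n → ℂ)
    (r : I → ℝ) (v : n → ℂ) :
    (∑ i, r i • ketBra (e i)).mulVec v = ∑ i, ((r i : ℂ) * (star (e i) ⬝ᵥ v)) • e i := by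
  rw [Matrix.sum_mulVec]
  refine Finset.sum_congr rfl fun i _ => ?_
  rw [Matrix.smul_mulVec, ketBra_mulVec, mul_smul]
  rfl

lemma star_dotProduct_comm {n : Type*} [Fintype n] (v w : n → ℂ) :
    star (star v ⬝ᵥ w) = star w ⬝ᵥ v := by
  rw [Matrix.star_dotProduct, star_star, dotProduct_comm]

lemma star_dotProduct_sum_smul_ketBra_mulVec {n I : Type*} [Fintype n] [Fintype I] (e : I → n → ℂ)
    (r : I → ℝ) (v : n → ℂ) :
    star v ⬝ᵥ (∑ i, r i • ketBra (e i)).mulVec v =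
      ((∑ i, r i * ‖star (e i) ⬝ᵥ v‖ ^ 2 : ℝ) : ℂ) := by
  rw [sum_smul_ketBra_mulVec, dotProduct_sum]
  push_cast
  refine Finset.sum_congr rfl fun i _ => ?_
  rw [dotProduct_smul, smul_eq_mul, mul_assoc, ← star_dotProduct_comm (e i) v,
    mul_comm (star (e i) ⬝ᵥ v), star_mul_self_eq]
  push_cast; rfl

lemma IsKetBasis.sum_smul_mulVec_apply (he : IsKetBasis e) (r : I → ℝ) (i : I) :
    (∑ i, r i • ketBra (e i)).mulVec (e i) = (r i : ℂ) • e i := by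
  rw [sum_smul_ketBra_mulVec, Finset.sum_eq_single i]
  · simp [he.orth]
  · intro j _ hj
    simp [he.orth, hj]
  · simp

lemma IsKetBasis.sum_dotProduct_smul (he : IsKetBasis e) (v : n → ℂ) :
    ∑ i, (star (e i) ⬝ᵥ v) • e i = v := by
  have := sum_smul_ketBra_mulVec e (fun _ => 1) v
  simp only [one_smul, he.complete, Matrix.one_mulVec, Complex.ofReal_one, one_mul] at this
  exact this.symm

lemma IsKetBasis.sum_norm_sq (he : IsKetBasis e) (v : n → ℂ) :
    ∑ i, ‖star (e i) ⬝ᵥ v‖ ^ 2 = ∑ x, ‖v x‖ ^ 2 := by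
  have := star_dotProduct_sum_smul_ketBra_mulVec e (fun _ => 1) v
  simp only [one_smul, he.complete, Matrix.one_mulVec, one_mul, star_dotProduct_self] at this
  exact_mod_cast this.symm

lemma norm_star_dotProduct_comm {n : Type*} [Fintype n] (v w : n → ℂ) :
    ‖star v ⬝ᵥ w‖ = ‖star w ⬝ᵥ v‖ := by
  rw [← star_dotProduct_comm, norm_star]

lemma IsKetBasis.sum_norm_sq_right (he : IsKetBasis e) (hf : IsKetBasis f) (i : I) :
    ∑ j, ‖star (e i) ⬝ᵥ f j‖ ^ 2 = 1 := by
  simp only [norm_star_dotProduct_comm (e i)]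
  rw [hf.sum_norm_sq]
  exact he.isUnitKet i

/-- The kernel of the operator diagonal in `f` is spanned by the `f j` with `s j = 0`, so only these
need testing. -/
lemma IsKetBasis.support_iff (he : IsKetBasis e) (hf : IsKetBasis f) (r : I → ℝ) (s : J → ℝ) :
    (∀ v, (∑ j, s j • ketBra (f j)).mulVec v = 0 → (∑ i, r i • ketBra (e i)).mulVec v = 0) ↔
      ∀ i j, s j = 0 → r i ≠ 0 → star (e i) ⬝ᵥ f j = 0 := by
  have key : ∀ (v : n → ℂ) (i : I), star (e i) ⬝ᵥ (∑ i, r i • ketBra (e i)).mulVec v =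
      (r i : ℂ) * (star (e i) ⬝ᵥ v) := by
    intro v i
    rw [sum_smul_ketBra_mulVec, dotProduct_sum, Finset.sum_eq_single i]
    · simp [he.orth]
    · intro j _ hj
      simp [he.orth, hj.symm]
    · simp
  have key' : ∀ (v : n → ℂ) (j : J), star (f j) ⬝ᵥ (∑ j, s j • ketBra (f j)).mulVec v =
      (s j : ℂ) * (star (f j) ⬝ᵥ v) := by
    intro v i
    rw [sum_smul_ketBra_mulVec, dotProduct_sum, Finset.sum_eq_single i]
    · simp [hf.orth]
    · intro j _ hj
      simp [hf.orth, hj.symm]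
    · simp
  constructor
  · intro h i j hs hr
    have h1 := h (f j) (by rw [hf.sum_smul_mulVec_apply, hs]; simp)
    have h2 := key (f j) i
    rw [h1, dotProduct_zero] at h2
    exact (mul_eq_zero.1 h2.symm).resolve_left (by exact_mod_cast hr)
  · intro h v hv
    rw [sum_smul_ketBra_mulVec]
    refine Finset.sum_eq_zero fun i _ => ?_
    by_cases hr : r i = 0
    · simp [hr]
    have : star (e i) ⬝ᵥ v = 0 := by
      rw [← hf.sum_dotProduct_smul v, dotProduct_sum]
      refine Finset.sum_eq_zero fun j _ => ?_
      rw [dotProduct_smul, smul_eq_mul]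
      by_cases hs : s j = 0
      · rw [h i j hs hr, mul_zero]
      · have h2 := key' v j
        rw [hv, dotProduct_zero] at h2
        rw [(mul_eq_zero.1 h2.symm).resolve_left (by exact_mod_cast hs), zero_mul]
    rw [this]
    simp

lemma trace_ketBra_mul_ketBra {n : Type*} [Fintype n] (v w : n → ℂ) :
    (ketBra v * ketBra w).trace = ((‖star v ⬝ᵥ w‖ ^ 2 : ℝ) : ℂ) := by
  rw [trace_mul_ketBra, ketBra_mulVec, dotProduct_smul, smul_eq_mul, ← star_dotProduct_comm v w,
    mul_comm, star_mul_self_eq]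

open Classical in
/-- The relative entropy in terms of the eigenvalues and the overlaps of the eigenvectors. -/
lemma relativeEntropy_eq (he : IsKetBasis e) (hf : IsKetBasis f) (r : I → ℝ) (s : J → ℝ) :
    relativeEntropy (∑ i, r i • ketBra (e i)) (∑ j, s j • ketBra (f j)) =
      if ∀ i j, s j = 0 → r i ≠ 0 → star (e i) ⬝ᵥ f j = 0 then
        ((∑ i, ∑ j, ‖star (e i) ⬝ᵥ f j‖ ^ 2 * (r i * (Real.logb 2 (r i) - Real.logb 2 (s j))) :
          ℝ) : EReal)
      else ⊤ := by
  rw [relativeEntropy]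
  simp only [he.support_iff hf]
  split_ifs with h
  swap
  · rfl
  congr 1
  rw [he.cfc_sum_smul, hf.cfc_sum_smul, mul_sub, he.sum_smul_mul_sum_smul, Finset.sum_mul_sum,
    Matrix.trace_sub, Complex.sub_re, Matrix.trace_sum, Matrix.trace_sum, Complex.re_sum,
    Complex.re_sum, ← Finset.sum_sub_distrib]
  refine Finset.sum_congr rfl fun i _ => ?_
  rw [Matrix.trace_smul, trace_ketBra, he.orth, if_pos rfl, Matrix.trace_sum, Complex.re_sum]
  simp only [mul_sub, Finset.sum_sub_distrib]
  rw [← Finset.sum_mul, he.sum_norm_sq_right hf]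
  congr 1
  · simp
  · refine Finset.sum_congr rfl fun j _ => ?_
    rw [smul_mul_smul_comm, Matrix.trace_smul, trace_ketBra_mul_ketBra, Complex.smul_re,
      Complex.ofReal_re, smul_eq_mul]
    ring

end Spectral

/-! ### Lower and upper bounds on the relative entropy -/

section Bounds

variable {n : Type*} [Fintype n] [DecidableEq n]

lemma relativeEntropy_ne_bot (ρ σ : Matrix n n ℂ) : relativeEntropy ρ σ ≠ ⊥ := by
  rw [relativeEntropy]
  split_ifs
  · exact EReal.coe_ne_bot _
  · exact top_ne_bot

/-- Lower bound on the relative entropy from the measurement of a projection `P ≥ supp ρ`. -/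
lemma neg_logb_le_relativeEntropy {ρ σ P : Matrix n n ℂ} (hρ : IsDensityMatrix ρ)
    (hσ : σ.PosSemidef) (hP : P.IsHermitian) (hPP : P * P = P) (hPρ : P * ρ = ρ) {q : ℝ}
    (hq : 0 < q) (hPσ : (P * σ).trace.re ≤ q) :
    ((-Real.logb 2 q : ℝ) : EReal) ≤ relativeEntropy ρ σ := by
  classical
  obtain ⟨e, r, he, rfl, hr0, hr1⟩ := hρ.exists_eigenbasis
  obtain ⟨f, s, hf, hσs, hs0⟩ := exists_eigenbasis hσ.isHermitian
  have hs0 := hs0 hσ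
  rw [hσs, relativeEntropy_eq he hf]
  split_ifs with hsupp
  swap
  · exact le_top
  rw [EReal.coe_le_coe_iff]
  have hPe : ∀ i, r i ≠ 0 → P.mulVec (e i) = e i := by
    intro i hi
    have h1 : (P * ∑ i, r i • ketBra (e i)).mulVec (e i) = (r i : ℂ) • e i := by
      rw [hPρ, he.sum_smul_mulVec_apply]
    rw [← Matrix.mulVec_mulVec, he.sum_smul_mulVec_apply, Matrix.mulVec_smul] at h1
    exact smul_right_injective _ (show (r i : ℂ) ≠ 0 by exact_mod_cast hi) h1
  -- `Q` is the support projection of `ρ`. It satisfies `Q ≤ P` and is diagonal in the eigenbasis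
  -- `e`, which `P` need not be.
  set t : n → ℝ := fun i => if r i = 0 then 0 else 1 with ht
  set Q : Matrix n n ℂ := ∑ i, t i • ketBra (e i) with hQ
  have hQh : Q.IsHermitian := isHermitian_sum_smul_ketBra e t
  have hQQ : Q * Q = Q := by
    rw [hQ, he.sum_smul_mul_sum_smul]
    refine Finset.sum_congr rfl fun i _ => ?_
    simp only [ht]; split_ifs <;> simp
  have hPQ : P * Q = Q := by
    rw [hQ, Matrix.mul_sum]
    refine Finset.sum_congr rfl fun i _ => ?_
    simp only [ht]
    split_ifs with h
    · simp
    · rw [one_smul, ketBra, Matrix.mul_vecMulVec, hPe i h]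
  have hQP : Q * P = Q := by
    have := congrArg Matrix.conjTranspose hPQ
    rwa [Matrix.conjTranspose_mul, hQh.eq, hP.eq] at this
  have hpsd : (P - Q).PosSemidef := by
    have : (P - Q) = (P - Q) * (P - Q).conjTranspose := by
      rw [Matrix.conjTranspose_sub, hP.eq, hQh.eq, sub_mul, mul_sub, mul_sub, hPP, hQQ, hPQ, hQP]
      simp
    rw [this]
    exact Matrix.posSemidef_self_mul_conjTranspose _
  have hQσ : (Q * σ).trace.re ≤ q := by
    have := trace_mul_re_nonneg hpsd hσ
    rw [sub_mul, Matrix.trace_sub, Complex.sub_re] at this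
    linarith
  have hsum : ∑ i, ∑ j, ‖star (e i) ⬝ᵥ f j‖ ^ 2 * (t i * s j) ≤ q := by
    refine le_of_eq_of_le ?_ hQσ
    rw [hQ, hσs, Finset.sum_mul_sum, Matrix.trace_sum, Complex.re_sum]
    refine Finset.sum_congr rfl fun i _ => ?_
    rw [Matrix.trace_sum, Complex.re_sum]
    refine Finset.sum_congr rfl fun j _ => ?_
    rw [smul_mul_smul_comm, Matrix.trace_smul, trace_ketBra_mul_ketBra, Complex.smul_re,
      Complex.ofReal_re, smul_eq_mul, mul_comm]
  -- This is `log x ≥ 1 - 1/x` at `x = q r / s`. The sum is `1 - log q - tr Qσ / q`, which is at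
  -- least `-log q`.
  have hterm : ∀ i j, ‖star (e i) ⬝ᵥ f j‖ ^ 2 * (r i * (1 - Real.log q)) -
      ‖star (e i) ⬝ᵥ f j‖ ^ 2 * (t i * s j) / q ≤
      ‖star (e i) ⬝ᵥ f j‖ ^ 2 * (r i * (Real.log (r i) - Real.log (s j))) := by
    intro i j
    by_cases hr : r i = 0
    · simp [ht, hr]
    by_cases hc : star (e i) ⬝ᵥ f j = 0
    · simp [hc]
    have hs : s j ≠ 0 := fun h => hc (hsupp i j h hr)
    have hrp : 0 < r i := lt_of_le_of_ne (hr0 i) (Ne.symm hr)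
    have hsp : 0 < s j := lt_of_le_of_ne (hs0 j) (Ne.symm hs)
    have h1 := Real.one_sub_inv_le_log_of_pos (show 0 < q * r i / s j by positivity)
    rw [Real.log_div (by positivity) (by positivity), Real.log_mul (by positivity) (by positivity)]
      at h1
    rw [mul_div_assoc, ← mul_sub]
    refine mul_le_mul_of_nonneg_left ?_ (by positivity)
    have h2 := mul_le_mul_of_nonneg_left h1 hrp.le
    have h3 : r i * (1 - (q * r i / s j)⁻¹) = r i - s j / q := by
      field_simp
    rw [h3] at h2
    simp only [ht, if_neg hr, one_mul]
    linarith
  have hfin : -Real.log q ≤ ∑ i, ∑ j, ‖star (e i) ⬝ᵥ f j‖ ^ 2 *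
      (r i * (Real.log (r i) - Real.log (s j))) := by
    refine le_trans ?_ (Finset.sum_le_sum fun i _ => Finset.sum_le_sum fun j _ => hterm i j)
    simp only [Finset.sum_sub_distrib, ← Finset.sum_mul, ← Finset.sum_div,
      he.sum_norm_sq_right hf, one_mul, hr1]
    have := (div_le_one hq).2 hsum
    linarith
  have hl2 : 0 < Real.log 2 := Real.log_pos one_lt_two
  have h2 := div_le_div_of_nonneg_right hfin hl2.le
  rw [neg_div, Finset.sum_div] at h2
  refine h2.trans_eq (Finset.sum_congr rfl fun i _ => ?_)
  rw [Finset.sum_div]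
  refine Finset.sum_congr rfl fun j _ => ?_
  simp only [Real.logb]
  ring

/-- The relative entropy is at most the max-relative entropy. -/
lemma relativeEntropy_le_logb {ρ σ : Matrix n n ℂ} (hρ : IsDensityMatrix ρ)
    (hσ : σ.PosSemidef) {l : ℝ} (hl : 0 < l) (h : (l • σ - ρ).PosSemidef) :
    relativeEntropy ρ σ ≤ ((Real.logb 2 l : ℝ) : EReal) := by
  classical
  obtain ⟨e, r, he, rfl, hr0, hr1⟩ := hρ.exists_eigenbasis
  obtain ⟨f, s, hf, hσs, hs0⟩ := exists_eigenbasis hσ.isHermitian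
  have hs0 := hs0 hσ
  rw [hσs] at h
  have hquad : ∀ v : n → ℂ, ∑ i, r i * ‖star (e i) ⬝ᵥ v‖ ^ 2 ≤
      l * ∑ j, s j * ‖star (f j) ⬝ᵥ v‖ ^ 2 := by
    intro v
    have h1 := h.dotProduct_mulVec_nonneg v
    rw [Matrix.sub_mulVec, dotProduct_sub, Matrix.smul_mulVec, dotProduct_smul,
      star_dotProduct_sum_smul_ketBra_mulVec, star_dotProduct_sum_smul_ketBra_mulVec,
      Complex.real_smul] at h1
    have h2 := (Complex.le_def.1 h1).1
    rw [Complex.zero_re, Complex.sub_re, ← Complex.ofReal_mul, Complex.ofReal_re,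
      Complex.ofReal_re] at h2
    linarith
  have hle : ∀ i (v : n → ℂ), r i * ‖star (e i) ⬝ᵥ v‖ ^ 2 ≤
      l * ∑ j, s j * ‖star (f j) ⬝ᵥ v‖ ^ 2 := fun i v => by
    refine le_trans ?_ (hquad v)
    exact Finset.single_le_sum (f := fun i => r i * ‖star (e i) ⬝ᵥ v‖ ^ 2)
      (fun j _ => mul_nonneg (hr0 j) (by positivity)) (Finset.mem_univ i)
  have hsupp : ∀ i j, s j = 0 → r i ≠ 0 → star (e i) ⬝ᵥ f j = 0 := by
    intro i j hs hr
    have h1 := hle i (f j)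
    have h2 : ∑ k, s k * ‖star (f k) ⬝ᵥ f j‖ ^ 2 = 0 := by
      refine Finset.sum_eq_zero fun k _ => ?_
      rw [hf.orth]
      split_ifs with hk
      · rw [hk, hs, zero_mul]
      · simp
    rw [h2, mul_zero] at h1
    have hrp : 0 < r i := lt_of_le_of_ne (hr0 i) (Ne.symm hr)
    have h3 : ‖star (e i) ⬝ᵥ f j‖ ^ 2 = 0 :=
      le_antisymm (by nlinarith [sq_nonneg ‖star (e i) ⬝ᵥ f j‖]) (by positivity)
    simpa using h3
  rw [hσs, relativeEntropy_eq he hf, if_pos hsupp, EReal.coe_le_coe_iff]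
  -- `g i = ⟨e i|σ⁻¹|e i⟩`, with the inverse taken on the support of `σ` since division by zero
  -- gives zero.
  set g : n → ℝ := fun i => ∑ j, ‖star (e i) ⬝ᵥ f j‖ ^ 2 / s j with hg
  have hg0 : ∀ i, 0 ≤ g i := fun i =>
    Finset.sum_nonneg fun j _ => div_nonneg (by positivity) (hs0 j)
  have hrg : ∀ i, r i * g i ≤ l := by
    intro i
    -- Testing the operator inequality at `v = σ⁻¹ e i` gives `r i * (g i)² ≤ l * g i`.
    set v : n → ℂ := ∑ j, (((s j)⁻¹ : ℝ) * (star (f j) ⬝ᵥ e i) : ℂ) • f j with hv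
    have hfv : ∀ j, star (f j) ⬝ᵥ v = ((s j)⁻¹ : ℝ) * (star (f j) ⬝ᵥ e i) := by
      intro j
      rw [hv, dotProduct_sum, Finset.sum_eq_single j]
      · rw [dotProduct_smul, hf.orth, if_pos rfl, smul_eq_mul, mul_one]
      · intro k _ hk
        rw [dotProduct_smul, hf.orth, if_neg hk.symm, smul_zero]
      · simp
    have hev : star (e i) ⬝ᵥ v = (g i : ℂ) := by
      rw [hv, dotProduct_sum, hg]
      push_cast
      refine Finset.sum_congr rfl fun j _ => ?_
      rw [dotProduct_smul, smul_eq_mul, ← star_dotProduct_comm (e i) (f j), mul_assoc,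
        star_mul_self_eq]
      push_cast
      ring
    have h1 := hle i v
    have h2 : ∑ j, s j * ‖star (f j) ⬝ᵥ v‖ ^ 2 = g i := by
      rw [hg]
      refine Finset.sum_congr rfl fun j _ => ?_
      rw [hfv, norm_mul, Complex.norm_real, mul_pow, Real.norm_eq_abs, sq_abs,
        norm_star_dotProduct_comm]
      by_cases hs : s j = 0
      · simp [hs]
      · field_simp
    rw [h2, hev, Complex.norm_real, Real.norm_of_nonneg (hg0 i)] at h1
    rcases (hg0 i).eq_or_lt with h0 | h0
    · rw [← h0, mul_zero]; exact hl.le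
    · nlinarith
  -- This is `log x ≤ x - 1` at `x = r / (l s)`. The sum is `log l - 1 + ∑ r² g / l`, and the last
  -- sum is at most one because `r g ≤ l`.
  have hterm : ∀ i j, ‖star (e i) ⬝ᵥ f j‖ ^ 2 * (r i * (Real.log (r i) - Real.log (s j))) ≤
      ‖star (e i) ⬝ᵥ f j‖ ^ 2 * (r i * (Real.log l - 1)) +
      r i * (r i * (‖star (e i) ⬝ᵥ f j‖ ^ 2 / s j)) / l := by
    intro i j
    by_cases hr : r i = 0
    · simp [hr]
    by_cases hc : star (e i) ⬝ᵥ f j = 0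
    · simp [hc]
    have hs : s j ≠ 0 := fun h => hc (hsupp i j h hr)
    have hrp : 0 < r i := lt_of_le_of_ne (hr0 i) (Ne.symm hr)
    have hsp : 0 < s j := lt_of_le_of_ne (hs0 j) (Ne.symm hs)
    have h1 := Real.log_le_sub_one_of_pos (show 0 < r i / (l * s j) by positivity)
    rw [Real.log_div (by positivity) (by positivity), Real.log_mul (by positivity) (by positivity)]
      at h1
    have h3 : r i * (r i * (‖star (e i) ⬝ᵥ f j‖ ^ 2 / s j)) / l =
        ‖star (e i) ⬝ᵥ f j‖ ^ 2 * (r i * (r i / (l * s j))) := by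
      field_simp
    rw [h3, ← mul_add, ← mul_add]
    refine mul_le_mul_of_nonneg_left (mul_le_mul_of_nonneg_left ?_ hrp.le) (by positivity)
    linarith
  have hfin : ∑ i, ∑ j, ‖star (e i) ⬝ᵥ f j‖ ^ 2 *
      (r i * (Real.log (r i) - Real.log (s j))) ≤ Real.log l := by
    refine (Finset.sum_le_sum fun i _ => Finset.sum_le_sum fun j _ => hterm i j).trans ?_
    simp only [Finset.sum_add_distrib, ← Finset.sum_mul, ← Finset.sum_div, ← Finset.mul_sum,
      he.sum_norm_sq_right hf, one_mul, hr1]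
    have : ∑ i, r i * (r i * g i) ≤ l := by
      calc ∑ i, r i * (r i * g i) ≤ ∑ i, r i * l :=
            Finset.sum_le_sum fun i _ => mul_le_mul_of_nonneg_left (hrg i) (hr0 i)
        _ = l := by rw [← Finset.sum_mul, hr1, one_mul]
    have := (div_le_one hl).2 this
    linarith
  have hl2 : 0 < Real.log 2 := Real.log_pos one_lt_two
  refine le_trans (le_of_eq ?_) (div_le_div_of_nonneg_right hfin hl2.le)
  rw [Finset.sum_div]
  refine Finset.sum_congr rfl fun i _ => ?_
  rw [Finset.sum_div]
  refine Finset.sum_congr rfl fun j _ => ?_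
  simp only [Real.logb]
  ring

end Bounds

/-! ### Relative entropy of tensor products -/

section Join

variable {N : ℕ} {α β γ : Type*} [Fintype α] [Fintype β] [Fintype γ]
  [DecidableEq α] [DecidableEq β] [DecidableEq γ] (e : γ ≃ α × β)

lemma joinOp_sum {N : ℕ} {α β γ I J : Type*} [Fintype I] [Fintype J] (e : γ ≃ α × β)
    (A : I → Matrix (Fin N → α) (Fin N → α) ℂ) (B : J → Matrix (Fin N → β) (Fin N → β) ℂ) :
    joinOp e (∑ i, A i) (∑ j, B j) = ∑ q : I × J, joinOp e (A q.1) (B q.2) := by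
  ext x y
  simp only [joinOp_apply, Matrix.sum_apply, Finset.sum_mul_sum, Fintype.sum_prod_type]

lemma IsKetBasis.joinKet {I J : Type*} [Fintype I] [DecidableEq I] [Fintype J] [DecidableEq J]
    {u : I → (Fin N → α) → ℂ} {v : J → (Fin N → β) → ℂ} (hu : IsKetBasis u)
    (hv : IsKetBasis v) : IsKetBasis fun q : I × J => joinKet e (u q.1) (v q.2) := by
  constructor
  · rintro ⟨i, j⟩ ⟨i', j'⟩
    rw [star_joinKet_dotProduct, hu.orth, hv.orth]
    split_ifs <;> simp_all
  · simp only [ketBra_joinKet]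
    rw [← joinOp_sum e (fun i => ketBra (u i)) fun j => ketBra (v j), hu.complete, hv.complete,
      joinOp, Matrix.one_kronecker_one, Matrix.submatrix_one_equiv]

lemma joinOp_sum_smul_ketBra {N : ℕ} {α β γ I J : Type*} [Fintype I] [Fintype J] (e : γ ≃ α × β)
    (u : I → (Fin N → α) → ℂ) (v : J → (Fin N → β) → ℂ) (r : I → ℝ) (s : J → ℝ) :
    joinOp e (∑ i, r i • ketBra (u i)) (∑ j, s j • ketBra (v j)) =
      ∑ q : I × J, (r q.1 * s q.2) • ketBra (joinKet e (u q.1) (v q.2)) := by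
  rw [joinOp_sum]
  refine Finset.sum_congr rfl fun q _ => ?_
  rw [joinOp_smul_left, joinOp_smul_right, smul_smul, ketBra_joinKet]

/-- Eigenvalues and overlaps multiply, so logarithms add. Only `≤` is needed, and infinite
right-hand sides then require nothing. -/
lemma relativeEntropy_joinOp_le {ρ σ : Matrix (Fin N → α) (Fin N → α) ℂ}
    {ρ' σ' : Matrix (Fin N → β) (Fin N → β) ℂ} (hρ : IsDensityMatrix ρ) (hσ : IsDensityMatrix σ)
    (hρ' : IsDensityMatrix ρ') (hσ' : IsDensityMatrix σ') :
    relativeEntropy (joinOp e ρ ρ') (joinOp e σ σ') ≤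
      relativeEntropy ρ σ + relativeEntropy ρ' σ' := by
  classical
  by_cases h1 : relativeEntropy ρ σ = ⊤
  · rw [h1, EReal.top_add_of_ne_bot (relativeEntropy_ne_bot _ _)]; exact le_top
  by_cases h2 : relativeEntropy ρ' σ' = ⊤
  · rw [h2, EReal.add_top_of_ne_bot (relativeEntropy_ne_bot _ _)]; exact le_top
  obtain ⟨u, r, hu, rfl, hr0, hr1⟩ := hρ.exists_eigenbasis
  obtain ⟨u', r', hu', rfl, hr0', hr1'⟩ := hρ'.exists_eigenbasis
  obtain ⟨v, s, hv, rfl, -, -⟩ := hσ.exists_eigenbasis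
  obtain ⟨v', s', hv', rfl, -, -⟩ := hσ'.exists_eigenbasis
  rw [relativeEntropy_eq hu hv] at h1 ⊢
  rw [relativeEntropy_eq hu' hv'] at h2 ⊢
  rw [joinOp_sum_smul_ketBra, joinOp_sum_smul_ketBra,
    relativeEntropy_eq (hu.joinKet e hu') (hv.joinKet e hv')]
  split_ifs at h1 h2 with c1 c2
  · have c3 : ∀ (i : (Fin N → α) × (Fin N → β)) (j : (Fin N → α) × (Fin N → β)),
        s j.1 * s' j.2 = 0 → r i.1 * r' i.2 ≠ 0 →
        star (joinKet e (u i.1) (u' i.2)) ⬝ᵥ joinKet e (v j.1) (v' j.2) = 0 := by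
      intro i j hs hr
      rw [star_joinKet_dotProduct]
      rcases mul_eq_zero.1 hs with h | h
      · rw [c1 _ _ h (left_ne_zero_of_mul hr), zero_mul]
      · rw [c2 _ _ h (right_ne_zero_of_mul hr), mul_zero]
    rw [if_pos c3, if_pos c1, if_pos c2, ← EReal.coe_add, EReal.coe_le_coe_iff]
    apply le_of_eq
    have hterm : ∀ i i' j j', ‖star (joinKet e (u i) (u' i')) ⬝ᵥ joinKet e (v j) (v' j')‖ ^ 2 *
        (r i * r' i' * (Real.logb 2 (r i * r' i') - Real.logb 2 (s j * s' j'))) =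
        (‖star (u i) ⬝ᵥ v j‖ ^ 2 * (r i * (Real.logb 2 (r i) - Real.logb 2 (s j)))) *
          (‖star (u' i') ⬝ᵥ v' j'‖ ^ 2 * r' i') +
        (‖star (u i) ⬝ᵥ v j‖ ^ 2 * r i) * (‖star (u' i') ⬝ᵥ v' j'‖ ^ 2 *
          (r' i' * (Real.logb 2 (r' i') - Real.logb 2 (s' j')))) := by
      intro i i' j j'
      rw [star_joinKet_dotProduct, norm_mul, mul_pow]
      by_cases hr : r i = 0
      · simp [hr]
      by_cases hr' : r' i' = 0
      · simp [hr']
      by_cases hc : star (u i) ⬝ᵥ v j = 0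
      · simp [hc]
      by_cases hc' : star (u' i') ⬝ᵥ v' j' = 0
      · simp [hc']
      have hs : s j ≠ 0 := fun h => hc (c1 _ _ h hr)
      have hs' : s' j' ≠ 0 := fun h => hc' (c2 _ _ h hr')
      rw [Real.logb_mul hr hr', Real.logb_mul hs hs']
      ring
    simp only [Fintype.sum_prod_type, hterm, Finset.sum_add_distrib]
    have hone : ∑ i, ∑ j, ‖star (u i) ⬝ᵥ v j‖ ^ 2 * r i = 1 := by
      simp only [← Finset.sum_mul, hu.sum_norm_sq_right hv, one_mul, hr1]
    have hone' : ∑ i, ∑ j, ‖star (u' i) ⬝ᵥ v' j‖ ^ 2 * r' i = 1 := by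
      simp only [← Finset.sum_mul, hu'.sum_norm_sq_right hv', one_mul, hr1']
    have hfac : ∀ (F : (Fin N → α) → (Fin N → α) → ℝ) (G : (Fin N → β) → (Fin N → β) → ℝ),
        ∑ i, ∑ i', ∑ j, ∑ j', F i j * G i' j' = (∑ i, ∑ j, F i j) * ∑ i', ∑ j', G i' j' := by
      intro F G
      rw [Finset.sum_mul_sum]
      refine Finset.sum_congr rfl fun i _ => Finset.sum_congr rfl fun i' _ => ?_
      rw [Finset.sum_mul_sum]
    rw [hfac (fun i j => _) (fun i' j' => _), hfac (fun i j => _) (fun i' j' => _), hone, hone',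
      mul_one, one_mul]
  · exact absurd rfl h2
  · exact absurd rfl h1
  · exact absurd rfl h1

end Join

/-! ### Basic properties of the three entanglement measures -/

section Measures

variable {N : ℕ} {α : Type*} [Fintype α] [DecidableEq α]
  {ρ : Matrix (Fin N → α) (Fin N → α) ℂ}

lemma isUnitKet_single (a : α) : IsUnitKet (Pi.single a (1 : ℂ)) := by
  rw [IsUnitKet, Finset.sum_eq_single a]
  · simp
  · intro b _ hb
    simp [hb]
  · simp

/-- The identity is the sum of the projections onto computational basis vectors, which are products.
The state serves as a witness that suprema and infima over separable states are taken over nonempty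
sets. -/
lemma maximallyMixed_mem [Nonempty (Fin N → α)] :
    ((Fintype.card (Fin N → α) : ℝ)⁻¹ • (1 : Matrix (Fin N → α) (Fin N → α) ℂ)) ∈
      separableStates N α := by
  have h : (1 : Matrix (Fin N → α) (Fin N → α) ℂ) =
      ∑ x : Fin N → α, ketBra (prodKet fun j => Pi.single (x j) (1 : ℂ)) := by
    have hp : ∀ x y : Fin N → α, prodKet (fun j => Pi.single (x j) (1 : ℂ)) y =
        if y = x then 1 else 0 := by
      intro x y
      simp only [prodKet, Pi.single_apply]
      rw [Finset.prod_ite_zero]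
      simp [funext_iff]
    ext y z
    rw [Matrix.sum_apply]
    simp only [ketBra_apply, hp, Matrix.one_apply]
    rw [Finset.sum_eq_single y]
    · simp [eq_comm]
    · intro b _ hb
      simp [hb.symm]
    · simp
  rw [h, Finset.smul_sum]
  refine convex_separableStates.sum_mem (fun _ _ => by positivity) ?_
    fun x _ => ketBra_prodKet_mem fun j => isUnitKet_single _
  rw [Finset.sum_const, Finset.card_univ, nsmul_eq_mul]
  exact mul_inv_cancel₀ (by exact_mod_cast Fintype.card_ne_zero)

lemma IsDensityMatrix.nonempty {n : Type*} [Fintype n] {ρ : Matrix n n ℂ}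
    (hρ : IsDensityMatrix ρ) : Nonempty n := by
  by_contra h
  rw [not_nonempty_iff] at h
  have := hρ.2
  simp [Matrix.trace] at this

/-- `Δ` is the normalized difference `(1 + t)σ - ρ`, so the robustness asks for the least multiple
of a separable state dominating `ρ`. -/
lemma IsDensityMatrix.mem_robustness_iff {N : ℕ} {α : Type*} [Fintype α]
    {ρ : Matrix (Fin N → α) (Fin N → α) ℂ} (hρ : IsDensityMatrix ρ) (t : ℝ) :
    (0 ≤ t ∧ ∃ Δ : Matrix (Fin N → α) (Fin N → α) ℂ,
      IsDensityMatrix Δ ∧ (1 + t)⁻¹ • (ρ + t • Δ) ∈ separableStates N α) ↔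
    0 ≤ t ∧ ∃ σ ∈ separableStates N α, ((1 + t) • σ - ρ).PosSemidef := by
  refine and_congr_right fun ht => ⟨?_, ?_⟩
  · rintro ⟨Δ, hΔ, h⟩
    refine ⟨_, h, ?_⟩
    rw [smul_inv_smul₀ (by linarith), add_sub_cancel_left]
    exact hΔ.1.smul ht
  · rintro ⟨σ, hσ, h⟩
    have hσd := isDensityMatrix_of_mem_separableStates hσ
    have htr : ((1 + t) • σ - ρ).trace = (t : ℂ) := by
      rw [Matrix.trace_sub, Matrix.trace_smul, hσd.2, hρ.2, Complex.real_smul]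
      push_cast; ring
    -- For `t = 0` the difference cannot be normalized, but being positive of trace zero it
    -- vanishes, and any state serves as `Δ`.
    rcases ht.eq_or_lt with rfl | hpos
    · have h0 : σ = ρ := by
        have := h.trace_eq_zero_iff.1 (by rw [htr]; simp)
        simpa [sub_eq_zero] using this
      refine ⟨ρ, hρ, ?_⟩
      simpa [← h0] using hσ
    · refine ⟨t⁻¹ • ((1 + t) • σ - ρ), ⟨h.smul (by positivity), ?_⟩, ?_⟩
      · rw [Matrix.trace_smul, htr, Complex.real_smul, ← Complex.ofReal_mul,
          inv_mul_cancel₀ hpos.ne', Complex.ofReal_one]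
      · rw [smul_inv_smul₀ hpos.ne', add_sub_cancel, inv_smul_smul₀ (by linarith)]
        exact hσ

lemma IsDensityMatrix.globalRobustness_eq {N : ℕ} {α : Type*} [Fintype α]
    {ρ : Matrix (Fin N → α) (Fin N → α) ℂ} (hρ : IsDensityMatrix ρ) :
    globalRobustness ρ =
      sInf {t : ℝ | 0 ≤ t ∧ ∃ σ ∈ separableStates N α, ((1 + t) • σ - ρ).PosSemidef} := by
  rw [globalRobustness]
  congr 1
  ext t
  exact hρ.mem_robustness_iff t

/-- Since `ρ ≤ 1`, the maximally mixed state works with `1 + t` equal to the total dimension.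
Without this the infimum could be the default value `0` of an empty set. -/
lemma IsDensityMatrix.exists_robustness (hρ : IsDensityMatrix ρ) :
    {t : ℝ | 0 ≤ t ∧ ∃ σ ∈ separableStates N α, ((1 + t) • σ - ρ).PosSemidef}.Nonempty := by
  have := hρ.nonempty
  set D : ℝ := (Fintype.card (Fin N → α) : ℝ) with hD
  have hD1 : 1 ≤ D := by
    rw [hD]; exact_mod_cast Fintype.card_pos
  refine ⟨D - 1, by linarith, _, maximallyMixed_mem, ?_⟩
  rw [add_sub_cancel, smul_inv_smul₀ (by linarith)]
  exact hρ.one_sub_posSemidef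

lemma globalRobustness_nonneg {N : ℕ} {α : Type*} [Fintype α]
    (ρ : Matrix (Fin N → α) (Fin N → α) ℂ) : 0 ≤ globalRobustness ρ :=
  Real.sInf_nonneg fun _ ht => ht.1

lemma logGlobalRobustness_nonneg {N : ℕ} {α : Type*} [Fintype α]
    (ρ : Matrix (Fin N → α) (Fin N → α) ℂ) :
    0 ≤ logGlobalRobustness ρ :=
  Real.logb_nonneg one_lt_two (by linarith [globalRobustness_nonneg ρ])

lemma IsDensityMatrix.globalRobustness_le (hρ : IsDensityMatrix ρ) {l : ℝ} (hl : 1 ≤ l)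
    {σ : Matrix (Fin N → α) (Fin N → α) ℂ} (hσ : σ ∈ separableStates N α)
    (h : (l • σ - ρ).PosSemidef) : 1 + globalRobustness ρ ≤ l := by
  rw [hρ.globalRobustness_eq]
  have : sInf {t : ℝ | 0 ≤ t ∧ ∃ σ ∈ separableStates N α, ((1 + t) • σ - ρ).PosSemidef} ≤ l - 1 :=
    csInf_le ⟨0, fun t ht => ht.1⟩ ⟨by linarith, σ, hσ, by rwa [add_sub_cancel]⟩
  linarith

lemma IsDensityMatrix.logGlobalRobustness_le (hρ : IsDensityMatrix ρ) {l : ℝ} (hl : 1 ≤ l)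
    {σ : Matrix (Fin N → α) (Fin N → α) ℂ} (hσ : σ ∈ separableStates N α)
    (h : (l • σ - ρ).PosSemidef) : logGlobalRobustness ρ ≤ Real.logb 2 l :=
  Real.logb_le_logb_of_le one_lt_two (by linarith [globalRobustness_nonneg ρ])
    (hρ.globalRobustness_le hl hσ h)

/-- Lower bound on the relative entropy of entanglement from a projection containing the support
of the state. -/
lemma IsDensityMatrix.neg_logb_le_relEntropyEntanglement (hρ : IsDensityMatrix ρ)
    {P : Matrix (Fin N → α) (Fin N → α) ℂ} (hP : P.IsHermitian) (hPP : P * P = P)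
    (hPρ : P * ρ = ρ) {q : ℝ} (hq : 0 < q)
    (h : ∀ v : Fin N → α → ℂ, (∀ j, IsUnitKet (v j)) →
      (star (prodKet v) ⬝ᵥ P.mulVec (prodKet v)).re ≤ q) :
    ((-Real.logb 2 q : ℝ) : EReal) ≤ relEntropyEntanglement ρ :=
  le_iInf₂ fun _ hσ => neg_logb_le_relativeEntropy hρ
    (isDensityMatrix_of_mem_separableStates hσ).1 hP hPP hPρ hq
    (trace_mul_re_le_of_mem_separableStates h hσ)

lemma IsDensityMatrix.relEntropyEntanglement_nonneg (hρ : IsDensityMatrix ρ) :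
    0 ≤ relEntropyEntanglement ρ := by
  have := hρ.neg_logb_le_relEntropyEntanglement (P := 1) (q := 1) Matrix.isHermitian_one
    (one_mul 1) (one_mul ρ) one_pos fun v hv => by
      rw [Matrix.one_mulVec, (isUnitKet_iff _).1 (IsUnitKet.prodKet hv), Complex.one_re]
  simpa using this

/-- Every admissible `t` bounds REE by `log (1 + t)`. One such `t` gives finiteness, the infimum
over all gives the comparison with LGR, and no minimizer has to exist. -/
lemma IsDensityMatrix.relEntropyEntanglement_eq_coe (hρ : IsDensityMatrix ρ) :
    relEntropyEntanglement ρ = ((relEntropyEntanglement ρ).toReal : EReal) ∧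
      (relEntropyEntanglement ρ).toReal ≤ logGlobalRobustness ρ := by
  have hle : ∀ t ∈ {t : ℝ | 0 ≤ t ∧ ∃ σ ∈ separableStates N α, ((1 + t) • σ - ρ).PosSemidef},
      relEntropyEntanglement ρ ≤ ((Real.logb 2 (1 + t) : ℝ) : EReal) := by
    rintro t ⟨ht, σ, hσ, h⟩
    exact iInf₂_le_of_le σ hσ (relativeEntropy_le_logb hρ
      (isDensityMatrix_of_mem_separableStates hσ).1 (by linarith) h)
  have hcoe : relEntropyEntanglement ρ = ((relEntropyEntanglement ρ).toReal : EReal) := by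
    refine (EReal.coe_toReal ?_ ?_).symm
    · obtain ⟨t, ht⟩ := hρ.exists_robustness
      exact ne_top_of_le_ne_top (EReal.coe_ne_top _) (hle t ht)
    · exact ne_bot_of_le_ne_bot (by simp) hρ.relEntropyEntanglement_nonneg
  refine ⟨hcoe, ?_⟩
  set x := (relEntropyEntanglement ρ).toReal
  rw [logGlobalRobustness, Real.le_logb_iff_rpow_le one_lt_two
    (by linarith [globalRobustness_nonneg ρ]), ← sub_le_iff_le_add', hρ.globalRobustness_eq]
  refine le_csInf hρ.exists_robustness fun t ht => ?_
  have := hle t ht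
  rw [hcoe, EReal.coe_le_coe_iff, Real.le_logb_iff_rpow_le one_lt_two (by linarith [ht.1])] at this
  linarith

lemma IsDensityMatrix.relEntropyEntanglement_le (hρ : IsDensityMatrix ρ) :
    relEntropyEntanglement ρ ≤ ((logGlobalRobustness ρ : ℝ) : EReal) := by
  rw [hρ.relEntropyEntanglement_eq_coe.1, EReal.coe_le_coe_iff]
  exact hρ.relEntropyEntanglement_eq_coe.2

lemma IsDensityMatrix.trace_mul_re_le_one (hρ : IsDensityMatrix ρ)
    {σ : Matrix (Fin N → α) (Fin N → α) ℂ} (hσ : σ ∈ separableStates N α) :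
    (ρ * σ).trace.re ≤ 1 := by
  have hσd := isDensityMatrix_of_mem_separableStates hσ
  have := trace_mul_re_nonneg hρ.one_sub_posSemidef hσd.1
  rw [sub_mul, one_mul, Matrix.trace_sub, hσd.2, Complex.sub_re, Complex.one_re] at this
  linarith

lemma IsDensityMatrix.le_maxOverlapSq (hρ : IsDensityMatrix ρ)
    {σ : Matrix (Fin N → α) (Fin N → α) ℂ} (hσ : σ ∈ separableStates N α) :
    (ρ * σ).trace.re ≤ maxOverlapSq ρ :=
  le_csSup ⟨1, by rintro _ ⟨σ, hσ, rfl⟩; exact hρ.trace_mul_re_le_one hσ⟩ ⟨σ, hσ, rfl⟩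

lemma IsDensityMatrix.maxOverlapSq_pos (hρ : IsDensityMatrix ρ) : 0 < maxOverlapSq ρ := by
  have := hρ.nonempty
  refine lt_of_lt_of_le ?_ (hρ.le_maxOverlapSq maximallyMixed_mem)
  rw [Matrix.mul_smul, mul_one, Matrix.trace_smul, hρ.2, Complex.smul_re, Complex.one_re,
    smul_eq_mul, mul_one, inv_pos]
  exact_mod_cast Fintype.card_pos

lemma IsDensityMatrix.maxOverlapSq_le (hρ : IsDensityMatrix ρ) {c : ℝ}
    (h : ∀ v : Fin N → α → ℂ, (∀ j, IsUnitKet (v j)) →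
      (star (prodKet v) ⬝ᵥ ρ.mulVec (prodKet v)).re ≤ c) : maxOverlapSq ρ ≤ c := by
  have := hρ.nonempty
  refine csSup_le (Set.Nonempty.image _ ⟨_, maximallyMixed_mem⟩) ?_
  rintro _ ⟨σ, hσ, rfl⟩
  exact trace_mul_re_le_of_mem_separableStates h hσ

lemma IsDensityMatrix.geometricMeasure_eq (hρ : IsDensityMatrix ρ) :
    geometricMeasure ρ = -Real.logb 2 (maxOverlapSq ρ) := by
  rw [geometricMeasure, Real.logb, Real.log_sqrt hρ.maxOverlapSq_pos.le, Real.logb]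
  ring

lemma IsDensityMatrix.geometricMeasure_nonneg (hρ : IsDensityMatrix ρ) :
    0 ≤ geometricMeasure ρ := by
  have := hρ.nonempty
  rw [hρ.geometricMeasure_eq, neg_nonneg]
  refine Real.logb_nonpos one_lt_two hρ.maxOverlapSq_pos.le ?_
  refine csSup_le (Set.Nonempty.image _ ⟨_, maximallyMixed_mem⟩) ?_
  rintro _ ⟨σ, hσ, rfl⟩
  exact hρ.trace_mul_re_le_one hσ

end Measures

/-! ### Subadditivity under tensor products -/

section Subadditivity

variable {N : ℕ} {α β γ : Type*} [Fintype α] [Fintype β] [Fintype γ]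
  [DecidableEq α] [DecidableEq β] [DecidableEq γ] (e : γ ≃ α × β)
  {ρ : Matrix (Fin N → α) (Fin N → α) ℂ} {ρ' : Matrix (Fin N → β) (Fin N → β) ℂ}

/-- Tensor products of separable states are separable, so products of overlaps compete in the joint
supremum. -/
lemma geometricMeasure_joinOp_le (hρ : IsDensityMatrix ρ) (hρ' : IsDensityMatrix ρ') :
    geometricMeasure (joinOp e ρ ρ') ≤ geometricMeasure ρ + geometricMeasure ρ' := by
  have := hρ.nonempty
  have := hρ'.nonempty
  have hj := hρ.joinOp e hρ'
  rw [hρ.geometricMeasure_eq, hρ'.geometricMeasure_eq, hj.geometricMeasure_eq, ← neg_add,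
    neg_le_neg_iff, ← Real.logb_mul hρ.maxOverlapSq_pos.ne' hρ'.maxOverlapSq_pos.ne']
  refine Real.logb_le_logb_of_le one_lt_two (mul_pos hρ.maxOverlapSq_pos hρ'.maxOverlapSq_pos) ?_
  have h1 : ∀ σ ∈ separableStates N α, ∀ σ' ∈ separableStates N β,
      (ρ * σ).trace.re * (ρ' * σ').trace.re ≤ maxOverlapSq (joinOp e ρ ρ') := by
    intro σ hσ σ' hσ'
    refine le_of_eq_of_le ?_ (hj.le_maxOverlapSq (joinOp_mem_separableStates e hσ hσ'))
    -- The real part of the product of traces splits because this trace, of a product of positive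
    -- operators, is real.
    have him : (ρ * σ).trace.im = 0 := by
      obtain ⟨f, s, -, h, -⟩ := (isDensityMatrix_of_mem_separableStates hσ).exists_eigenbasis
      rw [h, Matrix.mul_sum, Matrix.trace_sum, Complex.im_sum]
      refine Finset.sum_eq_zero fun i _ => ?_
      rw [Matrix.mul_smul, Matrix.trace_smul, trace_mul_ketBra, Complex.smul_im,
        ← (Complex.le_def.1 (hρ.1.dotProduct_mulVec_nonneg (f i))).2, Complex.zero_im, smul_zero]
    rw [joinOp_mul_joinOp, trace_joinOp, Complex.mul_re, him, zero_mul, sub_zero]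
  rw [← le_div_iff₀ hρ'.maxOverlapSq_pos]
  refine csSup_le (Set.Nonempty.image _ ⟨_, maximallyMixed_mem⟩) ?_
  rintro _ ⟨σ, hσ, rfl⟩
  rw [le_div_iff₀ hρ'.maxOverlapSq_pos]
  have h0 : 0 ≤ (ρ * σ).trace.re :=
    trace_mul_re_nonneg hρ.1 (isDensityMatrix_of_mem_separableStates hσ).1
  rcases h0.eq_or_lt with h0 | h0
  · change (ρ * σ).trace.re * _ ≤ _
    rw [← h0, zero_mul]
    exact hj.maxOverlapSq_pos.le
  · rw [mul_comm, ← le_div_iff₀ h0]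
    refine csSup_le (Set.Nonempty.image _ ⟨_, maximallyMixed_mem⟩) ?_
    rintro _ ⟨σ', hσ', rfl⟩
    rw [le_div_iff₀ h0, mul_comm]
    exact h1 σ hσ σ' hσ'

/-- The tensor product of separable states within `ε / 2` of the infima is a candidate for the joint
state. -/
lemma relEntropyEntanglement_joinOp_le (hρ : IsDensityMatrix ρ) (hρ' : IsDensityMatrix ρ') :
    relEntropyEntanglement (joinOp e ρ ρ') ≤
      relEntropyEntanglement ρ + relEntropyEntanglement ρ' := by
  rw [hρ.relEntropyEntanglement_eq_coe.1, hρ'.relEntropyEntanglement_eq_coe.1,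
    (hρ.joinOp e hρ').relEntropyEntanglement_eq_coe.1, ← EReal.coe_add, EReal.coe_le_coe_iff]
  refine le_of_forall_pos_le_add fun ε hε => ?_
  rw [← EReal.coe_le_coe_iff, ← (hρ.joinOp e hρ').relEntropyEntanglement_eq_coe.1]
  have h1 : relEntropyEntanglement ρ <
      (((relEntropyEntanglement ρ).toReal + ε / 2 : ℝ) : EReal) := by
    conv_lhs => rw [hρ.relEntropyEntanglement_eq_coe.1]
    rw [EReal.coe_lt_coe_iff]
    linarith
  have h2 : relEntropyEntanglement ρ' <
      (((relEntropyEntanglement ρ').toReal + ε / 2 : ℝ) : EReal) := by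
    conv_lhs => rw [hρ'.relEntropyEntanglement_eq_coe.1]
    rw [EReal.coe_lt_coe_iff]
    linarith
  conv_lhs at h1 => rw [relEntropyEntanglement]
  conv_lhs at h2 => rw [relEntropyEntanglement]
  simp only [iInf_lt_iff] at h1 h2
  obtain ⟨σ, hσ, h1⟩ := h1
  obtain ⟨σ', hσ', h2⟩ := h2
  refine (iInf₂_le_of_le _ (joinOp_mem_separableStates e hσ hσ') (relativeEntropy_joinOp_le e hρ
    (isDensityMatrix_of_mem_separableStates hσ) hρ'
    (isDensityMatrix_of_mem_separableStates hσ'))).trans ?_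
  refine (add_le_add h1.le h2.le).trans_eq ?_
  rw [← EReal.coe_add]
  congr 1
  ring

/-- Telescoping: `l l' σ ⊗ σ' - ρ ⊗ ρ' = (l σ - ρ) ⊗ l' σ' + ρ ⊗ (l' σ' - ρ')`. -/
lemma joinOp_sub_posSemidef {N : ℕ} {α β γ : Type*} [Fintype α] [Fintype β] (e : γ ≃ α × β)
    {ρ : Matrix (Fin N → α) (Fin N → α) ℂ} {ρ' : Matrix (Fin N → β) (Fin N → β) ℂ}
    {σ : Matrix (Fin N → α) (Fin N → α) ℂ}
    {σ' : Matrix (Fin N → β) (Fin N → β) ℂ} (hρ : ρ.PosSemidef)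
    (hσ' : σ'.PosSemidef) {l l' : ℝ} (hl' : 0 ≤ l') (h : (l • σ - ρ).PosSemidef)
    (h' : (l' • σ' - ρ').PosSemidef) :
    ((l * l') • joinOp e σ σ' - joinOp e ρ ρ').PosSemidef := by
  have : (l * l') • joinOp e σ σ' - joinOp e ρ ρ' =
      joinOp e (l • σ - ρ) (l' • σ') + joinOp e ρ (l' • σ' - ρ') := by
    ext x y
    simp only [joinOp_apply, Matrix.sub_apply, Matrix.smul_apply, Matrix.add_apply,
      Complex.real_smul]
    push_cast
    ring
  rw [this]
  exact (joinOp_posSemidef e h (hσ'.smul hl')).add (joinOp_posSemidef e hρ h')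

lemma logGlobalRobustness_joinOp_le (hρ : IsDensityMatrix ρ) (hρ' : IsDensityMatrix ρ') :
    logGlobalRobustness (joinOp e ρ ρ') ≤ logGlobalRobustness ρ + logGlobalRobustness ρ' := by
  have hj := hρ.joinOp e hρ'
  have g0 := globalRobustness_nonneg ρ
  have g0' := globalRobustness_nonneg ρ'
  have gj := globalRobustness_nonneg (joinOp e ρ ρ')
  rw [logGlobalRobustness, logGlobalRobustness, logGlobalRobustness,
    ← Real.logb_mul (by linarith) (by linarith)]
  refine Real.logb_le_logb_of_le one_lt_two (by linarith) ?_
  set R := 1 + globalRobustness (joinOp e ρ ρ')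
  have h1 : ∀ t ∈ {t : ℝ | 0 ≤ t ∧ ∃ σ ∈ separableStates N α, ((1 + t) • σ - ρ).PosSemidef},
      ∀ t' ∈ {t : ℝ | 0 ≤ t ∧ ∃ σ ∈ separableStates N β, ((1 + t) • σ - ρ').PosSemidef},
      R ≤ (1 + t) * (1 + t') := by
    rintro t ⟨ht, σ, hσ, h⟩ t' ⟨ht', σ', hσ', h'⟩
    exact hj.globalRobustness_le (by nlinarith) (joinOp_mem_separableStates e hσ hσ')
      (joinOp_sub_posSemidef e hρ.1 (isDensityMatrix_of_mem_separableStates hσ').1 (by linarith)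
        h h')
  have h2 : ∀ t ∈ {t : ℝ | 0 ≤ t ∧ ∃ σ ∈ separableStates N α, ((1 + t) • σ - ρ).PosSemidef},
      R ≤ (1 + t) * (1 + globalRobustness ρ') := by
    intro t ht
    have hp : 0 < 1 + t := by linarith [ht.1]
    have : R / (1 + t) - 1 ≤ globalRobustness ρ' := by
      rw [hρ'.globalRobustness_eq]
      refine le_csInf hρ'.exists_robustness fun t' ht' => ?_
      rw [sub_le_iff_le_add', div_le_iff₀ hp, mul_comm]
      exact h1 t ht t' ht'
    rwa [sub_le_iff_le_add', div_le_iff₀ hp, mul_comm] at this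
  have hp : 0 < 1 + globalRobustness ρ' := by linarith
  have : R / (1 + globalRobustness ρ') - 1 ≤ globalRobustness ρ := by
    rw [hρ.globalRobustness_eq]
    refine le_csInf hρ.exists_robustness fun t ht => ?_
    rw [sub_le_iff_le_add', div_le_iff₀ hp]
    exact h2 t ht
  rwa [sub_le_iff_le_add', div_le_iff₀ hp] at this

end Subadditivity

/-! ### From a strict drop at two copies to non-additivity -/

section Nonadditivity

variable {N : ℕ} {α : Type} [Fintype α] [DecidableEq α]
  {ρ : Matrix (Fin N → α) (Fin N → α) ℂ}

/-- Fekete's lemma: `u n / n` converges to a limit that is at most `u 2 / 2`, hence below `v`. -/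
lemma isNonadditive_of_subadditive
    {E : ∀ (α : Type) [Fintype α] [DecidableEq α], Matrix (Fin N → α) (Fin N → α) ℂ → EReal}
    (u : ℕ → ℝ) (hu : ∀ n, E (Fin n → α) (tensorPower ρ n) = (u n : EReal))
    (hsub : ∀ m n, u (m + n) ≤ u m + u n) (h0 : ∀ n, 0 ≤ u n) {v : ℝ}
    (hv : E α ρ = (v : EReal)) (h2 : u 2 < 2 * v) : IsNonadditive E ρ := by
  have hs : Subadditive u := hsub
  have hb : BddBelow (Set.range fun n : ℕ => u n / n) :=
    ⟨0, by rintro _ ⟨n, rfl⟩; exact div_nonneg (h0 n) (Nat.cast_nonneg n)⟩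
  refine ⟨hs.lim, ?_, ?_⟩
  · have h := (continuous_coe_real_ereal.tendsto hs.lim).comp (hs.tendsto_lim hb)
    refine h.congr fun n => ?_
    rw [hu, Function.comp_apply, EReal.coe_div]
    rfl
  · rw [hv, Ne, EReal.coe_eq_coe_iff]
    have := hs.lim_le_div hb two_ne_zero
    push_cast at this
    intro h
    linarith

lemma isNonadditive_geometricMeasure (hρ : IsDensityMatrix ρ)
    (h : geometricMeasure (tensorPower ρ 2) < 2 * geometricMeasure ρ) :
    IsNonadditive (fun _ _ _ τ => ((geometricMeasure τ : ℝ) : EReal)) ρ :=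
  isNonadditive_of_subadditive (fun n => geometricMeasure (tensorPower ρ n)) (fun _ => rfl)
    (fun m n => by
      rw [tensorPower_add]
      exact geometricMeasure_joinOp_le _ (hρ.tensorPower m) (hρ.tensorPower n))
    (fun n => (hρ.tensorPower n).geometricMeasure_nonneg) rfl h

lemma isNonadditive_logGlobalRobustness (hρ : IsDensityMatrix ρ)
    (h : logGlobalRobustness (tensorPower ρ 2) < 2 * logGlobalRobustness ρ) :
    IsNonadditive (fun _ _ _ τ => ((logGlobalRobustness τ : ℝ) : EReal)) ρ :=
  isNonadditive_of_subadditive (fun n => logGlobalRobustness (tensorPower ρ n)) (fun _ => rfl)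
    (fun m n => by
      rw [tensorPower_add]
      exact logGlobalRobustness_joinOp_le _ (hρ.tensorPower m) (hρ.tensorPower n))
    (fun n => logGlobalRobustness_nonneg _) rfl h

lemma isNonadditive_relEntropyEntanglement (hρ : IsDensityMatrix ρ)
    (h : relEntropyEntanglement (tensorPower ρ 2) < 2 * relEntropyEntanglement ρ) :
    IsNonadditive (fun _ _ _ τ => relEntropyEntanglement τ) ρ := by
  have hn := fun n => (hρ.tensorPower n).relEntropyEntanglement_eq_coe.1
  refine isNonadditive_of_subadditive
    (fun n => (relEntropyEntanglement (tensorPower ρ n)).toReal) hn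
    (fun m n => ?_) (fun n => ?_) hρ.relEntropyEntanglement_eq_coe.1 ?_
  · rw [← EReal.coe_le_coe_iff, EReal.coe_add, ← hn, ← hn, ← hn, tensorPower_add]
    exact relEntropyEntanglement_joinOp_le _ (hρ.tensorPower m) (hρ.tensorPower n)
  · rw [← EReal.coe_nonneg, ← hn]
    exact (hρ.tensorPower n).relEntropyEntanglement_nonneg
  · rw [← EReal.coe_lt_coe_iff, EReal.coe_mul, ← hn, ← hρ.relEntropyEntanglement_eq_coe.1]
    exact h

end Nonadditivity

/-! ### Slater determinants and the antisymmetric projection -/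

section Slater

variable {N : ℕ} {α : Type*}

lemma slaterKet_eq_sum (a : Fin N → EuclideanSpace ℂ α) :
    slaterKet a = ((Real.sqrt (N ! : ℝ) : ℝ) : ℂ)⁻¹ •
      ∑ π : Equiv.Perm (Fin N), sgn π • prodKet fun j => (a (π j)).ofLp := by
  funext x
  simp only [slaterKet, Pi.smul_apply, Finset.sum_apply, smul_eq_mul]
  rfl

lemma prodKet_comp_perm (v : Fin N → α → ℂ) (x : Fin N → α) (π : Equiv.Perm (Fin N)) :
    prodKet v (x ∘ π) = prodKet (v ∘ ⇑π⁻¹) x := by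
  simp only [prodKet, Function.comp_apply]
  rw [← Equiv.prod_comp π fun j => v (π⁻¹ j) (x j)]
  simp

lemma sum_sgn_mul_prodKet_comp (v : Fin N → α → ℂ) (x : Fin N → α) :
    ∑ π : Equiv.Perm (Fin N), sgn π * prodKet v (x ∘ π) =
      ∑ π : Equiv.Perm (Fin N), sgn π * prodKet (fun j => v (π j)) x := by
  rw [← Equiv.sum_comp (Equiv.inv _) fun π => sgn π * prodKet (fun j => v (π j)) x]
  refine Finset.sum_congr rfl fun π _ => ?_
  rw [prodKet_comp_perm, Equiv.inv_apply, sgn_inv]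
  rfl

lemma sqrt_factorial_ne_zero (N : ℕ) : ((Real.sqrt (N ! : ℝ) : ℝ) : ℂ) ≠ 0 := by
  have : (0 : ℝ) < N ! := by exact_mod_cast N.factorial_pos
  exact_mod_cast (Real.sqrt_pos.2 this).ne'

lemma sqrt_factorial_mul_self (N : ℕ) :
    ((Real.sqrt (N ! : ℝ) : ℝ) : ℂ) * ((Real.sqrt (N ! : ℝ) : ℝ) : ℂ) = (N ! : ℂ) := by
  rw [← Complex.ofReal_mul, Real.mul_self_sqrt (by positivity)]
  norm_cast

lemma antisymmetric_slaterKet (a : Fin N → EuclideanSpace ℂ α) : Antisymmetric (slaterKet a) := by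
  have h : slaterKet a = fun x => ((Real.sqrt (N ! : ℝ) : ℝ) : ℂ)⁻¹ *
      ∑ π : Equiv.Perm (Fin N), sgn π * prodKet (fun j => (a j).ofLp) (x ∘ π) := by
    funext x
    rw [sum_sgn_mul_prodKet_comp]
    rfl
  rw [h]
  exact (antisymmetric_sum_perm _).const_mul _

/-- The Slater determinant, evaluated at `x`, as an alternating map. -/
noncomputable def slaterAlternating (x : Fin N → α) :
    EuclideanSpace ℂ α [⋀^Fin N]→ₗ[ℂ] ℂ :=
  ((Real.sqrt (N ! : ℝ) : ℝ) : ℂ)⁻¹ • (Matrix.detRowAlternating (R := ℂ) (n := Fin N)).compLinearMap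
    (LinearMap.pi fun j => (LinearMap.proj (x j) : (α → ℂ) →ₗ[ℂ] ℂ) ∘ₗ
      (WithLp.linearEquiv 2 ℂ (α → ℂ)).toLinearMap)

lemma slaterAlternating_apply (x : Fin N → α) (a : Fin N → EuclideanSpace ℂ α) :
    slaterAlternating x a = slaterKet a x := by
  rw [slaterAlternating, AlternatingMap.smul_apply, AlternatingMap.compLinearMap_apply,
    smul_eq_mul, slaterKet]
  congr 1
  exact Matrix.det_apply' _

lemma slaterKet_comp_perm (a : Fin N → EuclideanSpace ℂ α) (π : Equiv.Perm (Fin N)) :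
    slaterKet (a ∘ π) = sgn π • slaterKet a := by
  funext x
  rw [Pi.smul_apply, ← slaterAlternating_apply, ← slaterAlternating_apply,
    AlternatingMap.map_perm, sgn, smul_eq_mul, Units.smul_def, zsmul_eq_mul]

lemma slaterKet_comp_eq_zero (a : Fin N → EuclideanSpace ℂ α) {f : Fin N → Fin N}
    (hf : ¬ Function.Bijective f) : slaterKet (a ∘ f) = 0 := by
  funext x
  rw [← slaterAlternating_apply]
  have hf' : ¬ Function.Injective f := fun h => hf (Finite.injective_iff_bijective.1 h)
  simp only [Function.Injective, not_forall] at hf'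
  obtain ⟨i, j, hij, hne⟩ := hf'
  exact AlternatingMap.map_eq_zero_of_eq _ _ (by simp [hij]) hne

variable [Fintype α]

lemma star_prodKet_dotProduct (v w : Fin N → α → ℂ) :
    star (prodKet v) ⬝ᵥ prodKet w = ∏ j, star (v j) ⬝ᵥ w j := by
  have h := Finset.prod_univ_sum (fun _ : Fin N => (Finset.univ : Finset α))
    fun j x => star (v j x) * w j x
  rw [Fintype.piFinset_univ] at h
  simp only [dotProduct, Pi.star_apply, prodKet]
  rw [h]
  exact Finset.sum_congr rfl fun x _ => by rw [star_prod, Finset.prod_mul_distrib]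

lemma orthonormal_star_dotProduct {κ : Type*} [DecidableEq κ] {a : κ → EuclideanSpace ℂ α}
    (ha : Orthonormal ℂ a) (i j : κ) :
    star (a i).ofLp ⬝ᵥ (a j).ofLp = if i = j then 1 else 0 := by
  rw [dotProduct_comm, ← EuclideanSpace.inner_eq_star_dotProduct]
  exact orthonormal_iff_ite.1 ha i j

lemma isUnitKet_iff_norm (v : EuclideanSpace ℂ α) : IsUnitKet v.ofLp ↔ ‖v‖ = 1 := by
  rw [IsUnitKet, ← EuclideanSpace.norm_sq_eq, pow_eq_one_iff_of_nonneg (norm_nonneg v) two_ne_zero]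

lemma isUnitKet_slaterKet {a : Fin N → EuclideanSpace ℂ α} (ha : Orthonormal ℂ a) :
    IsUnitKet (slaterKet a) := by
  rw [isUnitKet_iff, slaterKet_eq_sum]
  simp only [star_smul, star_sum, smul_dotProduct, dotProduct_smul, dotProduct_sum,
    sum_dotProduct, star_prodKet_dotProduct, orthonormal_star_dotProduct ha, star_sgn]
  have h1 : ∀ π π' : Equiv.Perm (Fin N),
      (∏ j, if π j = π' j then (1 : ℂ) else 0) = if π = π' then 1 else 0 := by
    intro π π'
    rw [Finset.prod_ite_zero]
    simp [Equiv.ext_iff]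
  have hs : star ((Real.sqrt (N ! : ℝ) : ℝ) : ℂ)⁻¹ = ((Real.sqrt (N ! : ℝ) : ℝ) : ℂ)⁻¹ := by
    rw [star_inv₀, Complex.star_def, Complex.conj_ofReal]
  have h2 : ∀ π : Equiv.Perm (Fin N), sgn π * (star ((Real.sqrt (N ! : ℝ) : ℝ) : ℂ)⁻¹ * sgn π) =
      ((Real.sqrt (N ! : ℝ) : ℝ) : ℂ)⁻¹ := fun π => by
    rw [hs, mul_left_comm, sgn_mul_self, mul_one]
  simp only [h1, smul_eq_mul, mul_ite, mul_one, mul_zero, Finset.sum_ite_eq', Finset.mem_univ,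
    if_true, h2, Finset.sum_const, Finset.card_univ, Fintype.card_perm, Fintype.card_fin,
    nsmul_eq_mul]
  rw [← sqrt_factorial_mul_self]
  have := sqrt_factorial_ne_zero N
  field_simp

/-- On the span of independent vectors an alternating form of top degree is a multiple of the
determinant, and in the Gram–Schmidt basis `b` that determinant is `∏ ⟨b j, v j⟩`. Each factor is at
most `‖v j‖`, which is Hadamard's inequality. -/
lemma slaterKet_eq_smul (v : Fin N → EuclideanSpace ℂ α) :
    slaterKet v = 0 ∨ ∃ (b : Fin N → EuclideanSpace ℂ α) (c : ℂ), Orthonormal ℂ b ∧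
      ‖c‖ ≤ ∏ j, ‖v j‖ ∧ slaterKet v = c • slaterKet b := by
  by_cases hv : LinearIndependent ℂ v
  · right
    set W := Submodule.span ℂ (Set.range v)
    have hW : Module.finrank ℂ W = Fintype.card (Fin N) := finrank_span_eq_card hv
    set w : Fin N → W := fun j => ⟨v j, Submodule.subset_span ⟨j, rfl⟩⟩
    set b := InnerProductSpace.gramSchmidtOrthonormalBasis (𝕜 := ℂ) (E := W) hW w
    refine ⟨fun j => (b j : EuclideanSpace ℂ α), ∏ j, inner ℂ (b j) (w j), ?_, ?_, ?_⟩
    · exact b.orthonormal.comp_linearIsometry W.subtypeₗᵢ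
    · rw [norm_prod]
      refine Finset.prod_le_prod (fun _ _ => norm_nonneg _) fun j _ => ?_
      refine (norm_inner_le_norm (𝕜 := ℂ) (b j) (w j)).trans_eq ?_
      rw [b.orthonormal.1 j, one_mul]
      rfl
    · funext x
      have h := AlternatingMap.eq_smul_basis_det b.toBasis
        ((slaterAlternating x).compLinearMap W.subtype)
      have h2 := congrArg (fun F => F w) h
      simp only [AlternatingMap.smul_apply, AlternatingMap.compLinearMap_apply] at h2
      rw [InnerProductSpace.gramSchmidtOrthonormalBasis_det] at h2
      rw [Pi.smul_apply, ← slaterAlternating_apply, ← slaterAlternating_apply, smul_eq_mul,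
        mul_comm, ← smul_eq_mul]
      convert h2 using 1
      congr 1
      congr 1
  · left
    funext x
    rw [← slaterAlternating_apply]
    exact AlternatingMap.map_linearDependent _ _ hv

variable [DecidableEq α]

/-- The projection onto the totally antisymmetric subspace. -/
noncomputable def antisymProj (N : ℕ) (α : Type*) [DecidableEq α] :
    Matrix (Fin N → α) (Fin N → α) ℂ :=
  Matrix.of fun x y => (N ! : ℂ)⁻¹ * ∑ π : Equiv.Perm (Fin N), if x ∘ π = y then sgn π else 0

lemma antisymProj_mulVec (ψ : (Fin N → α) → ℂ) (x : Fin N → α) :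
    (antisymProj N α).mulVec ψ x =
      (N ! : ℂ)⁻¹ * ∑ π : Equiv.Perm (Fin N), sgn π * ψ (x ∘ π) := by
  simp only [Matrix.mulVec, dotProduct, antisymProj, Matrix.of_apply, mul_assoc, Finset.sum_mul,
    ← Finset.mul_sum]
  rw [Finset.sum_comm]
  congr 1
  refine Finset.sum_congr rfl fun π _ => ?_
  simp

lemma isHermitian_antisymProj {N : ℕ} {α : Type*} [DecidableEq α] :
    (antisymProj N α).IsHermitian := by
  ext x y
  rw [Matrix.conjTranspose_apply, antisymProj, Matrix.of_apply, Matrix.of_apply, star_mul',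
    star_sum]
  congr 1
  · simp
  · rw [← Equiv.sum_comp (Equiv.inv _)]
    refine Finset.sum_congr rfl fun π _ => ?_
    have h : y ∘ ⇑π⁻¹ = x ↔ x ∘ π = y := by
      constructor
      · rintro rfl; funext j; simp
      · rintro rfl; funext j; simp
    rw [Equiv.inv_apply, sgn_inv]
    simp only [h]
    split_ifs <;> simp

lemma Antisymmetric.antisymProj_mulVec {ψ : (Fin N → α) → ℂ} (hψ : Antisymmetric ψ) :
    (antisymProj N α).mulVec ψ = ψ := by
  funext x
  rw [MultipartiteEntanglement.antisymProj_mulVec]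
  have : (N ! : ℂ) ≠ 0 := by exact_mod_cast N.factorial_ne_zero
  simp only [hψ _ x, ← mul_assoc, sgn_mul_self, one_mul, Finset.sum_const, Finset.card_univ,
    Fintype.card_perm, Fintype.card_fin, nsmul_eq_mul]
  field_simp

lemma antisymProj_mul_self : antisymProj N α * antisymProj N α = antisymProj N α := by
  refine Matrix.toLin'.injective (LinearMap.ext fun ψ => ?_)
  rw [Matrix.toLin'_apply, Matrix.toLin'_apply, ← Matrix.mulVec_mulVec]
  refine Antisymmetric.antisymProj_mulVec ?_
  have : (antisymProj N α).mulVec ψ = fun x => (N ! : ℂ)⁻¹ *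
      ∑ π : Equiv.Perm (Fin N), sgn π * ψ (x ∘ π) := funext fun x => antisymProj_mulVec ψ x
  rw [this]
  exact (antisymmetric_sum_perm ψ).const_mul _

lemma antisymProj_mulVec_prodKet (v : Fin N → EuclideanSpace ℂ α) :
    (antisymProj N α).mulVec (prodKet fun j => (v j).ofLp) =
      ((Real.sqrt (N ! : ℝ) : ℝ) : ℂ)⁻¹ • slaterKet v := by
  funext x
  rw [antisymProj_mulVec, sum_sgn_mul_prodKet_comp, Pi.smul_apply, smul_eq_mul,
    ← sqrt_factorial_mul_self, mul_inv, mul_assoc]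
  rfl

lemma star_dotProduct_mulVec_eq_of_isHermitian {n : Type*} [Fintype n] {P : Matrix n n ℂ}
    (hP : P.IsHermitian) (v w : n → ℂ) : star v ⬝ᵥ P.mulVec w = star (P.mulVec v) ⬝ᵥ w := by
  rw [Matrix.star_mulVec, hP.eq, Matrix.dotProduct_mulVec]

lemma star_dotProduct_mulVec_proj {n : Type*} [Fintype n] {P : Matrix n n ℂ}
    (hP : P.IsHermitian) (hPP : P * P = P) (v : n → ℂ) :
    star v ⬝ᵥ P.mulVec v = ((∑ x, ‖P.mulVec v x‖ ^ 2 : ℝ) : ℂ) := by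
  rw [← star_dotProduct_self, ← star_dotProduct_mulVec_eq_of_isHermitian hP,
    Matrix.mulVec_mulVec, hPP]

lemma sum_norm_sq_smul {n : Type*} [Fintype n] (c : ℂ) (ψ : n → ℂ) :
    ∑ x, ‖(c • ψ) x‖ ^ 2 = ‖c‖ ^ 2 * ∑ x, ‖ψ x‖ ^ 2 := by
  rw [Finset.mul_sum]
  exact Finset.sum_congr rfl fun x _ => by
    rw [Pi.smul_apply, smul_eq_mul, norm_mul, mul_pow]

lemma norm_inv_sqrt_factorial_sq (N : ℕ) :
    ‖((Real.sqrt (N ! : ℝ) : ℝ) : ℂ)⁻¹‖ ^ 2 = (N ! : ℝ)⁻¹ := by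
  rw [norm_inv, Complex.norm_real, inv_pow, Real.norm_eq_abs, sq_abs,
    Real.sq_sqrt (by positivity)]

lemma sum_norm_sq_slaterKet_le {α : Type*} [Fintype α] (v : Fin N → EuclideanSpace ℂ α)
    (hv : ∀ j, ‖v j‖ = 1) :
    ∑ x, ‖slaterKet v x‖ ^ 2 ≤ 1 := by
  rcases slaterKet_eq_smul v with h | ⟨b, c, hb, hc, h⟩
  · simp [h]
  · rw [h, sum_norm_sq_smul, isUnitKet_slaterKet hb, mul_one]
    simp only [hv, Finset.prod_const_one] at hc
    exact pow_le_one₀ (norm_nonneg _) hc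

/-- The overlap is the squared norm of the projected vector, a Slater vector over `√N!`, and
Hadamard's inequality bounds the Slater vector by one. -/
lemma antisymProj_overlap_le (v : Fin N → α → ℂ) (hv : ∀ j, IsUnitKet (v j)) :
    (star (prodKet v) ⬝ᵥ (antisymProj N α).mulVec (prodKet v)).re ≤ (N ! : ℝ)⁻¹ := by
  rw [star_dotProduct_mulVec_proj isHermitian_antisymProj antisymProj_mul_self, Complex.ofReal_re]
  have h := antisymProj_mulVec_prodKet fun j => WithLp.toLp 2 (v j)
  change (antisymProj N α).mulVec (prodKet v) = _ at h
  rw [h, sum_norm_sq_smul, norm_inv_sqrt_factorial_sq]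
  refine mul_le_of_le_one_right (by positivity) (sum_norm_sq_slaterKet_le _ fun j => ?_)
  rw [← isUnitKet_iff_norm]
  exact hv j

end Slater

/-! ### Overlap of two antisymmetric projections with product vectors -/

section TwoCopies

variable {N : ℕ} {α γ : Type*} [Fintype α] [Fintype γ] [DecidableEq α] (e : γ ≃ α × α)

lemma isHermitian_joinOp {N : ℕ} {α β γ : Type*} (e : γ ≃ α × β)
    {A : Matrix (Fin N → α) (Fin N → α) ℂ} {B : Matrix (Fin N → β) (Fin N → β) ℂ}
    (hA : A.IsHermitian) (hB : B.IsHermitian) : (joinOp e A B).IsHermitian := by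
  ext x y
  rw [Matrix.conjTranspose_apply, joinOp_apply, joinOp_apply, star_mul', hA.apply, hB.apply]

/-- Read across the copies each local vector is a matrix; one projection permutes the row indices,
the other the column indices. -/
lemma joinOp_antisymProj_mulVec_prodKet (v : Fin N → γ → ℂ) (x : Fin N → γ) :
    (joinOp e (antisymProj N α) (antisymProj N α)).mulVec (prodKet v) x =
      ((N ! : ℂ)⁻¹) ^ 2 * biAlt (fun j a b => v j (e.symm (a, b))) (splitEquiv N e x).1
        (splitEquiv N e x).2 := by
  set F : (Fin N → α) → (Fin N → α) → ℂ := fun y y' =>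
    ∏ j, v j (e.symm (y j, y' j)) with hF
  have h1 : ∀ y, prodKet v y = F (splitEquiv N e y).1 (splitEquiv N e y).2 := by
    intro y
    simp only [prodKet, hF]
    refine Finset.prod_congr rfl fun j _ => ?_
    congr 1
    exact (e.symm_apply_apply (y j)).symm
  simp only [Matrix.mulVec, dotProduct, joinOp_apply, h1]
  rw [sum_splitEquiv e fun y y' => antisymProj N α (splitEquiv N e x).1 y *
    antisymProj N α (splitEquiv N e x).2 y' * F y y']
  have h2 : ∀ y, ∑ y', antisymProj N α (splitEquiv N e x).1 y *
      antisymProj N α (splitEquiv N e x).2 y' * F y y' =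
      antisymProj N α (splitEquiv N e x).1 y * ((N ! : ℂ)⁻¹ *
        ∑ π : Equiv.Perm (Fin N), sgn π * F y ((splitEquiv N e x).2 ∘ π)) := by
    intro y
    rw [← antisymProj_mulVec (F y), Matrix.mulVec, dotProduct, Finset.mul_sum]
    exact Finset.sum_congr rfl fun _ _ => by ring
  simp only [h2]
  have h3 := antisymProj_mulVec (fun y => (N ! : ℂ)⁻¹ *
        ∑ π : Equiv.Perm (Fin N), sgn π * F y ((splitEquiv N e x).2 ∘ π)) (splitEquiv N e x).1
  rw [Matrix.mulVec, dotProduct] at h3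
  rw [h3]
  simp only [biAlt, hF, Finset.mul_sum]
  refine Finset.sum_congr rfl fun _ _ => Finset.sum_congr rfl fun _ _ => ?_
  simp only [Function.comp_apply]
  ring

/-- The bound on `biAlt` carries `(N!)³`, and the squared normalization of the two projections
contributes `(N!)⁻⁴`. -/
lemma joinOp_antisymProj_overlap_le (hN : N ≤ Fintype.card α) (v : Fin N → γ → ℂ)
    (hv : ∀ j, IsUnitKet (v j)) :
    (star (prodKet v) ⬝ᵥ
      (joinOp e (antisymProj N α) (antisymProj N α)).mulVec (prodKet v)).re ≤
      ((Fintype.card α).descFactorial N : ℝ) / ((N ! : ℝ) * (Fintype.card α : ℝ) ^ N) := by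
  have hPP : joinOp e (antisymProj N α) (antisymProj N α) *
      joinOp e (antisymProj N α) (antisymProj N α) =
      joinOp e (antisymProj N α) (antisymProj N α) := by
    rw [joinOp_mul_joinOp, antisymProj_mul_self]
  rw [star_dotProduct_mulVec_proj (isHermitian_joinOp e isHermitian_antisymProj
    isHermitian_antisymProj) hPP, Complex.ofReal_re]
  set A : Fin N → α → α → ℂ := fun j a b => v j (e.symm (a, b)) with hA
  have hA1 : ∀ j, biNormSq (A j) = 1 := by
    intro j
    have h := hv j
    rw [IsUnitKet, ← e.symm.sum_comp, Fintype.sum_prod_type] at h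
    exact h
  have key := card_pow_mul_biNormSq_biAlt_le hN A hA1
  have h1 : ∑ x, ‖(joinOp e (antisymProj N α) (antisymProj N α)).mulVec (prodKet v) x‖ ^ 2 =
      ((N ! : ℝ)⁻¹) ^ 4 * biNormSq (biAlt A) := by
    simp only [joinOp_antisymProj_mulVec_prodKet, norm_mul, mul_pow]
    rw [← Finset.mul_sum, sum_splitEquiv e fun y y' => ‖biAlt A y y'‖ ^ 2]
    congr 1
    rw [norm_pow, norm_inv, Complex.norm_natCast]
    ring
  rw [h1]
  have hf : (0 : ℝ) < N ! := by exact_mod_cast N.factorial_pos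
  have hd : (0 : ℝ) < (Fintype.card α : ℝ) ^ N := by
    rcases Nat.eq_zero_or_pos N with rfl | h
    · simp
    · have : 0 < Fintype.card α := by omega
      positivity
  rw [le_div_iff₀ (by positivity)]
  calc ((N ! : ℝ)⁻¹) ^ 4 * biNormSq (biAlt A) * ((N ! : ℝ) * (Fintype.card α : ℝ) ^ N)
      = ((N ! : ℝ)⁻¹) ^ 3 * ((Fintype.card α : ℝ) ^ N * biNormSq (biAlt A)) := by
        field_simp
    _ ≤ ((N ! : ℝ)⁻¹) ^ 3 * ((N ! : ℝ) ^ 3 * (Fintype.card α).descFactorial N) := by gcongr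
    _ = _ := by field_simp

end TwoCopies

/-! ### Separable states dominating one and two Slater states -/

section UpperBounds

/-- A vector that is an average of product vectors with coefficients of modulus `√l` is dominated
by `l` times a separable state. -/
lemma exists_separable_of_average {N : ℕ} {α K : Type*} [Fintype α] [Fintype K] [Nonempty K]
    {ψ : (Fin N → α) → ℂ} (c : K → ℂ) (v : K → Fin N → α → ℂ) {l : ℝ}
    (hc : ∀ k, ‖c k‖ ^ 2 = l) (hv : ∀ k j, IsUnitKet (v k j))
    (hψ : ψ = (Fintype.card K : ℂ)⁻¹ • ∑ k, c k • prodKet (v k)) :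
    ∃ σ ∈ separableStates N α, (l • σ - ketBra ψ).PosSemidef := by
  set D : ℝ := (Fintype.card K : ℝ) with hD
  have hD0 : 0 < D := by rw [hD]; exact_mod_cast Fintype.card_pos
  have hl : 0 ≤ l := by rw [← hc (Classical.arbitrary K)]; positivity
  refine ⟨∑ k, D⁻¹ • ketBra (prodKet (v k)), convex_separableStates.sum_mem
    (fun _ _ => by positivity) ?_ fun k _ => ketBra_prodKet_mem (hv k), ?_⟩
  · rw [Finset.sum_const, Finset.card_univ, nsmul_eq_mul]
    exact mul_inv_cancel₀ hD0.ne'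
  have hh : (l • ∑ k, D⁻¹ • ketBra (prodKet (v k)) - ketBra ψ).IsHermitian :=
    ((Matrix.posSemidef_sum _ fun k _ =>
      (posSemidef_ketBra (prodKet (v k))).smul (inv_pos.2 hD0).le).smul hl).isHermitian.sub
      (posSemidef_ketBra ψ).isHermitian
  refine Matrix.PosSemidef.of_dotProduct_mulVec_nonneg hh fun w => ?_
  have h1 : star w ⬝ᵥ (ketBra ψ).mulVec w = ((‖star ψ ⬝ᵥ w‖ ^ 2 : ℝ) : ℂ) := by
    have := star_dotProduct_sum_smul_ketBra_mulVec (fun _ : Unit => ψ) (fun _ => 1) w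
    simpa using this
  rw [Matrix.sub_mulVec, dotProduct_sub, Matrix.smul_mulVec, dotProduct_smul,
    star_dotProduct_sum_smul_ketBra_mulVec, h1, Complex.real_smul, ← Complex.ofReal_mul,
    ← Complex.ofReal_sub, Complex.zero_le_real, sub_nonneg]
  have h2 : ‖star ψ ⬝ᵥ w‖ ≤ D⁻¹ * ∑ k, ‖c k‖ * ‖star (prodKet (v k)) ⬝ᵥ w‖ := by
    rw [hψ, star_smul, star_sum, smul_dotProduct, sum_dotProduct, norm_smul]
    have : ‖star (Fintype.card K : ℂ)⁻¹‖ = D⁻¹ := by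
      rw [norm_star, norm_inv, Complex.norm_natCast]
    rw [this]
    gcongr
    refine (norm_sum_le _ _).trans_eq (Finset.sum_congr rfl fun k _ => ?_)
    rw [star_smul, smul_dotProduct, norm_smul, norm_star]
  -- Cauchy–Schwarz on the average; since all coefficients have the same modulus, what remains is
  -- the quadratic form of the uniform mixture.
  have h3 := sq_sum_le_card_mul_sum_sq (s := (Finset.univ : Finset K))
    (f := fun k => ‖c k‖ * ‖star (prodKet (v k)) ⬝ᵥ w‖)
  simp only [mul_pow, hc, Finset.card_univ, ← Finset.mul_sum] at h3
  calc ‖star ψ ⬝ᵥ w‖ ^ 2 ≤ (D⁻¹ * ∑ k, ‖c k‖ * ‖star (prodKet (v k)) ⬝ᵥ w‖) ^ 2 := by gcongr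
    _ = D⁻¹ ^ 2 * (∑ k, ‖c k‖ * ‖star (prodKet (v k)) ⬝ᵥ w‖) ^ 2 := by ring
    _ ≤ D⁻¹ ^ 2 * (D * (l * ∑ k, ‖star (prodKet (v k)) ⬝ᵥ w‖ ^ 2)) := by gcongr
    _ = l * ∑ k, D⁻¹ * ‖star (prodKet (v k)) ⬝ᵥ w‖ ^ 2 := by
      rw [← Finset.mul_sum]
      field_simp

lemma exists_separable_of_mixture {N : ℕ} {α ι : Type*} [Fintype α] [Fintype ι] {p : ι → ℝ}
    (hp : ∀ i, 0 ≤ p i) (hp1 : ∑ i, p i = 1) {ψ : ι → (Fin N → α) → ℂ} {l : ℝ}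
    (h : ∀ i, ∃ σ ∈ separableStates N α, (l • σ - ketBra (ψ i)).PosSemidef) :
    ∃ σ ∈ separableStates N α, (l • σ - ∑ i, p i • ketBra (ψ i)).PosSemidef := by
  choose σ hσ hpsd using h
  refine ⟨∑ i, p i • σ i, convex_separableStates.sum_mem (fun i _ => hp i) hp1 fun i _ => hσ i, ?_⟩
  have : l • ∑ i, p i • σ i - ∑ i, p i • ketBra (ψ i) =
      ∑ i, p i • (l • σ i - ketBra (ψ i)) := by
    rw [Finset.smul_sum, ← Finset.sum_sub_distrib]
    exact Finset.sum_congr rfl fun i _ => by rw [smul_sub, smul_comm]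
  rw [this]
  exact Matrix.posSemidef_sum _ fun i _ => (hpsd i).smul (hp i)

lemma isDensityMatrix_mixture {n ι : Type*} [Fintype n] [Fintype ι] {p : ι → ℝ}
    (hp : ∀ i, 0 ≤ p i) (hp1 : ∑ i, p i = 1) {ψ : ι → n → ℂ} (h : ∀ i, IsUnitKet (ψ i)) :
    IsDensityMatrix (∑ i, p i • ketBra (ψ i)) :=
  convex_isDensityMatrix.sum_mem (fun i _ => hp i) hp1 fun i _ => isDensityMatrix_ketBra (h i)

variable {N : ℕ} {α γ : Type*} [Fintype α] [Fintype γ] (e : γ ≃ α × α)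

/-- Since `1/√N! = √N! / N!`, the Slater vector is an average over permutations with coefficients
`±√N!`. -/
lemma exists_separable_slaterKet {a : Fin N → EuclideanSpace ℂ α} (ha : Orthonormal ℂ a) :
    ∃ σ ∈ separableStates N α, ((N ! : ℝ) • σ - ketBra (slaterKet a)).PosSemidef := by
  refine exists_separable_of_average
    (fun π : Equiv.Perm (Fin N) => ((Real.sqrt (N ! : ℝ) : ℝ) : ℂ) * sgn π)
    (fun π j => (a (π j)).ofLp) (fun π => ?_)
    (fun π j => (isUnitKet_iff_norm _).2 (ha.1 _)) ?_
  · rw [norm_mul, norm_sgn, mul_one, Complex.norm_real, Real.norm_eq_abs, sq_abs,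
      Real.sq_sqrt (by positivity)]
  · rw [slaterKet_eq_sum, Fintype.card_perm, Fintype.card_fin, ← sqrt_factorial_mul_self]
    simp only [mul_smul, ← Finset.smul_sum]
    rw [smul_smul]
    congr 1
    have := sqrt_factorial_ne_zero N
    field_simp

/-- The normalized maximally entangled vector of two orthonormal families, with signs `w`. -/
noncomputable def pairKet (a b : Fin N → EuclideanSpace ℂ α) (w : Fin N → ℤˣ) (c : γ) : ℂ :=
  ((Real.sqrt (N : ℝ) : ℝ) : ℂ)⁻¹ *
    ∑ m, ((w m : ℤ) : ℂ) * (a m (e c).1 * b m (e c).2)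

lemma isUnitKet_pairKet (hN : 0 < N) {a b : Fin N → EuclideanSpace ℂ α} (ha : Orthonormal ℂ a)
    (hb : Orthonormal ℂ b) (w : Fin N → ℤˣ) : IsUnitKet (pairKet e a b w) := by
  have hN' : (0 : ℝ) < N := by exact_mod_cast hN
  have h0 : pairKet e a b w = ((Real.sqrt (N : ℝ) : ℝ) : ℂ)⁻¹ •
      ∑ m, ((w m : ℤ) : ℂ) • fun c => (a m).ofLp (e c).1 * (b m).ofLp (e c).2 := by
    funext c
    simp [pairKet]
  have h1 : ∀ m m', star (fun c => (a m).ofLp (e c).1 * (b m).ofLp (e c).2) ⬝ᵥ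
      (fun c => (a m').ofLp (e c).1 * (b m').ofLp (e c).2) = if m = m' then 1 else 0 := by
    intro m m'
    have : star (fun c => (a m).ofLp (e c).1 * (b m).ofLp (e c).2) ⬝ᵥ
      (fun c => (a m').ofLp (e c).1 * (b m').ofLp (e c).2) =
      (star (a m).ofLp ⬝ᵥ (a m').ofLp) * (star (b m).ofLp ⬝ᵥ (b m').ofLp) := by
      simp only [dotProduct, Pi.star_apply]
      rw [e.sum_comp fun q => star ((a m).ofLp q.1 * (b m).ofLp q.2) *
        ((a m').ofLp q.1 * (b m').ofLp q.2), Fintype.sum_prod_type, Finset.sum_mul_sum]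
      refine Finset.sum_congr rfl fun _ _ => Finset.sum_congr rfl fun _ _ => ?_
      rw [star_mul']
      ring
    rw [this, orthonormal_star_dotProduct ha, orthonormal_star_dotProduct hb]
    split_ifs <;> simp
  rw [isUnitKet_iff, h0]
  simp only [star_smul, star_sum, smul_dotProduct, dotProduct_smul, dotProduct_sum,
    sum_dotProduct, h1]
  have hs : star ((Real.sqrt (N : ℝ) : ℝ) : ℂ)⁻¹ = ((Real.sqrt (N : ℝ) : ℝ) : ℂ)⁻¹ := by
    rw [star_inv₀, Complex.star_def, Complex.conj_ofReal]
  have hw : ∀ m, star ((w m : ℤ) : ℂ) * ((w m : ℤ) : ℂ) = 1 := by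
    intro m
    rcases Int.units_eq_one_or (w m) with h | h <;> simp [h]
  simp only [smul_eq_mul, mul_ite, mul_one, mul_zero, Finset.sum_ite_eq', Finset.mem_univ, if_true,
    hs]
  have h2 : ∀ m, ((w m : ℤ) : ℂ) * (((Real.sqrt (N : ℝ) : ℝ) : ℂ)⁻¹ * star ((w m : ℤ) : ℂ)) =
      ((Real.sqrt (N : ℝ) : ℝ) : ℂ)⁻¹ := fun m => by
    rw [mul_left_comm, mul_comm _ (star _), hw, mul_one]
  have h3 : (((Real.sqrt (N : ℝ) : ℝ) : ℂ)) * ((Real.sqrt (N : ℝ) : ℝ) : ℂ) = (N : ℂ) := by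
    rw [← Complex.ofReal_mul, Real.mul_self_sqrt hN'.le]
    norm_cast
  have h4 : ((Real.sqrt (N : ℝ) : ℝ) : ℂ) ≠ 0 := by
    exact_mod_cast (Real.sqrt_pos.2 hN').ne'
  simp only [h2]
  simp
  field_simp
  rw [sq, h3]

lemma prodKet_pairKet {N : ℕ} {α γ : Type*} (e : γ ≃ α × α) (a b : Fin N → EuclideanSpace ℂ α)
    (w : Fin N → ℤˣ) :
    prodKet (fun _ => pairKet e a b w) =
      (((Real.sqrt (N : ℝ) : ℝ) : ℂ)⁻¹ ^ N) • ∑ f : Fin N → Fin N,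
        (∏ j, ((w (f j) : ℤ) : ℂ)) • joinKet e (prodKet fun j => (a (f j)).ofLp)
          (prodKet fun j => (b (f j)).ofLp) := by
  funext x
  have h := Finset.prod_univ_sum (fun _ : Fin N => (Finset.univ : Finset (Fin N)))
    fun j m => ((w m : ℤ) : ℂ) * (a m (e (x j)).1 * b m (e (x j)).2)
  rw [Fintype.piFinset_univ] at h
  simp only [prodKet, pairKet, Finset.prod_mul_distrib, Pi.smul_apply, Finset.sum_apply,
    smul_eq_mul, joinKet] at h ⊢
  rw [h, Finset.prod_const, Finset.card_univ, Fintype.card_fin]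
  rfl

/-- If `f` misses `j₀`, flipping the sign at `j₀` reverses the summand; if `f` is bijective, the two
products coincide and multiply to one. -/
lemma sum_sign_prod (f : Fin N → Fin N) :
    ∑ w : Fin N → ℤˣ, (∏ j, ((w j : ℤ) : ℂ)) * ∏ j, ((w (f j) : ℤ) : ℂ) =
      if Function.Bijective f then (Fintype.card (Fin N → ℤˣ) : ℂ) else 0 := by
  split_ifs with hf
  · have : ∀ w : Fin N → ℤˣ, (∏ j, ((w j : ℤ) : ℂ)) * ∏ j, ((w (f j) : ℤ) : ℂ) = 1 := by
      intro w
      rw [hf.prod_comp fun j => ((w j : ℤ) : ℂ), ← Finset.prod_mul_distrib]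
      refine Finset.prod_eq_one fun j _ => ?_
      rcases Int.units_eq_one_or (w j) with h | h <;> simp [h]
    simp only [this, Finset.sum_const, Finset.card_univ, nsmul_eq_mul, mul_one]
  · have hs : ¬ Function.Surjective f := fun h => hf (Finite.surjective_iff_bijective.1 h)
    simp only [Function.Surjective, not_forall, not_exists] at hs
    obtain ⟨j₀, hj⟩ := hs
    set F : (Fin N → ℤˣ) → ℂ := fun w => (∏ j, ((w j : ℤ) : ℂ)) * ∏ j, ((w (f j) : ℤ) : ℂ)
    have h1 : ∀ w, F (w * Pi.mulSingle j₀ (-1)) = -F w := by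
      intro w
      have e1 : ∀ j, (w * Pi.mulSingle j₀ (-1) : Fin N → ℤˣ) (f j) = w (f j) := fun j => by
        simp [Pi.mulSingle_eq_of_ne (hj j)]
      have e2 : ∏ j, (((w * Pi.mulSingle j₀ (-1) : Fin N → ℤˣ) j : ℤ) : ℂ) =
          -∏ j, ((w j : ℤ) : ℂ) := by
        have e3 : ∏ j, (((Pi.mulSingle j₀ (-1) : Fin N → ℤˣ) j : ℤ) : ℂ) = -1 := by
          rw [Finset.prod_eq_single j₀]
          · simp
          · intro j _ h
            simp [Pi.mulSingle_eq_of_ne h]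
          · simp
        simp only [Pi.mul_apply, Units.val_mul, Int.cast_mul, Finset.prod_mul_distrib]
        rw [e3, mul_neg_one]
      simp only [F, e1, e2, neg_mul]
    have h2 := Equiv.sum_comp (Equiv.mulRight (Pi.mulSingle j₀ (-1) : Fin N → ℤˣ)) F
    simp only [Equiv.coe_mulRight, h1, Finset.sum_neg_distrib] at h2
    exact self_eq_neg.1 h2.symm

lemma sum_bijective_eq_sum_perm {M : Type*} [AddCommMonoid M] (g : (Fin N → Fin N) → M)
    (hg : ∀ f, ¬ Function.Bijective f → g f = 0) :
    ∑ f, g f = ∑ π : Equiv.Perm (Fin N), g π := by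
  refine (Fintype.sum_of_injective (fun π : Equiv.Perm (Fin N) => ⇑π) DFunLike.coe_injective _ _
    (fun f hf => hg f fun hb => hf ⟨Equiv.ofBijective f hb, rfl⟩) fun π => rfl).symm

lemma joinKet_smul_left {N : ℕ} {α β γ : Type*} (e : γ ≃ α × β) (c : ℂ) (ψ : (Fin N → α) → ℂ)
    (χ : (Fin N → β) → ℂ) : joinKet e (c • ψ) χ = c • joinKet e ψ χ := by
  funext x; simp [joinKet, mul_assoc]

lemma joinKet_smul_right {N : ℕ} {α β γ : Type*} (e : γ ≃ α × β) (c : ℂ) (ψ : (Fin N → α) → ℂ)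
    (χ : (Fin N → β) → ℂ) : joinKet e ψ (c • χ) = c • joinKet e ψ χ := by
  funext x; simp [joinKet, mul_left_comm]

lemma joinKet_sum_sum {N : ℕ} {α β γ I J : Type*} [Fintype I] [Fintype J] (e : γ ≃ α × β)
    (ψ : I → (Fin N → α) → ℂ) (χ : J → (Fin N → β) → ℂ) :
    joinKet e (∑ i, ψ i) (∑ j, χ j) = ∑ i, ∑ j, joinKet e (ψ i) (χ j) := by
  funext x; simp [joinKet, Finset.sum_apply, Finset.sum_mul_sum]

/-- Expanding the power of `pairKet` assigns a pair to every party through an index function `f`.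
The sum over signs keeps the bijective `f`, which put the same permutation on both copies; the
signed sum over the permutation applied to `a` then makes the two independent. -/
lemma joinKet_slaterKet_eq_average {N : ℕ} {α γ : Type*} (e : γ ≃ α × α)
    (a b : Fin N → EuclideanSpace ℂ α) :
    joinKet e (slaterKet a) (slaterKet b) =
      (Fintype.card (Equiv.Perm (Fin N) × (Fin N → ℤˣ)) : ℂ)⁻¹ •
        ∑ q : Equiv.Perm (Fin N) × (Fin N → ℤˣ),
          (((Real.sqrt (N : ℝ) : ℝ) : ℂ) ^ N * (sgn q.1 * ∏ j, ((q.2 j : ℤ) : ℂ))) •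
            prodKet fun _ => pairKet e (a ∘ q.1) b q.2 := by
  have hs : ((Real.sqrt (N : ℝ) : ℝ) : ℂ) ^ N * (((Real.sqrt (N : ℝ) : ℝ) : ℂ)⁻¹ ^ N) = 1 := by
    rcases Nat.eq_zero_or_pos N with rfl | h
    · simp
    · have : ((Real.sqrt (N : ℝ) : ℝ) : ℂ) ≠ 0 := by
        have : (0 : ℝ) < N := by exact_mod_cast h
        exact_mod_cast (Real.sqrt_pos.2 this).ne'
      rw [← mul_pow, mul_inv_cancel₀ this, one_pow]
  set G : Equiv.Perm (Fin N) → (Fin N → Fin N) → ((Fin N → γ) → ℂ) := fun τ f =>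
    joinKet e (prodKet fun j => ((a ∘ τ) (f j)).ofLp) (prodKet fun j => (b (f j)).ofLp) with hG
  set D : ℂ := (Fintype.card (Fin N → ℤˣ) : ℂ) with hD
  have hD0 : D ≠ 0 := by rw [hD]; exact_mod_cast Fintype.card_ne_zero
  have h1 : ∀ τ : Equiv.Perm (Fin N), ∑ w : Fin N → ℤˣ,
      (((Real.sqrt (N : ℝ) : ℝ) : ℂ) ^ N * (sgn τ * ∏ j, ((w j : ℤ) : ℂ))) •
        prodKet (fun _ => pairKet e (a ∘ τ) b w) =
      (sgn τ * D) • ∑ π : Equiv.Perm (Fin N), G τ π := by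
    intro τ
    have h2 : ∀ w : Fin N → ℤˣ, (((Real.sqrt (N : ℝ) : ℝ) : ℂ) ^ N *
        (sgn τ * ∏ j, ((w j : ℤ) : ℂ))) • prodKet (fun _ => pairKet e (a ∘ τ) b w) =
        sgn τ • ∑ f : Fin N → Fin N,
          ((∏ j, ((w j : ℤ) : ℂ)) * ∏ j, ((w (f j) : ℤ) : ℂ)) • G τ f := by
      intro w
      rw [prodKet_pairKet, smul_smul, mul_right_comm, hs, one_mul, mul_smul, Finset.smul_sum]
      congr 1
      exact Finset.sum_congr rfl fun f _ => by rw [smul_smul]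
    simp only [h2]
    rw [← Finset.smul_sum, Finset.sum_comm, mul_smul]
    congr 1
    simp only [← Finset.sum_smul, sum_sign_prod]
    rw [sum_bijective_eq_sum_perm _ fun f hf => by rw [if_neg hf, zero_smul], Finset.smul_sum]
    exact Finset.sum_congr rfl fun π _ => by rw [if_pos π.bijective]
  rw [Fintype.sum_prod_type]
  simp only [h1]
  rw [slaterKet_eq_sum, slaterKet_eq_sum, joinKet_smul_left, joinKet_smul_right, smul_smul,
    ← mul_inv, sqrt_factorial_mul_self, joinKet_sum_sum, Fintype.card_prod, Fintype.card_perm,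
    Fintype.card_fin]
  push_cast
  rw [mul_inv, mul_smul]
  congr 1
  simp only [mul_comm _ D, mul_smul, ← Finset.smul_sum]
  rw [← hD, inv_smul_smul₀ hD0, Finset.sum_comm]
  simp only [Finset.smul_sum]
  conv_rhs => rw [Finset.sum_comm]
  refine Finset.sum_congr rfl fun π _ => ?_
  -- With the first permutation written as `τ π`, the sign is `sgn (τ π) * sgn π = sgn τ`.
  rw [← Equiv.sum_comp (Equiv.mulRight π)]
  refine Finset.sum_congr rfl fun τ _ => ?_
  rw [Equiv.coe_mulRight, sgn_mul, joinKet_smul_left, joinKet_smul_right, smul_smul, mul_assoc,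
    sgn_mul_self, mul_one]
  rfl

lemma exists_separable_joinKet_slaterKet {a b : Fin N → EuclideanSpace ℂ α}
    (ha : Orthonormal ℂ a) (hb : Orthonormal ℂ b) :
    ∃ σ ∈ separableStates N γ,
      (((N : ℝ) ^ N) • σ - ketBra (joinKet e (slaterKet a) (slaterKet b))).PosSemidef := by
  refine exists_separable_of_average _ _ (fun q => ?_) (fun q j => ?_)
    (joinKet_slaterKet_eq_average e a b)
  · have : ‖∏ j, ((q.2 j : ℤ) : ℂ)‖ = 1 := by
      rw [norm_prod]
      refine Finset.prod_eq_one fun j _ => ?_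
      rcases Int.units_eq_one_or (q.2 j) with h | h <;> simp [h]
    rw [norm_mul, norm_mul, norm_sgn, this, mul_one, mul_one, norm_pow, Complex.norm_real,
      Real.norm_eq_abs, ← pow_mul, mul_comm N 2, pow_mul, sq_abs, Real.sq_sqrt (by positivity)]
  -- A party `j` exists, so `N` is positive and `pairKet` is normalized.
  · exact isUnitKet_pairKet e j.pos (ha.comp _ q.1.injective) hb _

end UpperBounds

/-! ### Two-copy overlap and the geometric measure -/

section GeometricMeasure

variable {N : ℕ} {α γ : Type*} [Fintype α] [Fintype γ] [DecidableEq α]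
  (e : γ ≃ α × α)

/-- Index functions that are not bijective repeat a vector and are killed by antisymmetrization. The
`N!` bijective ones give equal terms, the same sign occurring in both copies, and cancel the
normalization. -/
lemma joinOp_antisymProj_mulVec_pairKet (b : Fin N → EuclideanSpace ℂ α) :
    (joinOp e (antisymProj N α) (antisymProj N α)).mulVec
        (prodKet fun _ => pairKet e b b 1) =
      (((Real.sqrt (N : ℝ) : ℝ) : ℂ)⁻¹ ^ N) • joinKet e (slaterKet b) (slaterKet b) := by
  rw [prodKet_pairKet, Matrix.mulVec_smul, Matrix.mulVec_sum]
  congr 1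
  have h1 : ∀ f : Fin N → Fin N, (joinOp e (antisymProj N α) (antisymProj N α)).mulVec
      ((∏ j, (((1 : Fin N → ℤˣ) (f j) : ℤ) : ℂ)) • joinKet e (prodKet fun j => (b (f j)).ofLp)
          (prodKet fun j => (b (f j)).ofLp)) =
      (N ! : ℂ)⁻¹ • joinKet e (slaterKet (b ∘ f)) (slaterKet (b ∘ f)) := by
    intro f
    rw [Matrix.mulVec_smul, joinOp_mulVec_joinKet, antisymProj_mulVec_prodKet fun j => b (f j),
      joinKet_smul_left, joinKet_smul_right, smul_smul, smul_smul, mul_assoc, ← mul_inv,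
      sqrt_factorial_mul_self]
    simp
    rfl
  simp only [h1]
  rw [sum_bijective_eq_sum_perm _ fun f hf => by
    rw [slaterKet_comp_eq_zero b hf]
    funext x
    simp [joinKet]]
  have h2 : ∀ π : Equiv.Perm (Fin N), (N ! : ℂ)⁻¹ •
      joinKet e (slaterKet (b ∘ π)) (slaterKet (b ∘ π)) =
      (N ! : ℂ)⁻¹ • joinKet e (slaterKet b) (slaterKet b) := by
    intro π
    rw [slaterKet_comp_perm, joinKet_smul_left, joinKet_smul_right, smul_smul (sgn π),
      sgn_mul_self, one_smul]
  simp only [h2, Finset.sum_const, Finset.card_univ, Fintype.card_perm, Fintype.card_fin]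
  rw [← Nat.cast_smul_eq_nsmul ℂ, smul_smul,
    mul_inv_cancel₀ (by exact_mod_cast N.factorial_ne_zero), one_smul]

lemma star_dotProduct_mulVec_of_proj {n : Type*} [Fintype n] {P ρ : Matrix n n ℂ}
    (hP : P.IsHermitian) (hρ : ρ.IsHermitian) (hPρ : P * ρ = ρ) (v : n → ℂ) :
    star v ⬝ᵥ ρ.mulVec v = star (P.mulVec v) ⬝ᵥ ρ.mulVec (P.mulVec v) := by
  have hρP : ρ * P = ρ := by
    have := congrArg Matrix.conjTranspose hPρ
    rwa [Matrix.conjTranspose_mul, hP.eq, hρ.eq] at this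
  rw [Matrix.mulVec_mulVec, hρP, ← star_dotProduct_mulVec_eq_of_isHermitian hP,
    Matrix.mulVec_mulVec, hPρ]

lemma star_smul_dotProduct_mulVec_smul {n : Type*} [Fintype n] (ρ : Matrix n n ℂ) (c : ℂ)
    (v : n → ℂ) : star (c • v) ⬝ᵥ ρ.mulVec (c • v) =
      ((‖c‖ ^ 2 : ℝ) : ℂ) * (star v ⬝ᵥ ρ.mulVec v) := by
  rw [Matrix.mulVec_smul, star_smul, smul_dotProduct, dotProduct_smul, smul_eq_mul, smul_eq_mul,
    ← mul_assoc, star_mul_self_eq]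

/-- The maximal overlap of two copies of an antisymmetric state with product states. -/
lemma factorial_sq_mul_maxOverlapSq_sq_le [DecidableEq γ] {ρ : Matrix (Fin N → α) (Fin N → α) ℂ}
    (hρ : IsDensityMatrix ρ) (hPρ : antisymProj N α * ρ = ρ) :
    (N ! : ℝ) ^ 2 * maxOverlapSq ρ ^ 2 ≤ (N : ℝ) ^ N * maxOverlapSq (joinOp e ρ ρ) := by
  have hj := hρ.joinOp e hρ
  have hf : (0 : ℝ) < N ! := by exact_mod_cast N.factorial_pos
  set R := (N : ℝ) ^ N * maxOverlapSq (joinOp e ρ ρ) with hR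
  have hR0 : 0 ≤ R := mul_nonneg (by positivity) hj.maxOverlapSq_pos.le
  have key : maxOverlapSq ρ ≤ Real.sqrt R / N ! := by
    refine hρ.maxOverlapSq_le fun v hv => ?_
    -- Only the antisymmetric part of the product vector matters. If nonzero, it is `c/√N!` times
    -- the Slater vector of an orthonormal family `b` with `‖c‖ ≤ 1`.
    rw [star_dotProduct_mulVec_of_proj isHermitian_antisymProj hρ.1.isHermitian hPρ]
    have h := antisymProj_mulVec_prodKet fun j => WithLp.toLp 2 (v j)
    change (antisymProj N α).mulVec (prodKet v) = _ at h
    rw [h, star_smul_dotProduct_mulVec_smul, norm_inv_sqrt_factorial_sq, Complex.re_ofReal_mul]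
    rcases slaterKet_eq_smul fun j => WithLp.toLp 2 (v j) with h0 | ⟨b, c, hb, hc, h0⟩
    · rw [h0, Matrix.mulVec_zero, dotProduct_zero, Complex.zero_re, mul_zero]
      positivity
    rw [h0, star_smul_dotProduct_mulVec_smul, Complex.re_ofReal_mul]
    have hc1 : ‖c‖ ≤ 1 := by
      refine hc.trans_eq (Finset.prod_eq_one fun j _ => ?_)
      rw [← isUnitKet_iff_norm]
      exact hv j
    have hm := hρ.1.dotProduct_mulVec_nonneg (slaterKet b)
    set m := (star (slaterKet b) ⬝ᵥ ρ.mulVec (slaterKet b)).re with hmdef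
    have hm0 : 0 ≤ m := (Complex.le_def.1 hm).1
    have hmc : star (slaterKet b) ⬝ᵥ ρ.mulVec (slaterKet b) = (m : ℂ) :=
      Complex.ext rfl (Complex.le_def.1 hm).2.symm
    -- The two-copy candidate pairs `b` with itself. Its projection is `N^{-N/2}` times two copies
    -- of the Slater vector of `b`, so its overlap is `m² / N^N`.
    have hmR : m ^ 2 ≤ R := by
      have hle := hj.le_maxOverlapSq (ketBra_prodKet_mem (v := fun _ : Fin N => pairKet e b b 1)
        fun j => isUnitKet_pairKet e j.pos hb hb 1)
      rw [trace_mul_ketBra, star_dotProduct_mulVec_of_proj (isHermitian_joinOp e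
        isHermitian_antisymProj isHermitian_antisymProj) hj.1.isHermitian
        (by rw [joinOp_mul_joinOp, hPρ]), joinOp_antisymProj_mulVec_pairKet,
        star_smul_dotProduct_mulVec_smul, joinOp_mulVec_joinKet, star_joinKet_dotProduct, hmc,
        Complex.re_ofReal_mul, ← Complex.ofReal_mul, Complex.ofReal_re, norm_pow, norm_inv,
        Complex.norm_real, Real.norm_eq_abs, ← pow_mul, mul_comm N 2, pow_mul, inv_pow, sq_abs,
        Real.sq_sqrt (by positivity), inv_pow] at hle
      have hN : (0 : ℝ) < (N : ℝ) ^ N := by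
        rcases Nat.eq_zero_or_pos N with h | h
        · simp [h]
        · positivity
      rw [inv_mul_le_iff₀ hN] at hle
      rw [sq]
      exact hle
    rw [div_eq_inv_mul]
    refine mul_le_mul_of_nonneg_left ?_ (by positivity)
    calc ‖c‖ ^ 2 * m ≤ 1 * m := by
          gcongr
          exact pow_le_one₀ (norm_nonneg _) hc1
      _ = m := one_mul m
      _ ≤ Real.sqrt R := Real.le_sqrt_of_sq_le hmR
  rw [le_div_iff₀ hf, mul_comm] at key
  rw [← mul_pow]
  calc _ ≤ (Real.sqrt R) ^ 2 := by
        have := hρ.maxOverlapSq_pos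
        gcongr
    _ = R := Real.sq_sqrt hR0

end GeometricMeasure

/-- Reversing one factorial pairs `i + 1` with `N - i`. Each of the `N` products is at least `N`,
strictly so at `i = 1`. -/
lemma pow_self_lt_factorial_sq {N : ℕ} (hN : 3 ≤ N) : N ^ N < N ! ^ 2 := by
  have h1 : N ! ^ 2 = ∏ i ∈ Finset.range N, (i + 1) * (N - i) := by
    rw [Finset.prod_mul_distrib, Finset.prod_range_add_one_eq_factorial, sq]
    congr 1
    rw [← Finset.prod_range_reflect, ← Finset.prod_range_add_one_eq_factorial]
    refine Finset.prod_congr rfl fun i hi => ?_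
    have := Finset.mem_range.1 hi
    omega
  have h2 : N ^ N = ∏ i ∈ Finset.range N, N := by simp
  rw [h1, h2]
  have key : ∀ i < N, N ≤ (i + 1) * (N - i) := by
    intro i hi
    obtain ⟨k, rfl⟩ : ∃ k, N = i + 1 + k := ⟨N - (i + 1), by omega⟩
    have : i + 1 + k - i = k + 1 := by omega
    rw [this]
    nlinarith [Nat.zero_le (i * k)]
  refine Finset.prod_lt_prod (fun i _ => by omega) (fun i hi => key i (Finset.mem_range.1 hi))
    ⟨1, Finset.mem_range.2 (by omega), by omega⟩

/-! ### Mixtures of Slater states -/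

section Mixtures

variable {N : ℕ} {α ι : Type*} [Fintype α] [Fintype ι] {p : ι → ℝ}
  {a : ι → Fin N → EuclideanSpace ℂ α} {ρ : Matrix (Fin N → α) (Fin N → α) ℂ}

lemma antisymProj_mul_mixture [DecidableEq α] (hρ : ρ = ∑ i, p i • ketBra (slaterKet (a i))) :
    antisymProj N α * ρ = ρ := by
  rw [hρ, Matrix.mul_sum]
  refine Finset.sum_congr rfl fun i _ => ?_
  rw [Matrix.mul_smul, ketBra, Matrix.mul_vecMulVec,
    (antisymmetric_slaterKet (a i)).antisymProj_mulVec]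

lemma isDensityMatrix_slaterMixture (hp : ∀ i, 0 ≤ p i) (hp1 : ∑ i, p i = 1)
    (ha : ∀ i, Orthonormal ℂ (a i)) (hρ : ρ = ∑ i, p i • ketBra (slaterKet (a i))) :
    IsDensityMatrix ρ := by
  rw [hρ]
  exact isDensityMatrix_mixture hp hp1 fun i => isUnitKet_slaterKet (ha i)

/-- `ρ ⊗ ρ` mixes pairs of possibly different Slater states with weights `p i * p j`, so domination
is needed for two distinct families. -/
lemma logGlobalRobustness_joinOp_slaterMixture_le {γ : Type*} [Fintype γ] [DecidableEq γ]
    (e : γ ≃ α × α) (hp : ∀ i, 0 ≤ p i) (hp1 : ∑ i, p i = 1)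
    (ha : ∀ i, Orthonormal ℂ (a i)) (hρ : ρ = ∑ i, p i • ketBra (slaterKet (a i))) :
    logGlobalRobustness (joinOp e ρ ρ) ≤ (N : ℝ) * Real.logb 2 (N : ℝ) := by
  have hρd := isDensityMatrix_slaterMixture hp hp1 ha hρ
  obtain ⟨σ, hσ, h⟩ := exists_separable_of_mixture (p := fun q : ι × ι => p q.1 * p q.2)
    (fun q => mul_nonneg (hp _) (hp _))
    (by rw [Fintype.sum_prod_type, ← Finset.sum_mul_sum, hp1, one_mul])
    fun q => exists_separable_joinKet_slaterKet e (ha q.1) (ha q.2)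
  rw [← joinOp_sum_smul_ketBra e (fun i => slaterKet (a i)) fun i => slaterKet (a i), ← hρ] at h
  have h1 : (1 : ℝ) ≤ (N : ℝ) ^ N := by
    rcases Nat.eq_zero_or_pos N with rfl | hN
    · simp
    · exact one_le_pow₀ (by exact_mod_cast hN)
  have := (hρd.joinOp e hρd).logGlobalRobustness_le h1 hσ h
  rwa [Real.logb_pow] at this

variable [DecidableEq α]

lemma logGlobalRobustness_slaterMixture_le (hp : ∀ i, 0 ≤ p i) (hp1 : ∑ i, p i = 1)
    (ha : ∀ i, Orthonormal ℂ (a i)) (hρ : ρ = ∑ i, p i • ketBra (slaterKet (a i))) :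
    logGlobalRobustness ρ ≤ Real.logb 2 (N ! : ℝ) := by
  obtain ⟨σ, hσ, h⟩ := exists_separable_of_mixture hp hp1 fun i => exists_separable_slaterKet (ha i)
  rw [← hρ] at h
  exact (isDensityMatrix_slaterMixture hp hp1 ha hρ).logGlobalRobustness_le
    (by exact_mod_cast N.factorial_pos) hσ h

lemma logb_factorial_le_relEntropyEntanglement (hρd : IsDensityMatrix ρ)
    (hPρ : antisymProj N α * ρ = ρ) :
    ((Real.logb 2 (N ! : ℝ) : ℝ) : EReal) ≤ relEntropyEntanglement ρ := by
  have hf : (0 : ℝ) < N ! := by exact_mod_cast N.factorial_pos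
  have := hρd.neg_logb_le_relEntropyEntanglement isHermitian_antisymProj antisymProj_mul_self hPρ
    (inv_pos.2 hf) antisymProj_overlap_le
  rwa [Real.logb_inv, neg_neg] at this

lemma logb_le_relEntropyEntanglement_joinOp {γ : Type*} [Fintype γ] [DecidableEq γ]
    (e : γ ≃ α × α) (hN : N ≤ Fintype.card α) (hρd : IsDensityMatrix ρ)
    (hPρ : antisymProj N α * ρ = ρ) :
    ((Real.logb 2 ((Fintype.card α : ℝ) ^ N * (N ! : ℝ) * ((Fintype.card α - N)! : ℝ) /
      ((Fintype.card α)! : ℝ)) : ℝ) : EReal) ≤ relEntropyEntanglement (joinOp e ρ ρ) := by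
  have hd : (0 : ℝ) < (Fintype.card α : ℝ) ^ N := by
    rcases Nat.eq_zero_or_pos N with rfl | h
    · simp
    · have : 0 < Fintype.card α := by omega
      positivity
  have hf : (0 : ℝ) < N ! := by exact_mod_cast N.factorial_pos
  have hdf : (0 : ℝ) < (Fintype.card α).descFactorial N := by
    exact_mod_cast Nat.descFactorial_pos.2 hN
  have := (hρd.joinOp e hρd).neg_logb_le_relEntropyEntanglement
    (isHermitian_joinOp e isHermitian_antisymProj isHermitian_antisymProj)
    (by rw [joinOp_mul_joinOp, antisymProj_mul_self]) (by rw [joinOp_mul_joinOp, hPρ])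
    (div_pos hdf (mul_pos hf hd)) (joinOp_antisymProj_overlap_le e hN)
  rw [← Real.logb_inv, inv_div] at this
  have hdn : (0 : ℝ) < (Fintype.card α - N)! := by exact_mod_cast Nat.factorial_pos _
  have heq : (Fintype.card α : ℝ) ^ N * (N ! : ℝ) * ((Fintype.card α - N)! : ℝ) /
      ((Fintype.card α)! : ℝ) =
      (N ! : ℝ) * (Fintype.card α : ℝ) ^ N / (Fintype.card α).descFactorial N := by
    rw [← Nat.factorial_mul_descFactorial hN]
    push_cast
    field_simp
  rwa [heq]

lemma mul_logb_self_lt {N : ℕ} (hN : 3 ≤ N) :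
    (N : ℝ) * Real.logb 2 (N : ℝ) < 2 * Real.logb 2 (N ! : ℝ) := by
  have h : (N : ℝ) ^ N < (N ! : ℝ) ^ 2 := by exact_mod_cast pow_self_lt_factorial_sq hN
  have hN0 : (0 : ℝ) < (N : ℝ) ^ N := by
    have : 0 < N := by omega
    positivity
  have := Real.logb_lt_logb one_lt_two hN0 h
  rw [Real.logb_pow, Real.logb_pow] at this
  exact_mod_cast this

/-- From `(N!)² Λ⁴(ρ) ≤ N^N Λ²(ρ ⊗ ρ)` and `N^N < (N!)²` the strict inequality follows without
knowing the value of GM. -/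
lemma geometricMeasure_joinOp_lt {γ : Type*} [Fintype γ] [DecidableEq γ] (e : γ ≃ α × α)
    (hN : 3 ≤ N) (hρd : IsDensityMatrix ρ) (hPρ : antisymProj N α * ρ = ρ) :
    geometricMeasure (joinOp e ρ ρ) < 2 * geometricMeasure ρ := by
  have hj := hρd.joinOp e hρd
  have h0 := hρd.maxOverlapSq_pos
  have hj0 := hj.maxOverlapSq_pos
  rw [hρd.geometricMeasure_eq, hj.geometricMeasure_eq, mul_neg, neg_lt_neg_iff]
  have h := factorial_sq_mul_maxOverlapSq_sq_le e hρd hPρ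
  have hlt : (N : ℝ) ^ N < (N ! : ℝ) ^ 2 := by exact_mod_cast pow_self_lt_factorial_sq hN
  have hf : (0 : ℝ) < (N ! : ℝ) ^ 2 := by
    have : (0 : ℝ) < N ! := by exact_mod_cast N.factorial_pos
    positivity
  have key : maxOverlapSq ρ ^ 2 < maxOverlapSq (joinOp e ρ ρ) := by
    refine lt_of_mul_lt_mul_left (h.trans_lt ?_) hf.le
    gcongr
  have := Real.logb_lt_logb one_lt_two (by positivity) key
  rw [Real.logb_pow] at this
  exact_mod_cast this

end Mixtures

end MultipartiteEntanglement

/-! ### The proposition -/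

theorem mainTheorem12 {N d : ℕ} (hNd : N ≤ d) {ι : Type*} [Fintype ι]
    (p : ι → ℝ) (hp_nonneg : ∀ i, 0 ≤ p i) (hp_sum : ∑ i, p i = 1)
    (a : ι → Fin N → EuclideanSpace ℂ (Fin d)) (ha : ∀ i, Orthonormal ℂ (a i))
    (ρ : Matrix (Fin N → Fin d) (Fin N → Fin d) ℂ)
    (hρ : ρ = ∑ i, p i •
      ketBra (slaterKet (a i))) :
    (relEntropyEntanglement ρ = ((Real.logb 2 (N ! : ℝ) : ℝ) : EReal) ∧
      logGlobalRobustness ρ = Real.logb 2 (N ! : ℝ)) ∧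
    (((Real.logb 2 ((d : ℝ) ^ N * (N ! : ℝ) * ((d - N)! : ℝ) / (d ! : ℝ)) : ℝ) : EReal) ≤
        relEntropyEntanglement
          (tensorPower ρ 2) ∧
      relEntropyEntanglement
          (tensorPower ρ 2) ≤
        ((logGlobalRobustness
          (tensorPower ρ 2) : ℝ) : EReal) ∧
      logGlobalRobustness
          (tensorPower ρ 2) ≤ (N : ℝ) * Real.logb 2 (N : ℝ)) ∧
    (3 ≤ N →
      (geometricMeasure (tensorPower ρ 2) <
          2 * geometricMeasure ρ ∧
        IsNonadditive
          (fun _ _ _ τ => ((geometricMeasure τ : ℝ) : EReal)) ρ) ∧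
      (relEntropyEntanglement
          (tensorPower ρ 2) <
          2 * relEntropyEntanglement ρ ∧
        IsNonadditive
          (fun _ _ _ τ => relEntropyEntanglement τ) ρ) ∧
      (logGlobalRobustness
          (tensorPower ρ 2) <
          2 * logGlobalRobustness ρ ∧
        IsNonadditive
          (fun _ _ _ τ => ((logGlobalRobustness τ : ℝ) : EReal)) ρ)) := by
  have hρd := isDensityMatrix_slaterMixture hp_nonneg hp_sum ha hρ
  have hPρ := antisymProj_mul_mixture hρ
  have hER_ge := logb_factorial_le_relEntropyEntanglement hρd hPρ
  have hRL_le := logGlobalRobustness_slaterMixture_le hp_nonneg hp_sum ha hρ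
  have hle := hρd.relEntropyEntanglement_le
  -- The chain `log N! ≤ E_R ≤ R_L ≤ log N!` closes and determines both measures.
  have hER : relEntropyEntanglement ρ = ((Real.logb 2 (N ! : ℝ) : ℝ) : EReal) :=
    le_antisymm (hle.trans (EReal.coe_le_coe_iff.2 hRL_le)) hER_ge
  have hRL : logGlobalRobustness ρ = Real.logb 2 (N ! : ℝ) :=
    le_antisymm hRL_le (EReal.coe_le_coe_iff.1 (hER_ge.trans hle))
  have hle2 := (hρd.tensorPower 2).relEntropyEntanglement_le
  have hRL2 : logGlobalRobustness (tensorPower ρ 2) ≤ (N : ℝ) * Real.logb 2 (N : ℝ) := by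
    rw [tensorPower_two]
    exact logGlobalRobustness_joinOp_slaterMixture_le _ hp_nonneg hp_sum ha hρ
  refine ⟨⟨hER, hRL⟩, ⟨?_, hle2, hRL2⟩, fun hN => ?_⟩
  · have := logb_le_relEntropyEntanglement_joinOp (finTwoArrowEquiv (Fin d))
      (by simpa using hNd) hρd hPρ
    rw [tensorPower_two]
    simpa only [Fintype.card_fin] using this
  have hlt := mul_logb_self_lt hN
  have hG : geometricMeasure (tensorPower ρ 2) < 2 * geometricMeasure ρ := by
    rw [tensorPower_two]
    exact geometricMeasure_joinOp_lt _ hN hρd hPρ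
  have hR : logGlobalRobustness (tensorPower ρ 2) < 2 * logGlobalRobustness ρ := by
    rw [hRL]
    exact hRL2.trans_lt hlt
  have hE : relEntropyEntanglement (tensorPower ρ 2) < 2 * relEntropyEntanglement ρ := by
    rw [hER]
    refine (hle2.trans (EReal.coe_le_coe_iff.2 hRL2)).trans_lt ?_
    have h := EReal.coe_lt_coe_iff.2 hlt
    rw [EReal.coe_mul 2] at h
    exact h
  exact ⟨⟨hG, isNonadditive_geometricMeasure hρd hG⟩,
    ⟨hE, isNonadditive_relEntropyEntanglement hρd hE⟩,
    ⟨hR, isNonadditive_logGlobalRobustness hρd hR⟩⟩
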